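/- Let $G_{\mathrm D}$ be $O(d,d+m)$ ($d,m\ge 0$; the case $m=0$ is $O(d,d)$) or $E_{d(d)}$ with $d\le 7$, with $R_1$ the vector representation for $O(d,d+m)$, and for $E_{d(d)}$ the representation which decomposes under $GL(d)$ into vectors, 2-forms, 5-forms and (7,1)-tensors (of dimension $3,6,10,16,27,56$ for $d=2,\dots,7$). Let $t_{\boldsymbol a}$ be generators of $G_{\mathrm D}$ in $R_1$, $t^{\boldsymbol a}$ the dual generators for the invariant form $-\frac1\alpha\operatorname{tr}(t\,t')$ ($\alpha=2$ for $O(d,d+m)$, $\alpha=3,4,6,12$ for $E_{4},\dots,E_{7}$, and the same standard normalization for $d<4$), $\beta=0$ for $O(d,d+m)$ and $\beta=\frac1{9-d}$ for $E_{d(d)}$, and $$Y^{IJ}_{KL}=\delta^I_K\delta^J_L+(t^{\boldsymbol a})_K{}^J(t_{\boldsymbol a})_L{}^I+\beta\,\delta^I_L\delta^J_K .$$ Let $\mathfrak t_\alpha$ ($\alpha=1,\dots,n$) be linearly independent elements of the Lie algebra of $G_{\mathrm D}$ (in $R_1$) with $[\mathfrak t_\alpha,\mathfrak t_\beta]=f_{\alpha\beta}{}^\gamma\mathfrak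 t_\gamma$, generating a subgroup $G_{\mathrm S}$. On an open set $U\subset\mathbb R^{\dim R_1}$ with coordinates $y^I$ let $E_A{}^I$ be a smooth generalized frame, with values in $G_{\mathrm D}$ (in $\mathbb R^+\times G_{\mathrm D}$ for $E_{d(d)}$), let $\Omega_A{}^\alpha$ be smooth functions, and put $\Omega_{AB}{}^C=\Omega_A{}^\alpha(\mathfrak t_\alpha)_B{}^C$ and $\Omega_{IA}{}^B=E_I{}^C\,\Omega_{CA}{}^B$, where $E_I{}^A$ is the inverse of $E_A{}^I$. (i) The vielbein postulate $\partial_IE_A{}^J-\Omega_{IA}{}^BE_B{}^J+\Gamma_{IK}{}^JE_A{}^K=0$ on $U$ holds for exactly one affine connection $\Gamma$ on $U$, namely $\Gamma_{IK}{}^J=E_K{}^A\bigl(-\partial_IE_A{}^J+\Omega_{IA}{}^BE_B{}^J\bigr)$. Write $\Gamma_{AB}{}^C=E_A{}^IE_B{}^K\Gamma_{IK}{}^JE_J{}^C$, and $$\mathcal T_{AB}{}^C=2\,\Gamma_{[AB]}{}^C+Y^{EC}_{BD}\,\Gamma_{EA}{}^D=\Gamma_{AB}{}^C-\Gamma_{BA}{}^C+Y^{EC}_{BD}\,\Gamma_{EA}{}^D$$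 for its generalized torsion. (ii) On the mega-space, with coordinates $y^\mu$ on $G_{\mathrm S}$, $y^I$, and further ones on which nothing depends, restrict to the components $\hat A=(\alpha,A)$ in the two highest levels, which close among themselves and determine the level-0 part of the fluxes. There the frame is $\hat E=\tilde M NV$, where $$\tilde M=\exp(y^\mu\mathfrak t_\mu),\qquad N=\begin{pmatrix}1&0\\-\Omega_A{}^\beta&1\end{pmatrix},\qquad V=\begin{pmatrix}\tilde v_\alpha{}^\mu&0\\0&E_A{}^I\end{pmatrix};$$ here $\mathfrak t_\alpha$ acts block-diagonally, on the index $\alpha$ by $(\mathfrak t_\alpha)_\beta{}^\gamma=-f_{\alpha\beta}{}^\gamma$, and $\tilde v$ is smooth and invertible with $\tilde M^{-1}\tilde v_\alpha{}^\mu\partial_\mu\tilde M=\mathfrak t_\alpha$. Let $\hat Y$ be the restriction to these components of the Y-tensor of the mega-space duality group, $W_{\hat A\hat B}{}^{\hat C}=-\hat E_{\hat A}{}^{\hat J}\partial_{\hat J}\hat E_{\hat B}{}^{\hat I}\hat E_{\hat I}{}^{\hat C}$, and $\hat X_{\hat A\hat B}{}^{\hat C}=2W_{[\hat A\hat B]}{}^{\hat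 C}+\hat Y^{\hat E\hat C}_{\hat B\hat D}W_{\hat E\hat A}{}^{\hat D}$. Then the level-0 component of the untwisted fluxes is the generalized torsion of the connection defined by $\Omega$: $$X_{AB}{}^C:=(\tilde M^{-1})_A{}^{\hat D}(\tilde M^{-1})_B{}^{\hat E}\,\hat X_{\hat D\hat E}{}^{\hat F}\,\tilde M_{\hat F}{}^C=\mathcal T_{AB}{}^C .$$ (iii) The torsion is covariant. Let $\xi^I$ and $\xi^\alpha$ be smooth on $U$, and suppose that the section condition holds for the fields $E_A{}^I,\Omega_A{}^\alpha,\xi^I,\xi^\alpha$, i.e. $Y^{IJ}_{KL}\,\partial_If\,\partial_Jg=0$ and $Y^{IJ}_{KL}\,\partial_I\partial_Jf=0$ on $U$ for all components $f,g$ of these fields. With $\xi_A{}^B=\xi^\gamma(\mathfrak t_\gamma)_A{}^B$, consider the infinitesimal gauge transformation $$\delta E_A{}^I=\xi^J\partial_JE_A{}^I-E_A{}^J\partial_J\xi^I+Y^{IJ}_{KL}\,\partial_J\xi^K\,E_A{}^L+\xi_A{}^BE_B{}^I,$$ $$\delta\Omega_A{}^\alpha=\xi^K\partial_K\Omega_A{}^\alpha+\xi_A{}^C\,\Omega_C{}^\alpha+\Omega_A{}^\beta\,\xi^\gamma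 f_{\gamma\beta}{}^\alpha+E_A{}^I\partial_I\xi^\alpha .$$ Then on $U$ the variation $\delta\mathcal T=\frac{d}{d\varepsilon}\big|_{\varepsilon=0}\mathcal T[E+\varepsilon\,\delta E,\Omega+\varepsilon\,\delta\Omega]$ exists and equals $$\delta\mathcal T_{AB}{}^C=\xi^K\partial_K\mathcal T_{AB}{}^C+\xi_A{}^D\,\mathcal T_{DB}{}^C+\xi_B{}^D\,\mathcal T_{AD}{}^C-\mathcal T_{AB}{}^D\,\xi_D{}^C .$$ -/

import Mathlib

open scoped ContDiff
open Matrix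

noncomputable section

namespace GenGeom

/-! ## Duality groups, their first representation and their Y-tensor -/

/-- The data of a duality group that enter generalized geometry: the index set of the
representation `R₁`, the generators `t_a` and the dual generators `t^a` in that representation
(`t a K L` is the entry in row `K` and column `L`, i.e. `(t_a)_K^L`), the weight `β`, and the set
of matrices in which a generalized frame takes its values. -/
structure DualityDatum : Type 1 where
  Idx : Type
  fintypeIdx : Fintype Idx
  decEqIdx : DecidableEq Idx
  Adj : Type
  fintypeAdj : Fintype Adj
  t : Adj → Matrix Idx Idx ℝ
  tDual : Adj → Matrix Idx Idx ℝ
  β : ℝ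
  frameGroup : Set (Matrix Idx Idx ℝ)

instance (D : DualityDatum) : Fintype D.Idx := D.fintypeIdx
instance (D : DualityDatum) : DecidableEq D.Idx := D.decEqIdx
instance (D : DualityDatum) : Fintype D.Adj := D.fintypeAdj

/-- Kronecker delta. -/
def kd {κ : Type*} [DecidableEq κ] (i j : κ) : ℝ := if i = j then 1 else 0

/-- The Lie algebra of the duality group, in the representation `R₁`. -/
def DualityDatum.lieAlgebra (D : DualityDatum) : Submodule ℝ (Matrix D.Idx D.Idx ℝ) :=
  Submodule.span ℝ (Set.range D.t)

/-- `Y I J K L` is `Y^{IJ}_{KL} = δ^I_K δ^J_L + (t^a)_K^J (t_a)_L^I + β δ^I_L δ^J_K`. -/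
def DualityDatum.Y (D : DualityDatum) (I J K L : D.Idx) : ℝ :=
  kd I K * kd J L + ∑ a, D.tDual a K J * D.t a L I + D.β * (kd I L * kd J K)

/-! ### The orthogonal group `O(d, d + m)` -/

/-- Index set of the vector representation of `O(d, d + m)`. -/
abbrev OrthIdx (d m : ℕ) : Type := Fin d ⊕ (Fin d ⊕ Fin m)

/-- The invariant metric of signature `(d, d + m)`; it is its own inverse. -/
def orthEta (d m : ℕ) : Matrix (OrthIdx d m) (OrthIdx d m) ℝ := Matrix.of fun
  | .inl i, .inr (.inl j) => kd i j
  | .inr (.inl i), .inl j => kd i j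
  | .inr (.inr i), .inr (.inr j) => kd i j
  | _, _ => 0

/-- The vector representation of `O(d, d + m)`, with generators
`(t_{MN})_L^I = η_{ML} δ_N^I - η_{NL} δ_M^I`; the factor `1 / 2` in the dual generators accounts
for the sum over all ordered pairs. -/
def orthDatum (d m : ℕ) : DualityDatum where
  Idx := OrthIdx d m
  fintypeIdx := inferInstance
  decEqIdx := inferInstance
  Adj := OrthIdx d m × OrthIdx d m
  fintypeAdj := inferInstance
  t := fun p => Matrix.of fun L I => orthEta d m p.1 L * kd p.2 I - orthEta d m p.2 L * kd p.1 I
  tDual := fun p => Matrix.of fun K J =>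
    (1 / 2) * (kd p.1 K * orthEta d m p.2 J - kd p.2 K * orthEta d m p.1 J)
  β := 0
  frameGroup := {M | M * orthEta d m * Mᵀ = orthEta d m}

/-! ### The exceptional groups `E_{d(d)}`, `d ≤ 7` -/

/-- Antisymmetric multi-indices `a₁ < ⋯ < a_p` with values in `Fin d`. -/
abbrev Multi (d p : ℕ) : Type := {s : Finset (Fin d) // s.card = p}

/-- The increasing tuple of a multi-index. -/
def Multi.tup {d p : ℕ} (s : Multi d p) : Fin p → Fin d := s.1.orderEmbOfFin s.2

/-- Generalized Kronecker delta `δ^{a₁ ⋯ a_p}_{b₁ ⋯ b_p}` (equal to `± 1` or `0`). -/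
def gkd {d : ℕ} (p : ℕ) (a b : Fin p → Fin d) : ℝ :=
  Matrix.det (Matrix.of fun i j => kd (a i) (b j))

/-- Index set of the representation `R₁` of `E_{d(d)}` in its `GL(d)` decomposition: vectors,
two-forms, five-forms, and the mixed-symmetry tensors with seven antisymmetric indices and
one more index. -/
abbrev ExcIdx (d : ℕ) : Type := Fin d ⊕ (Multi d 2 ⊕ (Multi d 5 ⊕ (Multi d 7 × Fin d)))

instance (d : ℕ) : DecidableEq (ExcIdx d) := inferInstance
instance (d : ℕ) : Fintype (ExcIdx d) := inferInstance

/-- The generator `R_{c₁c₂c₃}`. -/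
def excR3Lo {d : ℕ} (c : Multi d 3) : Matrix (ExcIdx d) (ExcIdx d) ℝ := Matrix.of fun
  | .inr (.inl a), .inl b => gkd 3 (Fin.append ![b] a.tup) c.tup
  | .inr (.inr (.inl a)), .inr (.inl b) => - gkd 5 a.tup (Fin.append b.tup c.tup)
  | .inr (.inr (.inr a)), .inr (.inr (.inl b)) =>
      - ∑ e : Multi d 2, gkd 7 a.1.tup (Fin.append b.tup e.tup)
          * gkd 3 (Fin.append e.tup ![a.2]) c.tup
  | _, _ => 0

/-- The generator `R^{c₁c₂c₃}`. -/
def excR3Up {d : ℕ} (c : Multi d 3) : Matrix (ExcIdx d) (ExcIdx d) ℝ := Matrix.of fun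
  | .inl a, .inr (.inl b) => - gkd 3 c.tup (Fin.append ![a] b.tup)
  | .inr (.inl a), .inr (.inr (.inl b)) => gkd 5 (Fin.append a.tup c.tup) b.tup
  | .inr (.inr (.inl a)), .inr (.inr (.inr b)) =>
      ∑ e : Multi d 2, gkd 7 (Fin.append a.tup e.tup) b.1.tup
        * gkd 3 c.tup (Fin.append e.tup ![b.2])
  | _, _ => 0

/-- The generator `R_{c₁⋯c₆}`. -/
def excR6Lo {d : ℕ} (c : Multi d 6) : Matrix (ExcIdx d) (ExcIdx d) ℝ := Matrix.of fun
  | .inr (.inr (.inl a)), .inl b => gkd 6 (Fin.append ![b] a.tup) c.tup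
  | .inr (.inr (.inr a)), .inr (.inl b) =>
      - ∑ e : Fin d, gkd 2 ![a.2, e] b.tup * gkd 7 a.1.tup (Fin.append c.tup ![e])
  | _, _ => 0

/-- The generator `R^{c₁⋯c₆}`. -/
def excR6Up {d : ℕ} (c : Multi d 6) : Matrix (ExcIdx d) (ExcIdx d) ℝ := Matrix.of fun
  | .inl a, .inr (.inr (.inl b)) => - gkd 6 c.tup (Fin.append ![a] b.tup)
  | .inr (.inl a), .inr (.inr (.inr b)) =>
      ∑ e : Fin d, gkd 2 a.tup ![b.2, e] * gkd 7 (Fin.append c.tup ![e]) b.1.tup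
  | _, _ => 0

/-- The action of the `gl(d)` generator `K^c_k` on antisymmetric indices with values
in `Multi d (q + 1)`. -/
def glForm {d : ℕ} (q : ℕ) (c k : Fin d) (a b : Multi d (q + 1)) : ℝ :=
  - ∑ e : Multi d q, gkd (1 + q) (a.tup ∘ Fin.cast (Nat.add_comm 1 q)) (Fin.append ![k] e.tup)
      * gkd (1 + q) (Fin.append ![c] e.tup) (b.tup ∘ Fin.cast (Nat.add_comm 1 q))

/-- The generator `K^c_k` of `gl(d)`; the multiple of the identity puts it into `E_{d(d)}`. -/
def excK {d : ℕ} (c k : Fin d) : Matrix (ExcIdx d) (ExcIdx d) ℝ :=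
  (Matrix.of fun
    | .inl a, .inl b => kd a c * kd k b
    | .inr (.inl a), .inr (.inl b) => glForm 1 c k a b
    | .inr (.inr (.inl a)), .inr (.inr (.inl b)) => glForm 4 c k a b
    | .inr (.inr (.inr a)), .inr (.inr (.inr b)) =>
        glForm 6 c k a.1 b.1 * kd a.2 b.2 - kd a.1 b.1 * (kd a.2 k * kd b.2 c)
    | _, _ => 0)
  + (kd c k / (9 - d)) • (1 : Matrix (ExcIdx d) (ExcIdx d) ℝ)

/-- The label set of the generators `R_{c₃}`, `R^{c₃}`, `R_{c₆}`, `R^{c₆}`, `K^c_k`. -/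
abbrev ExcAdj (d : ℕ) : Type :=
  Multi d 3 ⊕ (Multi d 3 ⊕ (Multi d 6 ⊕ (Multi d 6 ⊕ (Fin d × Fin d))))

/-- The generators `t_a` of `E_{d(d)}` in the representation `R₁`. -/
def excGen {d : ℕ} : ExcAdj d → Matrix (ExcIdx d) (ExcIdx d) ℝ
  | .inl c => excR3Lo c
  | .inr (.inl c) => excR3Up c
  | .inr (.inr (.inl c)) => excR6Lo c
  | .inr (.inr (.inr (.inl c))) => excR6Up c
  | .inr (.inr (.inr (.inr p))) => excK p.1 p.2

/-- The generators `t^a`, dual to the `t_a` for the invariant form `-(1/α) tr(t t')`, where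
`α = 3, 4, 6, 12` for `d = 4, 5, 6, 7`. -/
def excGenDual {d : ℕ} : ExcAdj d → Matrix (ExcIdx d) (ExcIdx d) ℝ
  | .inl c => excR3Up c
  | .inr (.inl c) => excR3Lo c
  | .inr (.inr (.inl c)) => excR6Up c
  | .inr (.inr (.inr (.inl c))) => excR6Lo c
  | .inr (.inr (.inr (.inr p))) => - excK p.2 p.1 + (kd p.1 p.2 / 9) • ∑ a : Fin d, excK a a

/-- The group `ℝ⁺ × E_{d(d)}` acting in the representation `R₁`, where `E_{d(d)}` is generated by
the exponentials of its Lie algebra. -/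
def excFrameGroup (d : ℕ) : Set (Matrix (ExcIdx d) (ExcIdx d) ℝ) :=
  {M | ∃ c : ℝ, 0 < c ∧
    ∃ g ∈ Submonoid.closure
        {h : Matrix (ExcIdx d) (ExcIdx d) ℝ |
          ∃ A ∈ Submodule.span ℝ (Set.range (excGen (d := d))), h = NormedSpace.exp A},
      M = c • g}

/-- The duality group `E_{d(d)}`, for `d ≤ 7`. Since `β ≠ 0`, frames may be rescaled. -/
def excDatum (d : ℕ) : DualityDatum where
  Idx := ExcIdx d
  fintypeIdx := inferInstance
  decEqIdx := inferInstance
  Adj := ExcAdj d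
  fintypeAdj := inferInstance
  t := excGen
  tDual := excGenDual
  β := 1 / (9 - d)
  frameGroup := excFrameGroup d

/-- The duality groups: `O(d, d + m)` (`m = 0` is `O(d, d)`), and `E_{d(d)}` for `d ≤ 7`. -/
inductive DualityGroup : Type
  | orthogonal (d m : ℕ) : DualityGroup
  | exceptional (d : ℕ) (hd : d ≤ 7) : DualityGroup

def DualityGroup.datum : DualityGroup → DualityDatum
  | .orthogonal d m => orthDatum d m
  | .exceptional d _ => excDatum d

/-! ## Fields, generalized Lie derivative, section condition -/

/-- Partial derivative `∂_J f`. -/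
def pd {κ : Type*} [Fintype κ] [DecidableEq κ] (J : κ) (f : (κ → ℝ) → ℝ) (y : κ → ℝ) : ℝ :=
  fderiv ℝ f y (Pi.single J 1)

/-- `Y^{IJ}_{KL} ∂_I ⊗ ∂_J = 0` on `U`, for a set of fields: acting on any two of them, and
(both derivatives) on any one of them. -/
def SectionCondition (D : DualityDatum) (U : Set (D.Idx → ℝ)) (F : Set ((D.Idx → ℝ) → ℝ)) :
    Prop :=
  (∀ f ∈ F, ∀ g ∈ F, ∀ y ∈ U, ∀ K L : D.Idx,
    ∑ I, ∑ J, D.Y I J K L * (pd I f y * pd J g y) = 0) ∧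
  (∀ f ∈ F, ∀ y ∈ U, ∀ K L : D.Idx,
    ∑ I, ∑ J, D.Y I J K L * pd I (pd J f) y = 0)

/-- Generalized Lie derivative of a vector field `W` of weight `w`:
`V^J ∂_J W^I - W^J ∂_J V^I + Y^{IJ}_{KL} ∂_J V^K W^L + (w - β) ∂_K V^K W^I`. -/
def genLie (D : DualityDatum) (w : ℝ) (V W : (D.Idx → ℝ) → D.Idx → ℝ)
    (y : D.Idx → ℝ) (I : D.Idx) : ℝ :=
  ∑ J, V y J * pd J (fun z => W z I) y - ∑ J, W y J * pd J (fun z => V z I) y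
  + ∑ J, ∑ K, ∑ L, D.Y I J K L * pd J (fun z => V z K) y * W y L
  + (w - D.β) * (∑ K, pd K (fun z => V z K) y) * W y I

section Fields

variable (D : DualityDatum) {n : ℕ} (tS : Fin n → Matrix D.Idx D.Idx ℝ)
  (f : Fin n → Fin n → Fin n → ℝ)
  (E : (D.Idx → ℝ) → Matrix D.Idx D.Idx ℝ) (Om : (D.Idx → ℝ) → Matrix D.Idx (Fin n) ℝ)

/-- All the component functions `E_A^I`, `Ω_A^α`, `ξ^I`, `ξ^α`. -/
def components (xi : (D.Idx → ℝ) → D.Idx → ℝ) (lam : (D.Idx → ℝ) → Fin n → ℝ) :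
    Set ((D.Idx → ℝ) → ℝ) :=
  {g | (∃ A I, g = fun y => E y A I) ∨ (∃ A α, g = fun y => Om y A α) ∨
    (∃ I, g = fun y => xi y I) ∨ (∃ α, g = fun y => lam y α)}

/-- The connection `Ω_{AB}^C = Ω_A^α (t_α)_B^C` in flat indices. -/
def spinConn (y : D.Idx → ℝ) (A B C : D.Idx) : ℝ := ∑ α, Om y A α * tS α B C

/-- `Ω_{IA}^B`, with the first index made curved with the inverse frame. -/
def spinConnCurved (y : D.Idx → ℝ) (I A B : D.Idx) : ℝ :=
  ∑ C, (E y)⁻¹ I C * spinConn D tS Om y C A B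

/-- The vielbein postulate
`∇_I E_A^J = ∂_I E_A^J - Ω_{IA}^B E_B^J + Γ_{IK}^J E_A^K = 0` at `y`. -/
def VielbeinPostulate (Gam : (D.Idx → ℝ) → D.Idx → D.Idx → D.Idx → ℝ) (y : D.Idx → ℝ) : Prop :=
  ∀ I A J : D.Idx, pd I (fun z => E z A J) y - ∑ B, spinConnCurved D tS E Om y I A B * E y B J
    + ∑ K, Gam y I K J * E y A K = 0

/-- The affine connection
`Γ_{IK}^J = - E_K^A ∂_I E_A^J + E_K^A Ω_{IA}^B E_B^J` defined by `Ω`. -/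
def affineConn (y : D.Idx → ℝ) (I K J : D.Idx) : ℝ :=
  ∑ A, (E y)⁻¹ K A *
    (- pd I (fun z => E z A J) y + ∑ B, spinConnCurved D tS E Om y I A B * E y B J)

/-- Flat components `Γ_{AB}^C = E_A^I E_B^K Γ_{IK}^J E_J^C` of an affine connection. -/
def flatConn (Gam : (D.Idx → ℝ) → D.Idx → D.Idx → D.Idx → ℝ) (y : D.Idx → ℝ)
    (A B C : D.Idx) : ℝ :=
  ∑ I, ∑ K, ∑ J, E y A I * E y B K * Gam y I K J * (E y)⁻¹ J C

/-- Generalized torsion `2 Γ_{[AB]}^C + Y^{EC}_{BD} Γ_{EA}^D` of a connection given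
in flat indices. -/
def genTorsion (Gam : D.Idx → D.Idx → D.Idx → ℝ) (A B C : D.Idx) : ℝ :=
  Gam A B C - Gam B A C + ∑ F, ∑ G, D.Y F C B G * Gam F A G

/-- The generalized torsion of the connection defined by `Ω`. -/
def torsion (y : D.Idx → ℝ) (A B C : D.Idx) : ℝ :=
  genTorsion D (flatConn D E (affineConn D tS E Om) y) A B C

/-! ## Gauge transformations -/

variable (xi : (D.Idx → ℝ) → D.Idx → ℝ) (lam : (D.Idx → ℝ) → Fin n → ℝ)

/-- `ξ_A^B = ξ^γ (t_γ)_A^B`. -/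
def localParam (y : D.Idx → ℝ) : Matrix D.Idx D.Idx ℝ := ∑ γ, lam y γ • tS γ

/-- `δ E_A^I = L_ξ E_A^I + ξ_A^B E_B^I`, the frame having weight `β`. -/
def deltaE (y : D.Idx → ℝ) : Matrix D.Idx D.Idx ℝ := Matrix.of fun A I =>
  genLie D D.β xi (fun z => E z A) y I + ∑ B, localParam D tS lam y A B * E y B I

/-- `δ Ω_A^α = ξ^K ∂_K Ω_A^α + ξ_A^C Ω_C^α + Ω_A^β ξ^γ f_{γβ}^α + E_A^I ∂_I ξ^α`. -/
def deltaOm (y : D.Idx → ℝ) : Matrix D.Idx (Fin n) ℝ := Matrix.of fun A α =>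
  ∑ K, xi y K * pd K (fun z => Om z A α) y
  + ∑ C, localParam D tS lam y A C * Om y C α
  + ∑ β, ∑ γ, Om y A β * lam y γ * f γ β α
  + ∑ I, E y A I * pd I (fun z => lam z α) y

/-- The covariant transformation of a tensor with flat components `X_{AB}^C`:
`ξ^K ∂_K X_{AB}^C + ξ_A^D X_{DB}^C + ξ_B^D X_{AD}^C - X_{AB}^D ξ_D^C`. -/
def covariantVariation (X : (D.Idx → ℝ) → D.Idx → D.Idx → D.Idx → ℝ) (y : D.Idx → ℝ)
    (A B C : D.Idx) : ℝ :=
  ∑ K, xi y K * pd K (fun z => X z A B C) y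
  + ∑ G, localParam D tS lam y A G * X y G B C
  + ∑ G, localParam D tS lam y B G * X y A G C
  - ∑ G, X y A B G * localParam D tS lam y G C

end Fields

/-! ## The mega-space

The mega-space has the coordinates `y^μ` (on the group `G_S`) and `y^I`, and further ones on which
nothing depends. Its frame is block lower-triangular for the level grading, so that the components
with values in the two highest levels, indexed by `Fin n ⊕ Idx`, close among themselves and
determine the level-0 components of the fluxes. -/

section Mega

variable (D : DualityDatum) {n : ℕ} (tS : Fin n → Matrix D.Idx D.Idx ℝ)
  (f : Fin n → Fin n → Fin n → ℝ)

/-- Index set of the two highest levels of the representation `R₁` of the mega-space group. -/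
abbrev MegaIdx (D : DualityDatum) (n : ℕ) : Type := Fin n ⊕ D.Idx

/-- The negative-level generator `R_γ^F`. -/
def megaRNeg (γ : Fin n) (F : D.Idx) : Matrix (MegaIdx D n) (MegaIdx D n) ℝ := Matrix.of fun
  | .inr A, .inl β => kd A F * kd γ β
  | _, _ => 0

/-- The positive-level generator `R^γ_F`. -/
def megaRPos (γ : Fin n) (F : D.Idx) : Matrix (MegaIdx D n) (MegaIdx D n) ℝ := Matrix.of fun
  | .inl α, .inr B => - (kd α γ * kd F B)
  | _, _ => 0

/-- The level-0 generator of `gl(n)`. -/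
def megaK (γ δ : Fin n) : Matrix (MegaIdx D n) (MegaIdx D n) ℝ := Matrix.of fun
  | .inl α, .inl β => kd α γ * kd δ β
  | _, _ => 0

/-- A matrix acting on the indices of the original duality group. -/
def megaEmb (A : Matrix D.Idx D.Idx ℝ) : Matrix (MegaIdx D n) (MegaIdx D n) ℝ :=
  Matrix.fromBlocks 0 0 0 A

/-- The generator `∑_γ K^γ_γ - 1` in level 0 (the commutant of the duality group). -/
def megaL : Matrix (MegaIdx D n) (MegaIdx D n) ℝ :=
  (∑ γ : Fin n, megaK D γ γ) - 1

/-- The Y-tensor `δ^P_R δ^Q_S + (t^a)_R^Q (t_a)_S^P + β δ^P_S δ^Q_R` of the mega-space group (with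
its own generators and its own `β`), all four indices restricted to the two highest levels. The sum
over its generators is decomposed under `GL(n)` and the original duality group: only the generators
below act within the two highest levels, and the part of the sum over the two commuting dilations
that is not written here combines with the last term into `β L ⊗ L`, where `β` is the one of the
original duality group. -/
def megaY (P Q R S : MegaIdx D n) : ℝ :=
  kd P R * kd Q S
  + ∑ γ : Fin n, ∑ F : D.Idx,
      (megaRNeg D γ F R Q * megaRPos D γ F S P + megaRPos D γ F R Q * megaRNeg D γ F S P)
  - ∑ γ : Fin n, ∑ δ : Fin n, megaK D δ γ R Q * megaK D γ δ S P
  + ∑ a, megaEmb D (n := n) (D.tDual a) R Q * megaEmb D (n := n) (D.t a) S P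
  + D.β * (megaL D R Q * megaL D S P)

/-- The adjoint matrices `(t_α)_β^γ = - f_{αβ}^γ` of `G_S`. -/
def adjRep (α : Fin n) : Matrix (Fin n) (Fin n) ℝ := Matrix.of fun β γ => - f α β γ

/-- The generators of `G_S` on the mega-space. -/
def megaT (α : Fin n) : Matrix (MegaIdx D n) (MegaIdx D n) ℝ :=
  Matrix.fromBlocks (adjRep f α) 0 0 (tS α)

/-- The twist `exp(y^μ t_μ)`. -/
def megaM (s : Fin n → ℝ) : Matrix (MegaIdx D n) (MegaIdx D n) ℝ :=
  Matrix.fromBlocks (NormedSpace.exp (∑ μ, s μ • adjRep f μ)) 0 0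
    (NormedSpace.exp (∑ μ, s μ • tS μ))

/-- `v_α^μ` is the frame of left-invariant vector fields on a chart domain `S` of `G_S`, with
respect to the coordinates `y^μ` of the twist: `M⁻¹ v_α^μ ∂_μ M = t_α`. -/
def IsGroupFrame (S : Set (Fin n → ℝ)) (v : (Fin n → ℝ) → Matrix (Fin n) (Fin n) ℝ) : Prop :=
  IsOpen S ∧ (∀ α μ, ContDiffOn ℝ ∞ (fun s => v s α μ) S) ∧ (∀ s ∈ S, IsUnit (v s).det) ∧
  ∀ s ∈ S, ∀ α : Fin n, ∀ P Q : MegaIdx D n,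
    ∑ μ, v s α μ * pd μ (fun r => megaM D tS f r P Q) s = (megaM D tS f s * megaT D tS f α) P Q

variable (v : (Fin n → ℝ) → Matrix (Fin n) (Fin n) ℝ)
  (E : (D.Idx → ℝ) → Matrix D.Idx D.Idx ℝ) (Om : (D.Idx → ℝ) → Matrix D.Idx (Fin n) ℝ)

/-- The block-diagonal frame `diag(v_α^μ, E_A^I)`. -/
def megaV (x : MegaIdx D n → ℝ) : Matrix (MegaIdx D n) (MegaIdx D n) ℝ :=
  Matrix.fromBlocks (v (x ∘ Sum.inl)) 0 0 (E (x ∘ Sum.inr))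

/-- The factor `exp(- Ω_A^α R_α^A)`. -/
def megaN (x : MegaIdx D n → ℝ) : Matrix (MegaIdx D n) (MegaIdx D n) ℝ :=
  Matrix.fromBlocks 1 0 (- Om (x ∘ Sum.inr)) 1

/-- The frame `M N V` of the mega-space. -/
def megaFrame (x : MegaIdx D n → ℝ) : Matrix (MegaIdx D n) (MegaIdx D n) ℝ :=
  megaM D tS f (x ∘ Sum.inl) * megaN D Om x * megaV D v E x

/-- The Weitzenböck connection `- E_P^J ∂_J E_Q^I E_I^R` of the mega-space frame. -/
def megaWeitzenbock (x : MegaIdx D n → ℝ) (P Q R : MegaIdx D n) : ℝ :=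
  - ∑ J, ∑ I, megaFrame D tS f v E Om x P J *
      pd J (fun z => megaFrame D tS f v E Om z Q I) x * (megaFrame D tS f v E Om x)⁻¹ I R

/-- The generalized fluxes `2 W_{[PQ]}^R + Y^{SR}_{QT} W_{SP}^T` of the mega-space frame. -/
def megaFlux (x : MegaIdx D n → ℝ) (P Q R : MegaIdx D n) : ℝ :=
  megaWeitzenbock D tS f v E Om x P Q R - megaWeitzenbock D tS f v E Om x Q P R
  + ∑ S, ∑ T, megaY D S R Q T * megaWeitzenbock D tS f v E Om x S P T

/-- The untwisted fluxes `(M⁻¹)_P^S (M⁻¹)_Q^T X_{ST}^Z M_Z^R`. -/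
def untwistedFlux (x : MegaIdx D n → ℝ) (P Q R : MegaIdx D n) : ℝ :=
  ∑ S, ∑ T, ∑ Z, (megaM D tS f (x ∘ Sum.inl))⁻¹ P S * (megaM D tS f (x ∘ Sum.inl))⁻¹ Q T
    * megaFlux D tS f v E Om x S T Z * megaM D tS f (x ∘ Sum.inl) Z R

end Mega

end GenGeom

end

/-!
The affine connection, in flat indices, is the Weitzenböck connection of the frame plus `Ω`
(`flatConn_affineConn`), and it is the only solution of the vielbein postulate because the frame is
invertible (`vielbeinPostulate_iff`). The generalized torsion is a linear map of connections, built
from the Y-tensor, so all else rests on what the Y-tensor commutes with and on one quadratic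
identity. These facts about a duality group are collected in `IsCovariantY`.

*The mega-space.* Restricted to level 0, the Y-tensor of the mega-space is the Y-tensor of the
duality group, and its components with a contracted index in the higher level do not contribute
(`megaY_inr`, `megaY_inr_inl`, `megaY_inl_inr`), so the level-0 flux is the generalized torsion of
the level-0 Weitzenböck connection (`megaFlux_inr`). In the latter, the derivatives along `y^I`
give the Weitzenböck connection of `E`, and those along the group, weighted with the entry `-Ω v`
of the frame, give `Ω_A^α t_α` by the defining property of `v` (`conj_megaWeitzenbock`). Since the
twist is the exponential of an element of the Lie algebra, it leaves the Y-tensor invariant and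
commutes with taking the torsion (`genTorsion_conj`).

*Covariance.* A gauge variation of the fields splits into three parts, on each of which the
variation of the flat connection is explicit. Transport along `ξ` differentiates the torsion along
`ξ`. The local rotation rotates the three flat indices, with the derivatives of the parameter
cancelling between `E` and `Ω` (`flatGammaVar_rotate`), and torsion commutes with this rotation
(`genTorsion_rotate`). In the rest, the first derivatives of `ξ` cancel by the section condition
(`flatGammaVar_diffeo`), and what remains is the frame transform of
`∂_I ∂_L ξ^C - Y^{CJ}_{KL} ∂_I ∂_J ξ^K`, whose generalized torsion vanishes by the quadratic
identity `Y^{LJ}_{KM} Y^{MN}_{PI} s_{LN} = Y^{JN}_{PI} s_{KN}`, valid for symmetric `s` with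
`Y^{LN}_{PQ} s_{LN} = 0` (`genTorsion_eq_zero_of_quadratic`).

*The Y-tensor.* For `O(d, d + m)` it is `η^{IJ} η_{KL}`, and everything is immediate
(`orth_isCovariant`). For `E_d` the weights of `R₁` are the classes of lines in the Picard lattice
`ℤ^{1,d}` of a del Pezzo surface, and the roots are the classes of square `-2` orthogonal to the
anticanonical class `κ`. Up to signs of the basis vectors the generators are root vectors whose
structure constants are the parity of a bilinear form `q` (`rootVec`), and the shifted Casimir
`t^a ⊗ t_a + β 1 ⊗ 1` becomes an explicit function of intersection numbers (`exc_casimir`). The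
Hodge index theorem bounds the intersection number of two lines by `-1` and `2`, and that of a line
and a root by `±1`. The identities needed thereby become finite case distinctions on
intersection numbers, combined with sign computations modulo 2:

* invariance under the root vectors (`Pic.rootAction_eq_zero`);
* the part of `Y` antisymmetric in the upper indices is minus the square of the symplectic form of
  `E₇`, which pairs lines with sum `κ` and is zero for `d < 7` (`Pic.casimir_sub_casimir`);
* a crossing relation between the Casimir and the symplectic form (`Pic.casimir_sympl`).

The quadratic identity follows from these three: contracting `s` with the Casimir gives a tensor
whose symmetric part is the action of the Lie algebra on `s`, hence annihilated by `Y` as `s` is,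
while its antisymmetric part pairs to zero with the symplectic form (`quadratic_of_crossing`).
-/

open scoped Kronecker

noncomputable section

namespace GenGeom

section

/-! ### The Picard lattice of a del Pezzo surface -/

/-- The lattice `ℤ^{1,d}`; its second component lists the coefficients with respect to minus the
exceptional classes. -/
abbrev Pic (d : ℕ) : Type := ℤ × (Fin d → ℤ)

namespace Pic

variable {d : ℕ}

/-- The intersection form of signature `(1, d)`. -/
def ip (x y : Pic d) : ℤ := x.1 * y.1 - ∑ i, x.2 i * y.2 i

/-- The anticanonical class. -/
def kap (d : ℕ) : Pic d := (3, fun _ => 1)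

/-- The bilinear form whose parity is the cocycle of the structure constants. -/
def q (x y : Pic d) : ℤ := ∑ i, ∑ j, if j < i then x.2 i * y.2 j else 0

/-- Classes of `(-1)`-curves: the weights of `R₁`. -/
def IsLine (x : Pic d) : Prop := ip x x = -1 ∧ ip (kap d) x = 1

/-- The roots of `E_d`. -/
def IsRoot (x : Pic d) : Prop := ip x x = -2 ∧ ip (kap d) x = 0

lemma ip_comm (x y : Pic d) : ip x y = ip y x := by simp [ip, mul_comm]

lemma ip_add_left (x y z : Pic d) : ip (x + y) z = ip x z + ip y z := by
  simp [ip, add_mul, Finset.sum_add_distrib]; ring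

lemma ip_neg_left (x z : Pic d) : ip (-x) z = -ip x z := by
  simp [ip]; ring

lemma ip_sub_left (x y z : Pic d) : ip (x - y) z = ip x z - ip y z := by
  rw [sub_eq_add_neg, ip_add_left, ip_neg_left]; ring

lemma ip_add_right (x y z : Pic d) : ip x (y + z) = ip x y + ip x z := by
  rw [ip_comm, ip_add_left, ip_comm y, ip_comm z]

lemma ip_neg_right (x z : Pic d) : ip x (-z) = -ip x z := by
  rw [ip_comm, ip_neg_left, ip_comm]

lemma ip_sub_right (x y z : Pic d) : ip x (y - z) = ip x y - ip x z := by
  rw [ip_comm, ip_sub_left, ip_comm y, ip_comm z]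

lemma q_add_left (x y z : Pic d) : q (x + y) z = q x z + q y z := by
  simp only [q, ← Finset.sum_add_distrib]
  refine Finset.sum_congr rfl fun i _ => Finset.sum_congr rfl fun j _ => ?_
  split_ifs <;> simp [add_mul]

lemma q_add_right (x y z : Pic d) : q x (y + z) = q x y + q x z := by
  simp only [q, ← Finset.sum_add_distrib]
  refine Finset.sum_congr rfl fun i _ => Finset.sum_congr rfl fun j _ => ?_
  split_ifs <;> simp [mul_add]

lemma q_neg_left (x z : Pic d) : q (-x) z = -q x z := by
  simp only [q, ← Finset.sum_neg_distrib]
  refine Finset.sum_congr rfl fun i _ => Finset.sum_congr rfl fun j _ => ?_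
  split_ifs <;> simp

lemma q_neg_right (x z : Pic d) : q x (-z) = -q x z := by
  simp only [q, ← Finset.sum_neg_distrib]
  refine Finset.sum_congr rfl fun i _ => Finset.sum_congr rfl fun j _ => ?_
  split_ifs <;> simp

lemma q_sub_left (x y z : Pic d) : q (x - y) z = q x z - q y z := by
  rw [sub_eq_add_neg, q_add_left, q_neg_left]; ring

lemma q_sub_right (x y z : Pic d) : q x (y - z) = q x y - q x z := by
  rw [sub_eq_add_neg, q_add_right, q_neg_right]; ring

/-- The symmetrization of `q`, which determines commutation signs. -/
lemma q_add_q_swap (x y : Pic d) :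
    q x y + q y x = (∑ i, x.2 i) * (∑ i, y.2 i) - ∑ i, x.2 i * y.2 i := by
  have h1 : q y x = ∑ i, ∑ j, if i < j then x.2 i * y.2 j else 0 := by
    rw [q, Finset.sum_comm]
    refine Finset.sum_congr rfl fun i _ => Finset.sum_congr rfl fun j _ => ?_
    split_ifs <;> ring
  have h2 : ∑ i, x.2 i * y.2 i = ∑ i, ∑ j, if i = j then x.2 i * y.2 j else 0 := by simp
  rw [h1, q, h2, Finset.sum_mul_sum, ← Finset.sum_add_distrib, ← Finset.sum_sub_distrib]
  refine Finset.sum_congr rfl fun i _ => ?_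
  rw [← Finset.sum_add_distrib, ← Finset.sum_sub_distrib]
  refine Finset.sum_congr rfl fun j _ => ?_
  rcases lt_trichotomy i j with h | h | h
  · simp [h, h.not_gt, h.ne]
  · simp [h]
  · simp [h, h.not_gt, h.ne']

lemma ip_kap (x : Pic d) : ip (kap d) x = 3 * x.1 - ∑ i, x.2 i := by simp [ip, kap]

/-- Modulo 2, exchanging the arguments of `q` is governed by intersection numbers and by first
components; this is what compares cocycle signs. -/
lemma q_swap (x y : Pic d) : q x y + q y x = 8 * (x.1 * y.1) + ip x y
    - 3 * (x.1 * ip (kap d) y) - 3 * (ip (kap d) x * y.1) + ip (kap d) x * ip (kap d) y := by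
  rw [q_add_q_swap]
  have hx : ∑ i, x.2 i = 3 * x.1 - ip (kap d) x := by rw [ip_kap]; ring
  have hy : ∑ i, y.2 i = 3 * y.1 - ip (kap d) y := by rw [ip_kap]; ring
  have hxy : ip x y = x.1 * y.1 - ∑ i, x.2 i * y.2 i := rfl
  rw [hx, hy, hxy]; ring

/-- The Hodge index inequality, for self-intersection of the anticanonical class at least `2`. -/
lemma hodge (hd : d ≤ 7) (x : Pic d) : 2 * ip x x ≤ ip (kap d) x ^ 2 := by
  have h1 : (∑ i, x.2 i) ^ 2 ≤ d * ∑ i, x.2 i ^ 2 := by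
    simpa using sq_sum_le_card_mul_sum_sq (s := Finset.univ) (f := x.2)
  have h0 : 0 ≤ ∑ i, x.2 i ^ 2 := Finset.sum_nonneg fun i _ => sq_nonneg _
  have h2 : (d : ℤ) ≤ 7 := by exact_mod_cast hd
  have h3 : (∑ i, x.2 i) ^ 2 ≤ 7 * ∑ i, x.2 i ^ 2 := by nlinarith
  have h4 : ip x x = x.1 ^ 2 - ∑ i, x.2 i ^ 2 := by simp [ip, sq]
  rw [ip_kap, h4]
  -- What is left is a complete square in `x.1` and `∑ i, x.2 i`.
  nlinarith [sq_nonneg (7 * x.1 - 3 * ∑ i, x.2 i)]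

/-- The Hodge index inequality, for self-intersection of the anticanonical class at least `3`. -/
lemma hodge_six (hd : d ≤ 6) (x : Pic d) : 3 * ip x x ≤ ip (kap d) x ^ 2 := by
  have h1 : (∑ i, x.2 i) ^ 2 ≤ d * ∑ i, x.2 i ^ 2 := by
    simpa using sq_sum_le_card_mul_sum_sq (s := Finset.univ) (f := x.2)
  have h0 : 0 ≤ ∑ i, x.2 i ^ 2 := Finset.sum_nonneg fun i _ => sq_nonneg _
  have h2 : (d : ℤ) ≤ 6 := by exact_mod_cast hd
  have h3 : (∑ i, x.2 i) ^ 2 ≤ 6 * ∑ i, x.2 i ^ 2 := by nlinarith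
  have h4 : ip x x = x.1 ^ 2 - ∑ i, x.2 i ^ 2 := by simp [ip, sq]
  rw [ip_kap, h4]
  nlinarith [sq_nonneg (2 * x.1 - ∑ i, x.2 i)]

/-- The form is negative definite on the orthogonal complement of the anticanonical class. -/
lemma eq_zero_of_ip (hd : d ≤ 7) {x : Pic d} (h : ip (kap d) x = 0) (hx : ip x x = 0) :
    x = 0 := by
  have h1 : (∑ i, x.2 i) ^ 2 ≤ d * ∑ i, x.2 i ^ 2 := by
    simpa using sq_sum_le_card_mul_sum_sq (s := Finset.univ) (f := x.2)
  have h0 : 0 ≤ ∑ i, x.2 i ^ 2 := Finset.sum_nonneg fun i _ => sq_nonneg _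
  have h2 : (d : ℤ) ≤ 7 := by exact_mod_cast hd
  have h3 : (∑ i, x.2 i) ^ 2 ≤ 7 * ∑ i, x.2 i ^ 2 := by nlinarith
  have h4 : ip x x = x.1 ^ 2 - ∑ i, x.2 i ^ 2 := by simp [ip, sq]
  rw [ip_kap] at h
  have h5 : ∑ i, x.2 i = 3 * x.1 := by linarith
  rw [h5] at h3
  have h6 : x.1 ^ 2 = 0 := by nlinarith [sq_nonneg x.1]
  have h7 : ∑ i, x.2 i ^ 2 = 0 := by linarith
  rw [Finset.sum_eq_zero_iff_of_nonneg fun i _ => sq_nonneg _] at h7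
  refine Prod.ext (by simpa using h6) (funext fun i => ?_)
  simpa using h7 i (Finset.mem_univ i)

lemma IsLine.ip_le (hd : d ≤ 7) {x y : Pic d} (hx : IsLine x) (hy : IsLine y) : ip x y ≤ 2 := by
  have := hodge hd (x + y)
  simp only [ip_add_left, ip_add_right, ip_comm y x, hx.1, hy.1, hx.2, hy.2] at this
  linarith

lemma IsLine.ip_le_one (hd : d ≤ 6) {x y : Pic d} (hx : IsLine x) (hy : IsLine y) :
    ip x y ≤ 1 := by
  have := hodge_six hd (x + y)
  simp only [ip_add_left, ip_add_right, ip_comm y x, hx.1, hy.1, hx.2, hy.2] at this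
  omega

lemma IsLine.le_ip (hd : d ≤ 7) {x y : Pic d} (hx : IsLine x) (hy : IsLine y) : -1 ≤ ip x y := by
  have := hodge hd (x - y)
  simp only [ip_sub_left, ip_sub_right, ip_comm y x, hx.1, hy.1, hx.2, hy.2] at this
  linarith

lemma IsLine.eq_iff (hd : d ≤ 7) {x y : Pic d} (hx : IsLine x) (hy : IsLine y) :
    x = y ↔ ip x y = -1 := by
  refine ⟨fun h => h ▸ hx.1, fun h => sub_eq_zero.1 (eq_zero_of_ip hd ?_ ?_)⟩
  · rw [ip_sub_right, hx.2, hy.2, sub_self]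
  · simp only [ip_sub_left, ip_sub_right, ip_comm y x, hx.1, hy.1, h]; rfl

/-- On a del Pezzo surface of degree two, lines with intersection number two are exchanged by
the Geiser involution. -/
lemma IsLine.add_eq_kap {x y : Pic 7} (hx : IsLine x) (hy : IsLine y) (h : ip x y = 2) :
    x + y = kap 7 := by
  have hk : ip (kap 7) (kap 7) = 2 := by simp [ip, kap]
  refine sub_eq_zero.1 (eq_zero_of_ip le_rfl ?_ ?_)
  · rw [ip_sub_right, ip_add_right, hx.2, hy.2, hk]; rfl
  · simp only [ip_sub_left, ip_sub_right, ip_add_left, ip_add_right, ip_comm y x,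
      ip_comm _ (kap 7), hx.1, hy.1, h, hx.2, hy.2, hk]; rfl

/-- `R₁` is minuscule: the strings of a root through a weight have length at most two. -/
lemma IsLine.abs_ip_root (hd : d ≤ 7) {x y : Pic d} (hx : IsLine x) (hy : IsRoot y) :
    -1 ≤ ip x y ∧ ip x y ≤ 1 := by
  have h1 := hodge hd (x + y)
  have h2 := hodge hd (x - y)
  simp only [ip_add_left, ip_add_right, ip_sub_left, ip_sub_right, ip_comm y x,
    hx.1, hy.1, hx.2, hy.2] at h1 h2
  constructor <;> omega

lemma IsLine.add_root {x y : Pic d} (hx : IsLine x) (hy : IsRoot y) :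
    IsLine (x + y) ↔ ip x y = 1 := by
  simp only [IsLine, ip_add_left, ip_add_right, ip_comm y x, hx.1, hy.1, hx.2, hy.2]
  omega

lemma IsLine.sub_root {x y : Pic d} (hx : IsLine x) (hy : IsRoot y) :
    IsLine (x - y) ↔ ip x y = -1 := by
  simp only [IsLine, ip_sub_left, ip_sub_right, ip_comm y x, hx.1, hy.1, hx.2, hy.2]
  omega

lemma IsLine.sub_isRoot {x y : Pic d} (hx : IsLine x) (hy : IsLine y) :
    IsRoot (x - y) ↔ ip x y = 0 := by
  simp only [IsRoot, ip_sub_left, ip_sub_right, ip_comm y x, hx.1, hy.1, hx.2, hy.2]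
  omega

/-- `(-1)^m`. -/
def sg (m : ℤ) : ℝ := (-1) ^ m

lemma sg_add (m n : ℤ) : sg (m + n) = sg m * sg n := zpow_add₀ (by norm_num) _ _

lemma sg_mul_self (m : ℤ) : sg m * sg m = 1 := by
  rw [← sg_add, sg, Even.neg_one_zpow ⟨m, rfl⟩]

lemma sg_eq {m n : ℤ} (h : (m - n) % 2 = 0) : sg m = sg n := by
  have : m = n + (m - n) := by ring
  rw [this, sg_add, show sg (m - n) = 1 from Even.neg_one_zpow (Int.even_iff.2 h), mul_one]

lemma sg_eq_neg {m n : ℤ} (h : (m - n) % 2 = 1) : sg m = -sg n := by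
  have : m = n + (m - n) := by ring
  rw [this, sg_add, show sg (m - n) = -1 from Odd.neg_one_zpow (Int.odd_iff.2 h)]; ring

lemma sg_zero : sg 0 = 1 := by simp [sg]

end Pic

end

section

/-! ### Invariance of the Casimir under root vectors -/
namespace Pic

variable {d : ℕ}

/-- The tensor `∑ t^a ⊗ t_a` in the weight basis, up to signs of the basis vectors: the
intersection form on the Cartan part, a cocycle sign for each root. -/
def casimir (k j l i : Pic d) : ℝ :=
  if k = j then (if l = i then (ip k l : ℝ) else 0)
  else if k + l = j + i ∧ ip k j = 0 then - sg (q (j - k) (k + i)) else 0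

lemma casimir_eq_zero {k j l i : Pic d} (h : k + l ≠ j + i) : casimir k j l i = 0 := by
  unfold casimir
  split_ifs with h1 h2 h3
  · subst h1 h2; exact absurd rfl h
  · rfl
  · exact absurd h3.1 h
  · rfl

/-- On lines whose weights add up, `casimir` depends on a single intersection number. -/
lemma casimir_eval (hd : d ≤ 7) {k j l i : Pic d} (hk : IsLine k) (hj : IsLine j)
    (h : k + l = j + i) : casimir k j l i =
      if ip k j = -1 then (ip k l : ℝ) else if ip k j = 0 then - sg (q (j - k) (k + i)) else 0 := by
  unfold casimir
  by_cases h1 : k = j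
  · have h2 : l = i := by rw [h1] at h; exact add_left_cancel h
    simp [h1, h2, hj.1]
  · have h3 := mt (hk.eq_iff hd hj).2 h1
    simp [h1, h, h3]

lemma casimir_symm (hd : d ≤ 7) {k j l i : Pic d} (hk : IsLine k) (hj : IsLine j) (hl : IsLine l)
    (hi : IsLine i) : casimir k j l i = casimir l i k j := by
  by_cases h : k + l = j + i
  · rw [casimir_eval hd hk hj h, casimir_eval hd hl hi (by rw [add_comm l, h, add_comm])]
    have h1 : i = k + l - j := by rw [h]; abel
    have h2 : ip l i = ip k j := by
      have h3 := hi.1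
      rw [h1] at h3 ⊢
      simp only [ip_add_left, ip_sub_left, ip_add_right, ip_sub_right, hk.1, hj.1, hl.1,
        ip_comm l k, ip_comm j k, ip_comm j l] at h3 ⊢
      omega
    have h4 : sg (q (j - k) (k + i)) = sg (q (i - l) (l + j)) := by
      apply sg_eq
      rw [h1]
      simp only [q_add_left, q_sub_left, q_add_right, q_sub_right]
      omega
    rw [h2, h4, ip_comm l k]
  · rw [casimir_eq_zero h, casimir_eq_zero]
    intro h'; exact h (by rw [add_comm k, h', add_comm])

/-- The four terms in the action of a root generator on `casimir`. -/
def rootAction (g k j l i : Pic d) : ℝ :=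
  (if ip k g = -1 then sg (q g (k - g)) * casimir (k - g) j l i else 0)
  - (if ip j g = 1 then sg (q g j) * casimir k (j + g) l i else 0)
  + (if ip l g = -1 then sg (q g (l - g)) * casimir k j (l - g) i else 0)
  - (if ip i g = 1 then sg (q g i) * casimir k j l (i + g) else 0)

lemma rootAction_eq_zero_of_ne {g k j l i : Pic d} (h : k + l ≠ j + i + g) :
    rootAction g k j l i = 0 := by
  unfold rootAction
  rw [casimir_eq_zero (k := k - g), casimir_eq_zero (j := j + g), casimir_eq_zero (l := l - g),
    casimir_eq_zero (i := i + g)]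
  · simp
  all_goals
    intro h'
    apply h
  · rw [h']; abel
  · rw [← sub_add_cancel (k + l) g, show k + l - g = k + (l - g) by abel, h']
  · rw [h']; abel
  · rw [← sub_add_cancel (k + l) g, show k + l - g = k - g + l by abel, h']

/-- Signs as integers, in the form in which identities between them are linear arithmetic
modulo 2. -/
lemma sg_eq_emod (m : ℤ) : sg m = ((1 - 2 * (m % 2) : ℤ) : ℝ) := by
  rcases Int.emod_two_eq_zero_or_one m with h | h
  · rw [sg_eq (n := 0) (by simpa using h), h, sg_zero]; norm_num
  · rw [sg_eq_neg (n := 0) (by simpa using h), h, sg_zero]; norm_num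

set_option maxHeartbeats 1600000 in
/-- Invariance of `casimir` under root generators. When the weights match, the intersection
numbers with the root leave few cases; in each of them at most three terms survive and cancel
because the cocycle signs of two roots commute up to the parity of their intersection number. -/
lemma rootAction_eq_zero (hd : d ≤ 7) {g k j l i : Pic d} (hk : IsLine k) (hj : IsLine j)
    (hl : IsLine l) (hi : IsLine i) (hg : IsRoot g) : rootAction g k j l i = 0 := by
  by_cases h : k + l = j + i + g
  swap
  · exact rootAction_eq_zero_of_ne h
  have hi' : i = k + l - j - g := by rw [h]; abel
  have ka := hk.abs_ip_root hd hg
  have ja := hj.abs_ip_root hd hg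
  have la := hl.abs_ip_root hd hg
  have ia := hi.abs_ip_root hd hg
  have x1 := hk.le_ip hd hj
  have x2 := hk.ip_le hd hj
  have hxe : ip k j = -1 → ip k g = ip j g := fun h' => by rw [(hk.eq_iff hd hj).2 h']
  -- The four terms, in terms of the intersection numbers `a, b, c, e` of `k, j, l, i` with `g` and
  -- `x, y` of `k` with `j, l`.
  have e1 : ip k g = -1 → casimir (k - g) j l i = if ip k j - ip j g = -1 then
      ((ip k l - ip l g : ℤ) : ℝ) else if ip k j - ip j g = 0 then
        - sg (q (j - (k - g)) (k - g + i)) else 0 := fun h' => by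
    rw [casimir_eval hd ((hk.sub_root hg).2 h') hj (by rw [hi']; abel), ip_sub_left, ip_sub_left,
      ip_comm g j, ip_comm g l]
  have e2 : ip j g = 1 → casimir k (j + g) l i = if ip k j + ip k g = -1 then
      ((ip k l : ℤ) : ℝ) else if ip k j + ip k g = 0 then - sg (q (j + g - k) (k + i))
        else 0 := fun h' => by
    rw [casimir_eval hd hk ((hj.add_root hg).2 h') (by rw [hi']; abel), ip_add_right]
  have e3 : ip l g = -1 → casimir k j (l - g) i = if ip k j = -1 then
      ((ip k l - ip k g : ℤ) : ℝ) else if ip k j = 0 then - sg (q (j - k) (k + i))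
        else 0 := fun h' => by
    rw [casimir_eval hd hk hj (by rw [hi']; abel), ip_sub_right]
  have e4 : ip i g = 1 → casimir k j l (i + g) = if ip k j = -1 then
      ((ip k l : ℤ) : ℝ) else if ip k j = 0 then - sg (q (j - k) (k + (i + g)))
        else 0 := fun h' => by
    rw [casimir_eval hd hk hj (by rw [hi']; abel)]
  have hig : ip i g = ip k g + ip l g - ip j g + 2 := by
    rw [hi']; simp only [ip_sub_left, ip_add_left, hg.1]; ring
  -- The parities that compare cocycle signs.
  have qgg := q_swap g g
  have qgk := q_swap g k
  have qgj := q_swap g j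
  have qgl := q_swap g l
  rw [hg.2, hg.1] at qgg
  rw [hg.2, hk.2, ip_comm g] at qgk
  rw [hg.2, hj.2, ip_comm g] at qgj
  rw [hg.2, hl.2, ip_comm g] at qgl
  unfold rootAction
  generalize hA : ip k g = a at *
  generalize hB : ip j g = b at *
  generalize hC : ip l g = c at *
  generalize hD : ip i g = e at *
  generalize hX : ip k j = x at *
  generalize hY : ip k l = y at *
  have ha : a = -1 ∨ a = 0 ∨ a = 1 := by omega
  have hb : b = -1 ∨ b = 0 ∨ b = 1 := by omega
  have hc : c = -1 ∨ c = 0 ∨ c = 1 := by omega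
  have hx : x = -1 ∨ x = 0 ∨ x = 1 ∨ x = 2 := by omega
  have hjk : x = -1 → j = k := fun h' => ((hk.eq_iff hd hj).2 (hX.trans h')).symm
  have hjg : a = -1 → x - b = -1 → j = k - g := fun h' h'' => by
    refine ((((hk.sub_root hg).2 (hA.trans h')).eq_iff hd hj).2 ?_).symm
    rw [ip_sub_left, ip_comm g j, hX, hB, h'']
  clear hA hB hC hD hX hY
  -- Most cases are excluded by the bounds, or hold whatever the cocycle is; the others are left
  -- with an identity between signs.
  rcases ha with rfl | rfl | rfl <;> rcases hb with rfl | rfl | rfl <;>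
    rcases hc with rfl | rfl | rfl <;> rcases hx with rfl | rfl | rfl | rfl <;>
    first
    | (exfalso; omega)
    | (subst hig; norm_num at e1 e2 e3 e4 ⊢; done)
    | (subst hig; norm_num at e1 e2 e3 e4 ⊢
       simp only [e1, e2, e3, e4, mul_zero, sub_self, neg_zero, add_zero]; done)
    | (subst hig; norm_num at e1 e2 e3 e4 hjk hjg ⊢; (try simp only [e1, e2, e3, e4])
       clear ka ja la ia x1 x2 hxe e1 e2 e3 e4 hk hj hl hi hg h)
  -- Where a Cartan term survives, `j` and `k` are equal or differ by `g`.
  all_goals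
    first
    | (subst hjk
       have hi2 : i = l - g := by rw [hi']; abel
       subst hi2; clear hi')
    | (subst hjg
       have hi2 : i = l := by rw [hi']; abel
       subst hi2; clear hi')
    | (subst hi')
  all_goals
    try clear hjk
    try clear hjg
    try simp only [mul_neg, mul_add, mul_sub, mul_one, mul_zero]
    ring_nf
    try simp only [← sg_add]
  all_goals
    simp only [mul_two, q_add_left, q_add_right, q_sub_left, q_sub_right, q_neg_left,
      q_neg_right, sg_eq_emod] at qgg qgk qgj qgl ⊢ <;>
    norm_cast <;> omega
end Pic

end

section

/-! ### The antisymmetric part of the Y-tensor -/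
namespace Pic

variable {d : ℕ}

lemma IsLine.add_eq_kap_iff (hd : d ≤ 7) {x y : Pic d} (hx : IsLine x) (hy : IsLine y) :
    x + y = kap d ↔ ip x y = 2 := by
  constructor
  · intro h
    have := hx.2
    rw [← h, ip_add_left, hx.1, ip_comm] at this
    omega
  · intro h
    rcases Nat.lt_or_ge d 7 with h7 | h7
    · have := hx.ip_le_one (by omega) hy
      omega
    · obtain rfl : d = 7 := by omega
      exact hx.add_eq_kap hy h

/-- The invariant symplectic form of `E₇` in the weight basis, up to signs of the basis vectors;
it vanishes on lines for `d < 7`. -/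
def sympl (k l : Pic d) : ℝ := if k + l = kap d then sg (q k (kap d)) else 0

/-- The Geiser involution acts on lines. -/
lemma IsLine.kap_sub {x : Pic 7} (hx : IsLine x) : IsLine (kap 7 - x) := by
  have hk : ip (kap 7) (kap 7) = 2 := by simp [ip, kap]
  simp only [IsLine, ip_sub_left, ip_sub_right, ip_comm x, hx.1, hx.2, hk]
  exact ⟨rfl, rfl⟩

lemma q_kap_kap : q (kap 7) (kap 7) = 21 := by decide

set_option maxHeartbeats 1600000 in
/-- The Y-tensor is symmetric in its upper indices up to the square of the symplectic form. -/
lemma casimir_sub_casimir (hd : d ≤ 7) {k j l i : Pic d} (hk : IsLine k) (hj : IsLine j)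
    (hl : IsLine l) (hi : IsLine i) :
    (if i = k ∧ j = l then 1 else 0) - (if j = k ∧ i = l then 1 else 0)
      + casimir k j l i - casimir k i l j = - (sympl i j * sympl k l) := by
  by_cases h : k + l = j + i
  · have h' : k + l = i + j := by rw [h, add_comm]
    rw [casimir_eval hd hk hj h, casimir_eval hd hk hi h']
    have hl' : l = j + i - k := by rw [← h]; abel
    have x1 := hk.le_ip hd hj
    have x2 := hk.le_ip hd hi
    have y1 := hk.ip_le hd hl
    have hx : ip k l = 1 + ip k j + ip k i := by
      rw [hl', ip_sub_right, ip_add_right, hk.1]; ring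
    have hy : ip i j = ip k l := by
      have := hl.1
      rw [hl'] at this ⊢
      simp only [ip_sub_left, ip_sub_right, ip_add_left, ip_add_right, hk.1, hj.1, hi.1,
        ip_comm i j, ip_comm i k, ip_comm j k] at this ⊢
      omega
    have qij := q_swap i j
    have qkj := q_swap k j
    have qik := q_swap i k
    have qii := q_swap i i
    have qk2 := q_swap k k
    rw [hi.1, hi.2] at qii
    rw [hk.1, hk.2] at qk2
    rw [hk.2] at qkj
    rw [hi.2] at qij qik
    rw [hj.2] at qkj qij
    rw [hk.2, ip_comm] at qik
    have hik : i = k ∧ j = l ↔ ip k i = -1 := by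
      rw [← hk.eq_iff hd hi]
      refine ⟨fun h => h.1.symm, fun h => ⟨h.symm, ?_⟩⟩
      rw [hl', h]; abel
    have hjk : j = k ∧ i = l ↔ ip k j = -1 := by
      rw [← hk.eq_iff hd hj]
      refine ⟨fun h => h.1.symm, fun h => ⟨h.symm, ?_⟩⟩
      rw [hl', h]; abel
    simp only [hik, hjk, sympl, hi.add_eq_kap_iff hd hj, hk.add_eq_kap_iff hd hl, hy]
    -- If `k` and `l` meet in two points then `k + l = κ` and `d = 7`, and the symplectic form
    -- contributes; otherwise the right hand side vanishes.
    by_cases h2 : ip k l = 2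
    · have hk7 := (hk.add_eq_kap_iff hd hl).2 h2
      obtain rfl : d = 7 := by
        rcases Nat.lt_or_ge d 7 with h7 | h7
        · have := hk.ip_le_one (by omega) hl
          omega
        · omega
      have qkk := q_kap_kap
      have qk := q_swap (kap 7) k
      have hkk : ip (kap 7) (kap 7) = 2 := by simp [ip, kap]
      rw [hk.2, hkk] at qk
      have hk0 : kap 7 = i + j := by rw [← hk7, h']
      simp only [if_pos h2, ← sg_add]
      simp only [hk0, q_add_left, q_add_right] at qkk qk ⊢
      have : (i+j).1 = 3 := by rw [← hk0]; rfl
      rw [this] at qk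
      rw [h2] at hx hy
      have hc : (ip k j = -1 ∧ ip k i = 2) ∨ (ip k j = 0 ∧ ip k i = 1) ∨
          (ip k j = 1 ∧ ip k i = 0) ∨ (ip k j = 2 ∧ ip k i = -1) := by
        omega
      rcases hc with ⟨hxe, hze⟩ | ⟨hxe, hze⟩ | ⟨hxe, hze⟩ | ⟨hxe, hze⟩
      · obtain rfl := (hk.eq_iff hd hj).2 hxe
        simp only [sg_eq_emod, h2, hxe, hze]
        norm_num
        norm_cast
        omega
      · simp only [hxe, hze]
        simp only [sg_eq_emod, q_add_left, q_add_right, q_sub_left, q_sub_right]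
        norm_num
        norm_cast
        omega
      · simp only [hxe, hze]
        simp only [sg_eq_emod, q_add_left, q_add_right, q_sub_left, q_sub_right]
        norm_num
        norm_cast
        omega
      · obtain rfl := (hk.eq_iff hd hi).2 hze
        simp only [sg_eq_emod, h2, hxe, hze]
        norm_num
        norm_cast
        omega
    · have hc : (ip k j = -1 ∧ ip k i = -1) ∨ (ip k j = -1 ∧ ip k i = 0) ∨
          (ip k j = -1 ∧ ip k i = 1) ∨ (ip k j = 0 ∧ ip k i = -1) ∨ (ip k j = 0 ∧ ip k i = 0) ∨
          (ip k j = 1 ∧ ip k i = -1) := by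
        omega
      rcases hc with ⟨h3, h4⟩ | ⟨h3, h4⟩ | ⟨h3, h4⟩ | ⟨h3, h4⟩ | ⟨h3, h4⟩ | ⟨h3, h4⟩
      all_goals
        rw [h3, h4] at hx
        norm_num at hx
        simp only [h3, h4, hx, sg_eq_emod, q_add_left, q_add_right, q_sub_left, q_sub_right]
        norm_num
      all_goals
        try (have h5 := (hk.eq_iff hd hj).2 h3; subst h5)
        try (have h5 := (hk.eq_iff hd hi).2 h4; subst h5)
        norm_cast
        try omega
  · rw [casimir_eq_zero h, casimir_eq_zero (by rwa [add_comm i]), if_neg, if_neg]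
    · simp only [sympl]
      split_ifs with h1 h2
      · exact absurd (by rw [h2, add_comm j, h1]) h
      all_goals simp
    · rintro ⟨rfl, rfl⟩; exact h rfl
    · rintro ⟨rfl, rfl⟩; exact h (add_comm _ _)

end Pic

end

section

/-! ### The crossing relation -/
namespace Pic

set_option maxHeartbeats 1600000 in
/-- The crossing relation between the Y-tensor and the symplectic form. When the weights
match, the intersection numbers of `k` with `j`, `n`, `l` add up to zero, which leaves few cases. -/
lemma casimir_sympl {d : ℕ} (hd : d = 7) {k j n l : Pic d} (hk : IsLine k) (hj : IsLine j)
    (hn : IsLine n) (hl : IsLine l) :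
    casimir k j (kap d - n) l * sg (q (kap d - n) (kap d))
      + casimir k j (kap d - l) n * sg (q (kap d - l) (kap d))
    = (if l = k then sympl n j else 0) + (if n = k then sympl l j else 0)
      + (casimir k n (kap d - j) l + casimir k l (kap d - j) n) * sg (q (kap d - j) (kap d)) := by
  by_cases h : k + kap d = j + n + l
  · have h1 : k + (kap d - n) = j + l := by rw [← add_sub_assoc, h]; abel
    have h2 : k + (kap d - l) = j + n := by rw [← add_sub_assoc, h]; abel
    have h3 : k + (kap d - j) = n + l := by rw [← add_sub_assoc, h]; abel
    rw [casimir_eval hd.le hk hj h1, casimir_eval hd.le hk hj h2, casimir_eval hd.le hk hn h3,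
      casimir_eval hd.le hk hl (h3.trans (add_comm n l))]
    have hkap : kap d = j + n + l - k := by rw [← h]; abel
    have c1 := hk.le_ip hd.le hj
    have c2 := hk.le_ip hd.le hn
    have c3 := hk.le_ip hd.le hl
    have s0 : ip k j + ip k n + ip k l = 0 := by
      have := hk.2
      rw [hkap, ip_comm, ip_sub_right, ip_add_right, ip_add_right, hk.1] at this
      linarith
    have s0' : ip k l = -ip k j - ip k n := by linarith
    have hx : ip k j = -1 ∨ ip k j = 0 ∨ ip k j = 1 ∨ ip k j = 2 := by
      have := hk.ip_le hd.le hj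
      clear c2 c3 s0 s0'
      omega
    have hy : ip k n = -1 ∨ ip k n = 0 ∨ ip k n = 1 ∨ ip k n = 2 := by
      have := hk.ip_le hd.le hn
      clear c1 c3 s0 s0'
      omega
    have s1 : ip n j = 1 - ip k l := by
      have e1 := hj.2
      have e2 := hn.2
      have e3 := hl.2
      rw [hkap] at e1 e2 e3
      simp only [ip_sub_left, ip_add_left, hj.1, hn.1, hl.1, ip_comm l n, ip_comm l j,
        ip_comm j n] at e1 e2 e3
      linarith
    have s2 : ip l j = 1 - ip k n := by
      have e1 := hj.2
      have e2 := hn.2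
      have e3 := hl.2
      rw [hkap] at e1 e2 e3
      simp only [ip_sub_left, ip_add_left, hj.1, hn.1, hl.1, ip_comm n l, ip_comm l j,
        ip_comm j n] at e1 e2 e3 ⊢
      linarith
    have hlk : l = k ↔ ip k l = -1 := by rw [← hk.eq_iff hd.le hl, eq_comm]
    have hnk : n = k ↔ ip k n = -1 := by rw [← hk.eq_iff hd.le hn, eq_comm]
    have pkk := q_swap k k
    have pjj := q_swap j j
    have pnn := q_swap n n
    have pkj := q_swap k j
    have pkn := q_swap k n
    have pnj := q_swap n j
    have pκ : q (kap d) (kap d) = 21 := by subst hd; exact q_kap_kap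
    rw [hk.1, hk.2] at pkk
    rw [hj.1, hj.2] at pjj
    rw [hn.1, hn.2] at pnn
    rw [hk.2, hj.2] at pkj
    rw [hk.2, hn.2] at pkn
    rw [hn.2, hj.2, s1] at pnj
    have pk := q_swap (kap d) k
    have pj := q_swap (kap d) j
    have pn := q_swap (kap d) n
    have hκ : ip (kap d) (kap d) = 2 := by subst hd; simp [ip, kap]
    have hκ1 : (kap d).1 = 3 := rfl
    rw [hk.2, hκ, hκ1] at pk
    rw [hj.2, hκ, hκ1] at pj
    rw [hn.2, hκ, hκ1] at pn
    simp only [hlk, hnk, sympl, hn.add_eq_kap_iff hd.le hj, hl.add_eq_kap_iff hd.le hj,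
      s1, s2, ip_sub_right, ip_comm k (kap d), hk.2]
    have hl' : l = k + kap d - j - n := by rw [h]; abel
    rcases hx with x | x | x | x <;> rcases hy with y | y | y | y <;>
      first
      | (exfalso; linarith)
      | skip
    all_goals
      rw [x] at pkj
      rw [y] at pkn
      rw [s0', x, y] at pnj
      simp only [s0', x, y]
      norm_num only [if_true, if_false, zero_mul, mul_zero, add_zero, zero_add, Int.cast_one,
        Int.cast_zero, one_mul, Int.cast_ofNat]
      simp only [neg_mul, add_mul, ← sg_add]
    all_goals
      try
        have e := s0'
        rw [x, y] at e
        norm_num only at e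
        have e := (hk.eq_iff hd.le hl).2 e
        have e' : kap d = j + n := by rw [hkap, ← e]; abel
        simp only [e', q_add_left, q_add_right] at pκ pk pj pn ⊢
        replace hl' := e.symm
        clear e
      try
        have e := (hk.eq_iff hd.le hj).2 x
        clear x
        subst e
      try
        have e := (hk.eq_iff hd.le hn).2 y
        clear y
        subst e
    all_goals
      subst hl'
      simp only [sg_eq_emod, q_add_left, q_add_right, q_sub_left, q_sub_right]
      norm_cast
      clear hlk hnk s0 s1 s2 c1 c2 c3 h1 h2 h3 h hkap hk hj hn hl hκ hκ1
      omega
  · rw [casimir_eq_zero, casimir_eq_zero, casimir_eq_zero, casimir_eq_zero]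
    · split_ifs with h1 h2 h2
      · simp only [sympl]
        subst h1 h2
        rw [if_neg]
        · simp
        · intro h'
          apply h; rw [← h']; abel
      · simp only [sympl]
        rw [if_neg]
        · simp
        · intro h'
          apply h; rw [← h', h1]; abel
      · simp only [sympl]
        rw [if_neg]
        · simp
        · intro h'
          apply h; rw [← h', h2]; abel
      · simp
    all_goals
      intro h'
      apply h
      rw [← sub_eq_iff_eq_add, ← add_left_inj] at h' ⊢
      rw [← sub_eq_zero] at h' ⊢
      rw [← h']
      abel

end Pic

end

section

/-! ### The weights of `R₁` and the roots of `E_d` -/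
namespace Pic

variable {d : ℕ}

/-- Indicator vector of a set of indices. -/
def ind (s : Finset (Fin d)) : Fin d → ℤ := fun i => if i ∈ s then 1 else 0

lemma ind_injective : Function.Injective (ind (d := d)) := fun s t h => by
  ext i
  have := congrFun h i
  by_cases h1 : i ∈ s <;> by_cases h2 : i ∈ t <;> simp_all [ind]

lemma sum_ind (s : Finset (Fin d)) : ∑ i, ind s i = s.card := by simp [ind]

lemma sum_ind_sq (s : Finset (Fin d)) : ∑ i, ind s i * ind s i = s.card := by simp [ind]

lemma ind_univ : ind (Finset.univ : Finset (Fin d)) = fun _ => 1 := by ext; simp [ind]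

lemma ind_singleton (i : Fin d) : ind {i} = Pi.single i 1 := by
  ext j; simp [ind, Pi.single_apply]

lemma ind_compl (s : Finset (Fin d)) : ind sᶜ = (fun _ => 1) - ind s := by
  ext i; by_cases h : i ∈ s <;> simp [ind, h]

/-- An integer vector whose entries and whose squared entries have the same sum has entries `0`
and `1`. -/
lemma exists_ind {m : Fin d → ℤ} {n : ℕ} (h1 : ∑ i, m i = n) (h2 : ∑ i, m i * m i = n) :
    ∃ s : Finset (Fin d), s.card = n ∧ m = ind s := by
  have h3 : ∑ i, m i * (m i - 1) = 0 := by
    simp only [mul_sub, mul_one, Finset.sum_sub_distrib, h1, h2, sub_self]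
  rw [Finset.sum_eq_zero_iff_of_nonneg] at h3
  · have h4 : m = ind (Finset.univ.filter fun i => m i = 1) := by
      ext i
      rcases mul_eq_zero.1 (h3 i (Finset.mem_univ i)) with h | h
      · simp [ind, h]
      · simp [ind, sub_eq_zero.1 h]
    refine ⟨_, ?_, h4⟩
    rw [h4, sum_ind] at h1
    exact_mod_cast h1
  · intro i _
    rcases le_or_gt (m i) 0 with h | h <;> nlinarith

lemma exists_single {m : Fin d → ℤ} (h1 : ∑ i, m i = 1) (h2 : ∑ i, m i * m i = 1) :
    ∃ i, m = Pi.single i 1 := by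
  obtain ⟨s, hs, rfl⟩ := exists_ind (n := 1) (by exact_mod_cast h1) (by exact_mod_cast h2)
  obtain ⟨i, rfl⟩ := Finset.card_eq_one.1 hs
  exact ⟨i, ind_singleton i⟩

/-- The weight of a basis vector of `R₁`, as a class in the Picard lattice. -/
def wt : ExcIdx d → Pic d
  | .inl i => (0, -Pi.single i 1)
  | .inr (.inl a) => (1, ind a.1)
  | .inr (.inr (.inl a)) => (2, ind a.1)
  | .inr (.inr (.inr p)) => (3, ind p.1.1 + Pi.single p.2 1)

/-- A multi-index with seven entries exists only for `d = 7`, and is the full one. -/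
lemma multi_seven_eq (hd : d ≤ 7) (A : Multi d 7) : d = 7 ∧ A.1 = Finset.univ := by
  have h1 := Finset.card_le_univ A.1
  rw [A.2, Fintype.card_fin] at h1
  have h2 : d = 7 := by omega
  refine ⟨h2, ?_⟩
  rw [← Finset.card_eq_iff_eq_univ, A.2, Fintype.card_fin, h2]

lemma wt_isLine (hd : d ≤ 7) (K : ExcIdx d) : IsLine (wt K) := by
  rcases K with i | a | a | ⟨A, x⟩
  · simp [IsLine, wt, kap, ip, Pi.single_apply]
  · simp [IsLine, wt, ip_kap, sum_ind, a.2]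
    simp [ip, sum_ind_sq, a.2]
  · simp [IsLine, wt, ip_kap, sum_ind, a.2]
    simp [ip, sum_ind_sq, a.2]
  · obtain ⟨rfl, hA⟩ := multi_seven_eq hd A
    simp only [IsLine, wt, ip_kap, hA, ind_univ]
    simp [ip, Finset.sum_add_distrib, mul_add, Pi.single_apply]

lemma wt_injective (hd : d ≤ 7) : Function.Injective (wt (d := d)) := by
  rintro (i | a | a | ⟨A, x⟩) (j | b | b | ⟨B, y⟩) h
  all_goals
    simp only [wt, Prod.mk.injEq] at h
    obtain ⟨h1, h2⟩ := h
    first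
    | (exfalso; revert h1; norm_num; done)
    | skip
  · have := congrFun h2 i
    simp [Pi.single_apply] at this
    rw [this]
  · rw [Subtype.ext (ind_injective h2)]
  · rw [Subtype.ext (ind_injective h2)]
  · have hAB : A = B := Subtype.ext ((multi_seven_eq hd A).2.trans (multi_seven_eq hd B).2.symm)
    subst hAB
    have := congrFun (add_left_cancel h2) x
    simp [Pi.single_apply] at this
    rw [this]

/-- The weights of `R₁` are all the lines: by the Cauchy–Schwarz inequality the first
component of a line lies between `0` and `3`, and each value gives one of the four types of basis
vectors. -/
lemma IsLine.exists_wt (hd : d ≤ 7) {x : Pic d} (hx : IsLine x) : ∃ K, wt K = x := by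
  obtain ⟨h, m⟩ := x
  obtain ⟨h1, h2⟩ := hx
  rw [ip_kap] at h2
  simp only [ip] at h1 h2
  have c1 : (∑ i, m i) ^ 2 ≤ d * ∑ i, m i ^ 2 := by
    simpa using sq_sum_le_card_mul_sum_sq (s := Finset.univ) (f := m)
  have c2 : ∑ i, m i ^ 2 = ∑ i, m i * m i := by simp [sq]
  have c3 : (d : ℤ) ≤ 7 := by exact_mod_cast hd
  have s1 : ∑ i, m i = 3 * h - 1 := by linarith
  have s2 : ∑ i, m i * m i = h * h + 1 := by linarith
  rw [c2, s1, s2] at c1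
  have c4 : -1 < h := by nlinarith
  have c5 : h < 4 := by nlinarith
  have hh : h = 0 ∨ h = 1 ∨ h = 2 ∨ h = 3 := by omega
  rcases hh with rfl | rfl | rfl | rfl
  · obtain ⟨i, hi⟩ := exists_single (m := -m) (by simp [s1]) (by simp [s2])
    exact ⟨.inl i, by simp [wt, ← hi]⟩
  · obtain ⟨s, hs, rfl⟩ := exists_ind (n := 2) (by rw [s1]; rfl) (by rw [s2]; rfl)
    exact ⟨.inr (.inl ⟨s, hs⟩), rfl⟩
  · obtain ⟨s, hs, rfl⟩ := exists_ind (n := 5) (by rw [s1]; rfl) (by rw [s2]; rfl)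
    exact ⟨.inr (.inr (.inl ⟨s, hs⟩)), rfl⟩
  -- For first component `3`, subtracting `1` from all entries leaves a unit vector, and `d = 7`.
  · have t1 : ∑ i, (m i - 1) = 8 - d := by simp [Finset.sum_sub_distrib, s1]
    have t2 : ∑ i, (m i - 1) * (m i - 1) = d - 6 := by
      simp only [sub_mul, mul_sub, Finset.sum_sub_distrib, s2]
      simp [s1]; ring
    have d7 : d = 7 := by
      have u1 : 0 ≤ ∑ i, (m i - 1) * (m i - 1) :=
        Finset.sum_nonneg fun i _ => mul_self_nonneg _
      rcases Nat.lt_or_ge d 7 with h7 | h7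
      · have h6 : d = 6 := by omega
        subst h6
        norm_num at t1 t2
        rw [Finset.sum_eq_zero_iff_of_nonneg fun i _ => mul_self_nonneg _] at t2
        have u2 : ∑ i, (m i - 1) = 0 := Finset.sum_eq_zero fun i hi => by simpa using t2 i hi
        simp [Finset.sum_sub_distrib, t1] at u2
      · omega
    subst d7
    obtain ⟨i, hi⟩ := exists_single (m := fun i => m i - 1) (by rw [t1]; rfl) (by rw [t2]; rfl)
    refine ⟨.inr (.inr (.inr (⟨Finset.univ, by simp⟩, i))), ?_⟩
    simp only [wt, ind_univ, ← hi]
    ext j <;> simp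

/-- The roots that do not lie in `gl(d)`, and the ones that do. They are found as the lines are,
the first component of a root lying between `-2` and `2`. -/
lemma isRoot_iff (hd : d ≤ 7) (x : Pic d) : IsRoot x ↔
    (∃ c : Multi d 3, (1, ind c.1) = x) ∨ (∃ c : Multi d 3, -(1, ind c.1) = x) ∨
    (∃ c : Multi d 6, (2, ind c.1) = x) ∨ (∃ c : Multi d 6, -(2, ind c.1) = x) ∨
    ∃ p : Fin d × Fin d, p.1 ≠ p.2 ∧ (0, Pi.single p.2 1 - Pi.single p.1 1) = x := by
  constructor
  · rintro ⟨h1, h2⟩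
    obtain ⟨h, m⟩ := x
    rw [ip_kap] at h2
    simp only [ip] at h1 h2
    have c1 : (∑ i, m i) ^ 2 ≤ d * ∑ i, m i ^ 2 := by
      simpa using sq_sum_le_card_mul_sum_sq (s := Finset.univ) (f := m)
    have c2 : ∑ i, m i ^ 2 = ∑ i, m i * m i := by simp [sq]
    have c3 : (d : ℤ) ≤ 7 := by exact_mod_cast hd
    have s1 : ∑ i, m i = 3 * h := by linarith
    have s2 : ∑ i, m i * m i = h * h + 2 := by linarith
    rw [c2, s1, s2] at c1
    have c4 : -3 < h := by nlinarith
    have c5 : h < 3 := by nlinarith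
    have hh : h = 0 ∨ h = 1 ∨ h = 2 ∨ h = -1 ∨ h = -2 := by omega
    rcases hh with rfl | rfl | rfl | rfl | rfl
    · norm_num at s1 s2
      obtain ⟨k, hk⟩ : ∃ k, 0 < m k := by
        by_contra! hn
        have := (Finset.sum_eq_zero_iff_of_nonpos fun i _ => hn i).1 s1
        rw [Finset.sum_eq_zero fun i hi => by rw [this i hi]; rfl] at s2
        norm_num at s2
      -- For a positive entry `m k`, the vector `Pi.single k 1 - m` has square `3 - 2 * m k ≥ 0`.
      have t1 : ∑ i, (Pi.single k (1 : ℤ) - m : Fin d → ℤ) i = 1 := by simp [s1]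
      have t2 : ∑ i, (Pi.single k (1 : ℤ) - m : Fin d → ℤ) i *
          (Pi.single k (1 : ℤ) - m : Fin d → ℤ) i = 3 - 2 * m k := by
        simp only [Pi.sub_apply, sub_mul, mul_sub, Finset.sum_sub_distrib, s2]
        simp [Pi.single_apply]; ring
      have t3 : 0 ≤ ∑ i, (Pi.single k (1 : ℤ) - m : Fin d → ℤ) i *
          (Pi.single k (1 : ℤ) - m : Fin d → ℤ) i :=
        Finset.sum_nonneg fun i _ => mul_self_nonneg _
      have hk1 : m k = 1 := by omega
      obtain ⟨c, hc⟩ := exists_single t1 (by rw [t2, hk1]; rfl)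
      refine Or.inr (Or.inr (Or.inr (Or.inr ⟨(c, k), ?_, ?_⟩)))
      · intro (h : c = k)
        have := congrFun hc k
        simp [hk1, h] at this
      · rw [← hc]; simp
    · obtain ⟨s, hs, rfl⟩ := exists_ind (n := 3) (by rw [s1]; rfl) (by rw [s2]; rfl)
      exact Or.inl ⟨⟨s, hs⟩, rfl⟩
    · obtain ⟨s, hs, rfl⟩ := exists_ind (n := 6) (by rw [s1]; rfl) (by rw [s2]; rfl)
      exact Or.inr (Or.inr (Or.inl ⟨⟨s, hs⟩, rfl⟩))
    · obtain ⟨s, hs, h'⟩ := exists_ind (n := 3) (m := -m) (by simp [s1]) (by simp [s2])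
      exact Or.inr (Or.inl ⟨⟨s, hs⟩, by simp [← h']⟩)
    · obtain ⟨s, hs, h'⟩ := exists_ind (n := 6) (m := -m) (by simp [s1]) (by simp [s2])
      exact Or.inr (Or.inr (Or.inr (Or.inl ⟨⟨s, hs⟩, by simp [← h']⟩)))
  · rintro (⟨c, rfl⟩ | ⟨c, rfl⟩ | ⟨c, rfl⟩ | ⟨c, rfl⟩ | ⟨p, hp, rfl⟩)
    · simp [IsRoot, ip_kap, sum_ind, c.2]
      simp [ip, sum_ind_sq, c.2]
    · simp [IsRoot, ip_kap, sum_ind, c.2]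
      simp [ip, sum_ind_sq, c.2]
    · simp [IsRoot, ip_kap, sum_ind, c.2]
      simp [ip, sum_ind_sq, c.2]
    · simp [IsRoot, ip_kap, sum_ind, c.2]
      simp [ip, sum_ind_sq, c.2]
    · simp [IsRoot, kap, ip, mul_sub, Pi.single_apply, hp, hp.symm]

lemma sum_ite_eq_of_injective {ι : Type*} [Fintype ι] {g : ι → Pic d} (hg : Function.Injective g)
    (x : Pic d) [Decidable (∃ c, g c = x)] :
    (∑ c, if g c = x then (1 : ℝ) else 0) = if ∃ c, g c = x then 1 else 0 := by
  split_ifs with h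
  · obtain ⟨c, rfl⟩ := h
    rw [Finset.sum_eq_single c]
    · simp
    · intro b _ hb
      rw [if_neg fun h => hb (hg h)]
    · simp
  · exact Finset.sum_eq_zero fun c _ => if_neg fun h' => h ⟨c, h'⟩

lemma single_sub_single_injective : ∀ {p p' : Fin d × Fin d}, p.1 ≠ p.2 → p'.1 ≠ p'.2 →
    (Pi.single p.2 1 - Pi.single p.1 1 : Fin d → ℤ) = Pi.single p'.2 1 - Pi.single p'.1 1 →
    p = p' := by
  rintro ⟨a, b⟩ ⟨c, e⟩ h1 h2 h
  have ha := congrFun h a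
  have hb := congrFun h b
  simp only [Pi.sub_apply, Pi.single_apply] at ha hb
  simp only [ne_eq] at h1 h2
  ext
  · split_ifs at ha <;> simp_all
  · split_ifs at hb <;> simp_all

/-- Summing over all generators of `E_d` outside the Cartan subalgebra is summing over roots. -/
lemma sum_roots (hd : d ≤ 7) (x : Pic d) [Decidable (IsRoot x)] :
    (∑ c : Multi d 3, if (1, ind c.1) = x then (1 : ℝ) else 0)
    + (∑ c : Multi d 3, if -(1, ind c.1) = x then (1 : ℝ) else 0)
    + (∑ c : Multi d 6, if (2, ind c.1) = x then (1 : ℝ) else 0)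
    + (∑ c : Multi d 6, if -(2, ind c.1) = x then (1 : ℝ) else 0)
    + (∑ p : Fin d × Fin d,
        if p.1 ≠ p.2 ∧ (0, Pi.single p.2 1 - Pi.single p.1 1) = x then (1 : ℝ) else 0)
    = if IsRoot x then 1 else 0 := by
  classical
  have i1 : Function.Injective fun c : Multi d 3 => ((1, ind c.1) : Pic d) :=
    fun a b h => Subtype.ext (ind_injective (Prod.ext_iff.1 h).2)
  have i2 : Function.Injective fun c : Multi d 6 => ((2, ind c.1) : Pic d) :=
    fun a b h => Subtype.ext (ind_injective (Prod.ext_iff.1 h).2)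
  have h5 : (∑ p : Fin d × Fin d,
        if p.1 ≠ p.2 ∧ (0, Pi.single p.2 1 - Pi.single p.1 1) = x then (1 : ℝ) else 0)
      = if ∃ p : Fin d × Fin d, p.1 ≠ p.2 ∧ (0, Pi.single p.2 1 - Pi.single p.1 1) = x
        then 1 else 0 := by
    split_ifs with h
    · obtain ⟨p, hp, rfl⟩ := h
      rw [Finset.sum_eq_single p, if_pos ⟨hp, rfl⟩]
      · rintro p' - hp'
        rw [if_neg]
        rintro ⟨h1, h2⟩
        exact hp' (single_sub_single_injective h1 hp (Prod.ext_iff.1 h2).2)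
      · simp
    · exact Finset.sum_eq_zero fun p _ => if_neg fun h' => h ⟨p, h'⟩
  rw [sum_ite_eq_of_injective i1, sum_ite_eq_of_injective (g := fun c : Multi d 3 => -(1, ind c.1))
    (neg_injective.comp i1), sum_ite_eq_of_injective i2, sum_ite_eq_of_injective
    (g := fun c : Multi d 6 => -(2, ind c.1)) (neg_injective.comp i2), h5]
  by_cases hx : IsRoot x
  · rw [if_pos hx]
    rw [isRoot_iff hd] at hx
    obtain ⟨h, m⟩ := x
    simp only [Prod.neg_mk, Prod.mk.injEq] at hx ⊢
    rcases hx with ⟨c, rfl, rfl⟩ | ⟨c, rfl, rfl⟩ | ⟨c, rfl, rfl⟩ | ⟨c, rfl, rfl⟩ | ⟨p, hp, rfl, rfl⟩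
    · rw [if_pos ⟨c, rfl, rfl⟩]; norm_num
    · rw [if_neg (by norm_num), if_pos ⟨c, rfl, rfl⟩]; norm_num
    · rw [if_neg (by norm_num), if_neg (by norm_num), if_pos ⟨c, rfl, rfl⟩]; norm_num
    · rw [if_neg (by norm_num), if_neg (by norm_num), if_neg (by norm_num),
        if_pos ⟨c, rfl, rfl⟩]; norm_num
    · rw [if_neg (by norm_num), if_neg (by norm_num), if_neg (by norm_num),
        if_neg (by norm_num), if_pos ⟨p, hp, rfl, rfl⟩]; norm_num
  · rw [if_neg hx]
    rw [isRoot_iff hd] at hx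
    push Not at hx
    obtain ⟨h1, h2, h3, h4, h6⟩ := hx
    rw [if_neg fun ⟨c, h⟩ => h1 c h, if_neg fun ⟨c, h⟩ => h2 c h, if_neg fun ⟨c, h⟩ => h3 c h,
      if_neg fun ⟨c, h⟩ => h4 c h, if_neg fun ⟨p, hp, h⟩ => h6 p hp h]
    norm_num
end Pic

end

section

/-! ### Generalized Kronecker deltas -/

variable {d : ℕ}

/-- Multiplicity vector of a tuple of indices. -/
def tupleVec {n : ℕ} (a : Fin n → Fin d) : Fin d → ℤ := ∑ i, Pi.single (a i) 1

/-- Number of inversions of a tuple. -/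
def inversions {n : ℕ} (a : Fin n → Fin d) : ℤ := ∑ i, ∑ j, if i < j ∧ a j < a i then 1 else 0

lemma gkd_comm {n : ℕ} (a b : Fin n → Fin d) : gkd n a b = gkd n b a := by
  rw [gkd, gkd, ← det_transpose]
  congr 1
  ext i j
  simp [kd, eq_comm]

lemma tupleVec_apply {n : ℕ} (a : Fin n → Fin d) (x : Fin d) :
    tupleVec a x = ∑ i, if a i = x then 1 else 0 := by
  simp [tupleVec, Finset.sum_apply, Pi.single_apply, eq_comm]

lemma sum_lt_eq_of_tupleVec_eq {n m : ℕ} {a : Fin n → Fin d} {b : Fin m → Fin d}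
    (h : tupleVec a = tupleVec b) (x : Fin d) :
    (∑ i, if a i < x then (1 : ℤ) else 0) = ∑ i, if b i < x then 1 else 0 := by
  have key : ∀ {n : ℕ} (a : Fin n → Fin d), (∑ i, if a i < x then (1 : ℤ) else 0)
      = ∑ y, if y < x then tupleVec a y else 0 := by
    intro n a
    have h1 : ∀ y, (if y < x then tupleVec a y else 0)
        = ∑ i, if a i = y then (if y < x then 1 else 0) else 0 := by
      intro y
      rw [tupleVec_apply]
      split_ifs <;> simp
    simp only [h1]
    rw [Finset.sum_comm]
    exact Finset.sum_congr rfl fun i _ => by simp only [Finset.sum_ite_eq, Finset.mem_univ, if_true]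
  rw [key, key, h]

lemma tupleVec_succ {n : ℕ} (a : Fin (n + 1) → Fin d) (j : Fin (n + 1)) :
    tupleVec a = Pi.single (a j) 1 + tupleVec (a ∘ j.succAbove) := by
  simp [tupleVec, Fin.sum_univ_succAbove _ j]

lemma inversions_succ {n : ℕ} (a : Fin (n + 1) → Fin d) :
    inversions a = (∑ i, if (a ∘ Fin.succ) i < a 0 then 1 else 0) + inversions (a ∘ Fin.succ) := by
  simp only [inversions, Fin.sum_univ_succ, Function.comp, Fin.succ_lt_succ_iff, Fin.succ_pos,
    Fin.not_lt_zero, true_and, false_and, if_false, zero_add]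

lemma inversions_strictMono {n : ℕ} {a : Fin n → Fin d} (h : StrictMono a) : inversions a = 0 := by
  refine Finset.sum_eq_zero fun i _ => Finset.sum_eq_zero fun j _ => if_neg ?_
  rintro ⟨h1, h2⟩
  exact absurd (h h1) h2.not_gt

/-- Against an increasing tuple, a generalized Kronecker delta is the sign that sorts its other
argument. The proof expands the determinant along its first row, which has at most one entry. -/
lemma gkd_eq {n : ℕ} (a : Fin n → Fin d) {c : Fin n → Fin d} (hc : StrictMono c) :
    gkd n a c = if tupleVec a = tupleVec c then Pic.sg (inversions a) else 0 := by
  induction n with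
  | zero => simp [gkd, tupleVec, inversions, Pic.sg_zero]
  | succ n ih =>
    have hexp : gkd (n + 1) a c = ∑ j : Fin (n + 1), (-1) ^ (j : ℕ) * kd (a 0) (c j) *
        gkd n (a ∘ Fin.succ) (c ∘ j.succAbove) := by
      rw [gkd, det_succ_row_zero]
      rfl
    rw [hexp]
    by_cases h0 : ∃ j, c j = a 0
    · obtain ⟨j, hj⟩ := h0
      rw [Finset.sum_eq_single j]
      · rw [ih _ (hc.comp (Fin.strictMono_succAbove j)), tupleVec_succ a 0, tupleVec_succ c j, hj]
        simp only [add_right_inj, Fin.succAbove_zero]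
        split_ifs with h
        · rw [inversions_succ, Pic.sg_add, sum_lt_eq_of_tupleVec_eq h, kd, if_pos rfl]
          have e1 : (∑ i, if (c ∘ j.succAbove) i < a 0 then (1 : ℤ) else 0)
              = ∑ i, if c i < c j then (1 : ℤ) else 0 := by
            rw [Fin.sum_univ_succAbove _ j]; simp [hj]
          have e2 : (∑ i, if c i < c j then (1 : ℤ) else 0) = ((j : ℕ) : ℤ) := by
            simp only [hc.lt_iff_lt]
            rw [Finset.sum_boole, ← Fin.card_Iio j]
            congr 2
            ext; simp
          rw [e1, e2, show Pic.sg (j : ℕ) = (-1) ^ (j : ℕ) from zpow_natCast _ _, mul_one]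
        · simp
      · intro b _ hb
        have : a 0 ≠ c b := fun h => hb (hc.injective (h.symm.trans hj.symm))
        simp [kd, this]
      · simp
    · push Not at h0
      rw [if_neg, Finset.sum_eq_zero]
      · intro j _
        simp [kd, (h0 j).symm]
      · intro h
        have h1 := congrFun h (a 0)
        rw [tupleVec_apply, tupleVec_apply, Fin.sum_univ_succ, if_pos rfl,
          Finset.sum_eq_zero (s := Finset.univ) (f := fun i => if c i = a 0 then (1 : ℤ) else 0)
            fun i _ => if_neg (h0 i)] at h1
        have h2 : (0 : ℤ) ≤ ∑ i : Fin n, if a i.succ = a 0 then 1 else 0 :=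
          Finset.sum_nonneg fun i _ => by split_ifs <;> simp
        omega

lemma tupleVec_append {m n : ℕ} (u : Fin m → Fin d) (w : Fin n → Fin d) :
    tupleVec (Fin.append u w) = tupleVec u + tupleVec w := by
  simp [tupleVec, Fin.sum_univ_add]

/-- The inversions of a concatenation of increasing tuples are counted by `q`: this is how the
cocycle arises from antisymmetrization. -/
lemma inversions_append {m n : ℕ} {u : Fin m → Fin d} {w : Fin n → Fin d} (hu : StrictMono u)
    (hw : StrictMono w) :
    inversions (Fin.append u w) = Pic.q (0, tupleVec u) (0, tupleVec w) := by
  have h1 : inversions (Fin.append u w) = inversions u + inversions w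
      + ∑ i, ∑ j, if w j < u i then 1 else 0 := by
    simp only [inversions, Fin.sum_univ_add, Fin.append_left, Fin.append_right,
      Finset.sum_add_distrib]
    have e1 : ∀ (i : Fin m) (j : Fin n), Fin.castAdd n i < Fin.natAdd m j := fun i j => by
      rw [Fin.lt_def]; simp; omega
    have e2 : ∀ (i : Fin m) (j : Fin n), ¬ Fin.natAdd m j < Fin.castAdd n i := fun i j =>
      (e1 i j).le.not_gt
    have e3 : ∀ i j : Fin m, Fin.castAdd n i < Fin.castAdd n j ↔ i < j := fun i j => Iff.rfl
    simp only [e1, e2, e3, Fin.natAdd_lt_natAdd_iff, true_and, false_and, if_false,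
      Finset.sum_const_zero]
    ring
  rw [h1, inversions_strictMono hu, inversions_strictMono hw]
  simp only [Pic.q, tupleVec_apply, zero_add]
  simp only [Finset.sum_mul_sum]
  have e3 : ∀ x y : Fin d, (if y < x then ∑ i, ∑ j, (if u i = x then (1 : ℤ) else 0) *
      (if w j = y then 1 else 0) else 0)
      = ∑ i, ∑ j, if u i = x then (if w j = y then if y < x then 1 else 0 else 0) else 0 := by
    intro x y
    split_ifs
    · refine Finset.sum_congr rfl fun i _ => Finset.sum_congr rfl fun j _ => ?_
      split_ifs <;> simp
    · simp
  simp only [e3]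
  have e4 : ∀ x, ∑ y, ∑ i, ∑ j, (if u i = x then (if w j = y then if y < x then (1 : ℤ) else 0
      else 0) else 0) = ∑ i, ∑ j, if u i = x then (if w j < x then 1 else 0) else 0 := by
    intro x
    rw [Finset.sum_comm]
    refine Finset.sum_congr rfl fun i _ => ?_
    rw [Finset.sum_comm]
    refine Finset.sum_congr rfl fun j _ => ?_
    split_ifs <;> simp_all
  simp only [e4]
  symm
  rw [Finset.sum_comm]
  refine Finset.sum_congr rfl fun i _ => ?_
  rw [Finset.sum_comm]
  refine Finset.sum_congr rfl fun j _ => ?_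
  simp

lemma gkd_append {m n : ℕ} {u : Fin m → Fin d} {w : Fin n → Fin d} {c : Fin (m + n) → Fin d}
    (hu : StrictMono u) (hw : StrictMono w) (hc : StrictMono c) :
    gkd (m + n) (Fin.append u w) c = if tupleVec u + tupleVec w = tupleVec c
      then Pic.sg (Pic.q (0, tupleVec u) (0, tupleVec w)) else 0 := by
  rw [gkd_eq _ hc, tupleVec_append, inversions_append hu hw]

lemma Multi.tup_strictMono {p : ℕ} (s : Multi d p) : StrictMono s.tup :=
  (s.1.orderEmbOfFin s.2).strictMono

lemma Multi.tupleVec_tup {p : ℕ} (s : Multi d p) : tupleVec s.tup = Pic.ind s.1 := by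
  ext x
  rw [tupleVec_apply, Pic.ind]
  split_ifs with h
  · obtain ⟨i, hi⟩ : x ∈ Set.range s.tup := by
      rw [Multi.tup, Finset.range_orderEmbOfFin]; exact h
    rw [Finset.sum_eq_single i]
    · rw [if_pos hi]
    · intro j _ hj
      exact if_neg fun h' => hj (s.tup_strictMono.injective (h'.trans hi.symm))
    · simp
  · refine Finset.sum_eq_zero fun i _ => if_neg fun h' => h ?_
    rw [← h', Multi.tup]
    exact Finset.orderEmbOfFin_mem _ _ _

lemma strictMono_one (b : Fin d) : StrictMono ![b] := fun i j h => by
  exact absurd h (by rw [Subsingleton.elim i j]; exact lt_irrefl _)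

lemma tupleVec_one (b : Fin d) : tupleVec ![b] = Pi.single b 1 := by simp [tupleVec]

end

section

/-! ### The generators of `E_d` in the weight basis -/

variable {d : ℕ}

lemma gkd_tup {m n : ℕ} (a : Multi d m) (b : Multi d n) (c : Multi d (m + n)) :
    gkd (m + n) (Fin.append a.tup b.tup) c.tup = if Pic.ind a.1 + Pic.ind b.1 = Pic.ind c.1
      then Pic.sg (Pic.q (0, Pic.ind a.1) (0, Pic.ind b.1)) else 0 := by
  rw [gkd_append a.tup_strictMono b.tup_strictMono c.tup_strictMono]
  simp only [Multi.tupleVec_tup]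

lemma gkd_single_tup {n : ℕ} (a : Fin d) (b : Multi d n) (c : Multi d (1 + n)) :
    gkd (1 + n) (Fin.append ![a] b.tup) c.tup = if Pi.single a 1 + Pic.ind b.1 = Pic.ind c.1
      then Pic.sg (Pic.q (0, Pi.single a 1) (0, Pic.ind b.1)) else 0 := by
  rw [gkd_append (strictMono_one a) b.tup_strictMono c.tup_strictMono]
  simp only [Multi.tupleVec_tup, tupleVec_one]

lemma gkd_tup_single {n : ℕ} (a : Multi d n) (b : Fin d) (c : Multi d (n + 1)) :
    gkd (n + 1) (Fin.append a.tup ![b]) c.tup = if Pic.ind a.1 + Pi.single b 1 = Pic.ind c.1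
      then Pic.sg (Pic.q (0, Pic.ind a.1) (0, Pi.single b 1)) else 0 := by
  rw [gkd_append a.tup_strictMono (strictMono_one b) c.tup_strictMono]
  simp only [Multi.tupleVec_tup, tupleVec_one]

lemma gkd_pair (a b : Fin d) (c : Multi d 2) :
    gkd 2 ![a, b] c.tup = if Pi.single a 1 + Pi.single b 1 = Pic.ind c.1
      then Pic.sg (Pic.q (0, Pi.single a 1) (0, Pi.single b 1)) else 0 := by
  have h : (![a, b] : Fin 2 → Fin d) = Fin.append ![a] ![b] := by
    ext i; fin_cases i <;> rfl
  rw [h, show gkd 2 (Fin.append ![a] ![b]) c.tup = _ from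
    gkd_append (m := 1) (n := 1) (strictMono_one a) (strictMono_one b) c.tup_strictMono]
  simp only [Multi.tupleVec_tup, tupleVec_one]

/-- Signs relating the basis of `R₁` to one in which the structure constants are a cocycle. -/
def basisSign : ExcIdx d → ℝ
  | .inl _ => 1
  | .inr (.inl _) => 1
  | .inr (.inr (.inl _)) => -1
  | .inr (.inr (.inr p)) => Pic.sg (Pic.q (0, Pi.single p.2 1) (0, fun _ => 1))

lemma basisSign_mul_self (K : ExcIdx d) : basisSign K * basisSign K = 1 := by
  rcases K with i | a | a | p <;> simp [basisSign, Pic.sg_mul_self]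

/-- The root vector in `R₁`: it maps each weight to the sum with the root, if that is a weight, with
the parity of `q` as sign, conjugated by `basisSign`. -/
def rootVec (g : Pic d) : Matrix (ExcIdx d) (ExcIdx d) ℝ := Matrix.of fun K J =>
  if Pic.wt K = Pic.wt J + g then basisSign K * basisSign J * Pic.sg (Pic.q g (Pic.wt J)) else 0

lemma rootVec_apply (g : Pic d) (K J : ExcIdx d) : rootVec g K J =
  if Pic.wt K = Pic.wt J + g then basisSign K * basisSign J * Pic.sg (Pic.q g (Pic.wt J)) else 0 :=
  rfl

lemma ite_zero_congr {p q : Prop} [Decidable p] [Decidable q] {a b : ℝ} (h : p ↔ q)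
    (hab : p → a = b) : (if p then a else 0) = if q then b else 0 := by
  by_cases hp : p
  · rw [if_pos hp, if_pos (h.1 hp), hab hp]
  · rw [if_neg hp, if_neg (mt h.2 hp)]

lemma rootVec_transpose {g : Pic d} (hg : Pic.IsRoot g) : (rootVec g)ᵀ = -rootVec (-g) := by
  ext K J
  rw [transpose_apply, Matrix.neg_apply, rootVec_apply, rootVec_apply, ← mul_neg_one, ite_mul,
    zero_mul]
  refine ite_zero_congr ?_ fun h1 => ?_
  · rw [← sub_eq_add_neg, eq_sub_iff_add_eq, eq_comm]
  · have h2 : Pic.sg (Pic.q g (Pic.wt K)) = - Pic.sg (Pic.q (-g) (Pic.wt K + g)) := by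
      apply Pic.sg_eq_neg
      have := Pic.q_swap g g
      rw [hg.1, hg.2] at this
      simp only [Pic.q_neg_left, Pic.q_add_right]
      omega
    rw [h1, h2]; ring

/-- `q` does not depend on first components. -/
lemma q_congr (h h' : ℤ) (u v : Fin d → ℤ) : Pic.q (h, u) (h', v) = Pic.q (0, u) (0, v) := rfl

lemma q_add_left' (u v w : Fin d → ℤ) :
    Pic.q (0, u + v) (0, w) = Pic.q (0, u) (0, w) + Pic.q (0, v) (0, w) :=
  Pic.q_add_left (0, u) (0, v) (0, w)

lemma q_add_right' (u v w : Fin d → ℤ) :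
    Pic.q (0, u) (0, v + w) = Pic.q (0, u) (0, v) + Pic.q (0, u) (0, w) :=
  Pic.q_add_right (0, u) (0, v) (0, w)

lemma q_sub_left' (u v w : Fin d → ℤ) :
    Pic.q (0, u - v) (0, w) = Pic.q (0, u) (0, w) - Pic.q (0, v) (0, w) := by
  simpa using Pic.q_sub_left (0, u) (0, v) (0, w)

lemma q_sub_right' (u v w : Fin d → ℤ) :
    Pic.q (0, u) (0, v - w) = Pic.q (0, u) (0, v) - Pic.q (0, u) (0, w) := by
  simpa using Pic.q_sub_right (0, u) (0, v) (0, w)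

lemma q_single_single (c k : Fin d) :
    Pic.q (0, Pi.single c 1) (0, Pi.single k 1) = if k < c then 1 else 0 := by
  have h : ∀ i j : Fin d, (if j < i then (Pi.single c 1 : Fin d → ℤ) i *
      (Pi.single k 1 : Fin d → ℤ) j else 0) =
      if i = c then (if j = k then (if j < i then 1 else 0) else 0) else 0 := fun i j => by
    simp only [Pi.single_apply]
    split_ifs <;> simp_all
  simp only [Pic.q, h]
  simp

/-- The parity of the cocycle on a root and a line whose sum is a line. -/
lemma q_swap_of_add (hd : d ≤ 7) {g : Pic d} (hg : Pic.IsRoot g) {K J : ExcIdx d}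
    (h : Pic.wt K = Pic.wt J + g) :
    Pic.q (Pic.wt J) g + Pic.q g (Pic.wt J) = 8 * ((Pic.wt J).1 * g.1) + 1 - 3 * g.1 := by
  rw [Pic.q_swap, hg.2, (Pic.wt_isLine hd J).2,
    ((Pic.wt_isLine hd J).add_root hg).1 (h ▸ Pic.wt_isLine hd K)]
  ring

lemma q_single_one_swap (x : Fin d) : Pic.q (0, Pi.single x 1) (0, fun _ => 1)
    + Pic.q (0, fun _ => 1) (0, Pi.single x 1) = d - 1 := by
  rw [Pic.q_add_q_swap]; simp [Pi.single_apply]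

lemma isRoot_three (hd : d ≤ 7) (c : Multi d 3) : Pic.IsRoot (1, Pic.ind c.1) :=
  (Pic.isRoot_iff hd _).2 (Or.inl ⟨c, rfl⟩)

lemma isRoot_six (hd : d ≤ 7) (c : Multi d 6) : Pic.IsRoot (2, Pic.ind c.1) :=
  (Pic.isRoot_iff hd _).2 (Or.inr (Or.inr (Or.inl ⟨c, rfl⟩)))

lemma isRoot_gl (hd : d ≤ 7) {c k : Fin d} (h : c ≠ k) :
    Pic.IsRoot ((0, Pi.single k 1 - Pi.single c 1) : Pic d) :=
  (Pic.isRoot_iff hd _).2 (Or.inr (Or.inr (Or.inr (Or.inr ⟨(c, k), h, rfl⟩))))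

/-- Within a multi-index with seven entries, complements exist and are unique; the sums over
contracted indices in the generators thus have a single term. -/
lemma exists_compl (hd : d ≤ 7) (A : Multi d 7) {p r : ℕ} (b : Multi d p) (h : p + r = 7) :
    ∃ e₀ : Multi d r, ∀ e : Multi d r, Pic.ind b.1 + Pic.ind e.1 = Pic.ind A.1 ↔ e = e₀ := by
  obtain ⟨hd7, hA⟩ := Pic.multi_seven_eq hd A
  refine ⟨⟨b.1ᶜ, by rw [Finset.card_compl, b.2, Fintype.card_fin]; omega⟩, fun e => ?_⟩
  rw [hA, Pic.ind_univ, ← eq_sub_iff_add_eq', ← Pic.ind_compl, Pic.ind_injective.eq_iff,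
    Subtype.ext_iff]

lemma exists_compl_single (hd : d ≤ 7) (A : Multi d 7) (b : Multi d 6) :
    ∃ e₀ : Fin d, ∀ e : Fin d, Pic.ind b.1 + Pi.single e 1 = Pic.ind A.1 ↔ e = e₀ := by
  obtain ⟨⟨s, hs⟩, he⟩ := exists_compl hd A b (r := 1) rfl
  obtain ⟨e₀, rfl⟩ := Finset.card_eq_one.1 hs
  refine ⟨e₀, fun e => ?_⟩
  rw [← Pic.ind_singleton, he ⟨{e}, Finset.card_singleton e⟩]
  simp

lemma excR3Lo_eq (hd : d ≤ 7) (c : Multi d 3) : excR3Lo c = rootVec (1, Pic.ind c.1) := by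
  ext (i | a | a | ⟨A, x⟩) (j | b | b | ⟨B, y⟩)
  all_goals
    simp only [excR3Lo, rootVec_apply, of_apply]
    try (rw [if_neg (by simp [Pic.wt])]; done)
  · rw [show gkd 3 (Fin.append ![j] a.tup) c.tup = _ from gkd_single_tup j a c]
    have hiff : Pi.single j 1 + Pic.ind a.1 = Pic.ind c.1 ↔
        Pic.wt (Sum.inr (Sum.inl a)) = Pic.wt (Sum.inl j) + (1, Pic.ind c.1) := by
      simp only [Pic.wt, Prod.mk_add_mk, Prod.mk.injEq]
      exact ⟨fun h => ⟨rfl, by rw [← h]; abel⟩, fun h => by rw [h.2]; abel⟩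
    refine ite_zero_congr hiff fun h => ?_
    have hq := q_swap_of_add hd (isRoot_three hd c) (hiff.1 h)
    have hj := q_single_single j j
    have hn : (0, -Pi.single j 1) = -((0, Pi.single j 1) : Pic d) := by simp
    simp only [basisSign, Pic.wt, one_mul, hn, Pic.q_neg_left, Pic.q_neg_right, ← h,
      q_congr, q_add_left', q_add_right'] at hq ⊢
    rw [if_neg (lt_irrefl _)] at hj
    apply Pic.sg_eq
    omega
  · rw [gkd_comm, show gkd 5 (Fin.append b.tup c.tup) a.tup = _ from gkd_tup b c a]
    have hiff : Pic.ind b.1 + Pic.ind c.1 = Pic.ind a.1 ↔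
        Pic.wt (Sum.inr (Sum.inr (Sum.inl a)))
          = Pic.wt (Sum.inr (Sum.inl b)) + (1, Pic.ind c.1) := by
      simp only [Pic.wt, Prod.mk_add_mk, Prod.mk.injEq]
      exact ⟨fun h => ⟨rfl, h.symm⟩, fun h => h.2.symm⟩
    rw [← neg_one_mul, mul_ite, mul_zero]
    refine ite_zero_congr hiff fun h => ?_
    have hq := q_swap_of_add hd (isRoot_three hd c) (hiff.1 h)
    simp only [basisSign, Pic.wt, q_congr, mul_one] at hq ⊢
    congr 1
    apply Pic.sg_eq
    omega
  · obtain ⟨e, he⟩ := exists_compl hd A b (r := 2) rfl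
    have hiff : Pic.ind e.1 + Pi.single x 1 = Pic.ind c.1 ↔
        Pic.wt (Sum.inr (Sum.inr (Sum.inr (A, x))))
          = Pic.wt (Sum.inr (Sum.inr (Sum.inl b))) + (1, Pic.ind c.1) := by
      have := (he e).2 rfl
      simp only [Pic.wt, Prod.mk_add_mk, Prod.mk.injEq, ← this]
      exact ⟨fun h => ⟨rfl, by rw [← h]; abel⟩, fun h => by
        have h2 := h.2
        rw [add_assoc] at h2
        exact add_left_cancel h2⟩
    have hsum : (∑ e : Multi d 2, gkd 7 A.tup (Fin.append b.tup e.tup)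
          * gkd 3 (Fin.append e.tup ![x]) c.tup)
        = if Pic.ind e.1 + Pi.single x 1 = Pic.ind c.1 then
          Pic.sg (Pic.q (0, Pic.ind b.1) (0, Pic.ind e.1)) *
          Pic.sg (Pic.q (0, Pic.ind e.1) (0, Pi.single x 1)) else 0 := by
      rw [Finset.sum_eq_single e]
      · rw [gkd_comm, show gkd 7 (Fin.append b.tup e.tup) A.tup = _ from gkd_tup b e A,
          if_pos ((he e).2 rfl), show gkd 3 (Fin.append e.tup ![x]) c.tup = _ from
          gkd_tup_single e x c, mul_ite, mul_zero]
      · intro e' _ h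
        rw [gkd_comm, show gkd 7 (Fin.append b.tup e'.tup) A.tup = _ from gkd_tup b e' A,
          if_neg (mt (he e').1 h), zero_mul]
      · simp
    rw [hsum, ← neg_one_mul, mul_ite, mul_zero]
    refine ite_zero_congr hiff fun h => ?_
    have hq := q_swap_of_add hd (isRoot_three hd c) (hiff.1 h)
    have h1 := q_single_one_swap x
    obtain ⟨hd7, hA⟩ := Pic.multi_seven_eq hd A
    rw [← Pic.ind_univ, ← hA] at h1
    simp only [basisSign]
    rw [← Pic.ind_univ, ← hA]
    simp only [Pic.wt, ← h, q_congr, ← (he e).2 rfl, q_add_left', q_add_right'] at hq h1 ⊢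
    rw [← Pic.sg_add, neg_one_mul, mul_neg_one, neg_mul, ← Pic.sg_add]
    congr 1
    apply Pic.sg_eq
    omega

lemma excR6Lo_eq (hd : d ≤ 7) (c : Multi d 6) : excR6Lo c = rootVec (2, Pic.ind c.1) := by
  ext (i | a | a | ⟨A, x⟩) (j | b | b | ⟨B, y⟩)
  all_goals
    simp only [excR6Lo, rootVec_apply, of_apply]
    try (rw [if_neg (by simp [Pic.wt])]; done)
  · rw [show gkd 6 (Fin.append ![j] a.tup) c.tup = _ from gkd_single_tup j a c]
    have hiff : Pi.single j 1 + Pic.ind a.1 = Pic.ind c.1 ↔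
        Pic.wt (Sum.inr (Sum.inr (Sum.inl a))) = Pic.wt (Sum.inl j) + (2, Pic.ind c.1) := by
      simp only [Pic.wt, Prod.mk_add_mk, Prod.mk.injEq]
      exact ⟨fun h => ⟨rfl, by rw [← h]; abel⟩, fun h => by rw [h.2]; abel⟩
    refine ite_zero_congr hiff fun h => ?_
    have hq := q_swap_of_add hd (isRoot_six hd c) (hiff.1 h)
    have hj := q_single_single j j
    have hn : (0, -Pi.single j 1) = -((0, Pi.single j 1) : Pic d) := by simp
    simp only [basisSign, Pic.wt, mul_one, hn, Pic.q_neg_left, Pic.q_neg_right, ← h,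
      q_congr, q_add_left', q_add_right'] at hq ⊢
    rw [if_neg (lt_irrefl _)] at hj
    rw [neg_one_mul]
    apply Pic.sg_eq_neg
    omega
  · obtain ⟨e, he⟩ := exists_compl_single hd A c
    have hiff : Pi.single x 1 + Pi.single e 1 = Pic.ind b.1 ↔
        Pic.wt (Sum.inr (Sum.inr (Sum.inr (A, x))))
          = Pic.wt (Sum.inr (Sum.inl b)) + (2, Pic.ind c.1) := by
      have := (he e).2 rfl
      simp only [Pic.wt, Prod.mk_add_mk, Prod.mk.injEq, ← this]
      exact ⟨fun h => ⟨rfl, by rw [← h]; abel⟩, fun h => by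
        have h2 := h.2
        rw [add_assoc, add_comm (Pic.ind b.1)] at h2
        rw [← add_left_cancel h2, add_comm]⟩
    have hsum : (∑ e : Fin d, gkd 2 ![x, e] b.tup * gkd 7 A.tup (Fin.append c.tup ![e]))
        = if Pi.single x 1 + Pi.single e 1 = Pic.ind b.1 then
          Pic.sg (Pic.q (0, Pi.single x 1) (0, Pi.single e 1)) *
          Pic.sg (Pic.q (0, Pic.ind c.1) (0, Pi.single e 1)) else 0 := by
      rw [Finset.sum_eq_single e]
      · rw [gkd_comm A.tup, show gkd 7 (Fin.append c.tup ![e]) A.tup = _ from gkd_tup_single c e A,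
          if_pos ((he e).2 rfl), gkd_pair, ite_mul, zero_mul]
      · intro e' _ h
        rw [gkd_comm A.tup, show gkd 7 (Fin.append c.tup ![e']) A.tup = _ from
          gkd_tup_single c e' A, if_neg (mt (he e').1 h), mul_zero]
      · simp
    rw [hsum, ← neg_one_mul, mul_ite, mul_zero]
    refine ite_zero_congr hiff fun h => ?_
    have hq := q_swap_of_add hd (isRoot_six hd c) (hiff.1 h)
    have h1 := q_single_one_swap e
    obtain ⟨hd7, hA⟩ := Pic.multi_seven_eq hd A
    rw [← Pic.ind_univ, ← hA] at h1
    simp only [basisSign]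
    rw [← Pic.ind_univ, ← hA]
    simp only [Pic.wt, ← h, q_congr, ← (he e).2 rfl, q_add_left', q_add_right'] at hq h1 ⊢
    rw [← Pic.sg_add, neg_one_mul, mul_one, ← Pic.sg_add]
    symm
    apply Pic.sg_eq_neg
    omega

end

section

variable {d : ℕ}

/-- Raising generators are minus the transposes of lowering ones. -/
lemma excR3Up_eq (hd : d ≤ 7) (c : Multi d 3) : excR3Up c = rootVec (-(1, Pic.ind c.1)) := by
  rw [← neg_neg (rootVec (-(1, Pic.ind c.1))), ← rootVec_transpose (isRoot_three hd c),
    ← excR3Lo_eq hd]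
  ext (i | a | a | ⟨A, x⟩) (j | b | b | ⟨B, y⟩) <;>
    simp [excR3Lo, excR3Up]
  · rw [gkd_comm]
  · rw [gkd_comm]
  · exact Finset.sum_congr rfl fun e _ => by rw [gkd_comm, gkd_comm c.tup]

lemma excR6Up_eq (hd : d ≤ 7) (c : Multi d 6) : excR6Up c = rootVec (-(2, Pic.ind c.1)) := by
  rw [← neg_neg (rootVec (-(2, Pic.ind c.1))), ← rootVec_transpose (isRoot_six hd c),
    ← excR6Lo_eq hd]
  ext (i | a | a | ⟨A, x⟩) (j | b | b | ⟨B, y⟩) <;>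
    simp [excR6Lo, excR6Up]
  · rw [gkd_comm]
  · exact Finset.sum_congr rfl fun e _ => by rw [gkd_comm, gkd_comm B.tup]

/-- The `gl(d)` generator on forms replaces the index `k` by `c`, up to a sign. -/
lemma glForm_eq (q : ℕ) (c k : Fin d) (a b : Multi d (q + 1)) : glForm q c k a b =
    if k ∈ a.1 ∧ Pi.single c 1 + Pic.ind a.1 = Pic.ind b.1 + Pi.single k 1 then
      - (Pic.sg (Pic.q (0, Pi.single k 1) (0, Pic.ind a.1 - Pi.single k 1))
        * Pic.sg (Pic.q (0, Pi.single c 1) (0, Pic.ind a.1 - Pi.single k 1))) else 0 := by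
  have hcast : ∀ (a : Multi d (q + 1)) (u : Fin d) (e : Multi d q),
      gkd (1 + q) (Fin.append ![u] e.tup) (a.tup ∘ Fin.cast (Nat.add_comm 1 q))
      = if Pi.single u 1 + Pic.ind e.1 = Pic.ind a.1
        then Pic.sg (Pic.q (0, Pi.single u 1) (0, Pic.ind e.1)) else 0 := by
    intro a u e
    have hm : StrictMono (a.tup ∘ Fin.cast (Nat.add_comm 1 q)) :=
      a.tup_strictMono.comp (Fin.castOrderIso (Nat.add_comm 1 q)).strictMono
    have hv : tupleVec (a.tup ∘ Fin.cast (Nat.add_comm 1 q)) = Pic.ind a.1 := by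
      rw [← a.tupleVec_tup, tupleVec, tupleVec]
      exact (finCongr (Nat.add_comm 1 q)).sum_comp fun i => (Pi.single (a.tup i) 1 : Fin d → ℤ)
    rw [gkd_append (strictMono_one u) e.tup_strictMono hm, hv, e.tupleVec_tup, tupleVec_one]
  rw [glForm]
  simp only [gkd_comm (a.tup ∘ Fin.cast (Nat.add_comm 1 q)), hcast]
  by_cases hk : k ∈ a.1
  · obtain ⟨e₀, h₀⟩ : ∃ e₀ : Multi d q, Pi.single k 1 + Pic.ind e₀.1 = Pic.ind a.1 := by
      refine ⟨⟨a.1.erase k, by rw [Finset.card_erase_of_mem hk, a.2]; rfl⟩, ?_⟩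
      ext i
      by_cases h : i = k
      · subst h; simp [Pic.ind, hk]
      · simp [Pic.ind, h]
    have h1 : Pic.ind a.1 - Pi.single k 1 = Pic.ind e₀.1 := by rw [← h₀]; abel
    rw [Finset.sum_eq_single e₀, if_pos h₀, h1, mul_ite, mul_zero]
    · rw [← neg_one_mul, mul_ite, mul_zero, neg_one_mul]
      refine ite_zero_congr ?_ fun _ => rfl
      rw [and_iff_right hk, ← h₀]
      constructor
      · intro h; rw [← h]; abel
      · intro h
        have h2 : Pi.single k 1 + (Pi.single c 1 + Pic.ind e₀.1) = Pi.single k 1 + Pic.ind b.1 := by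
          rw [add_comm _ (Pic.ind b.1), ← h]; abel
        exact add_left_cancel h2
    · intro e _ he
      rw [if_neg, zero_mul]
      intro h
      exact he (Subtype.ext (Pic.ind_injective (add_left_cancel (h.trans h₀.symm))))
    · simp
  · rw [if_neg fun h => hk h.1, Finset.sum_eq_zero, neg_zero]
    intro e _
    rw [if_neg, zero_mul]
    intro h
    have := congrFun h k
    simp only [Pi.add_apply, Pi.single_eq_same, Pic.ind, if_neg hk] at this
    split_ifs at this <;> omega

lemma kd_mul_kd {κ : Type*} [DecidableEq κ] {κ' : Type*} [DecidableEq κ'] (a b : κ) (c e : κ') :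
    kd a b * kd c e = if a = b ∧ c = e then 1 else 0 := by
  simp only [kd]
  split_ifs <;> simp_all

/-- The Cartan generators are diagonal, with weights as entries up to a shift. -/
lemma excK_self (hd : d ≤ 7) (c : Fin d) : excK c c =
    diagonal fun K : ExcIdx d => 1 / (9 - (d : ℝ)) - ((Pic.wt K).2 c : ℝ) := by
  have hg : ∀ (q : ℕ) (a b : Multi d (q + 1)), glForm q c c a b
      = if a = b then -(Pic.ind a.1 c : ℝ) else 0 := by
    intro q a b
    rw [glForm_eq, Pic.sg_mul_self]
    simp only [add_comm (Pi.single c 1), add_left_inj, Pic.ind_injective.eq_iff, Subtype.ext_iff]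
    by_cases h : c ∈ a.1 <;> simp [h, Pic.ind]
  ext K J
  rw [excK, Matrix.add_apply, Matrix.smul_apply, diagonal_apply, one_apply]
  rcases K with i | a | a | ⟨A, x⟩ <;> rcases J with j | b | b | ⟨B, y⟩
  all_goals
    simp only [of_apply, hg, Sum.inl.injEq, Sum.inr.injEq, reduceCtorEq, if_false, Pic.wt]
    try simp only [smul_zero, add_zero]
  · by_cases h : i = j
    · subst h
      by_cases h2 : i = c
      · subst h2; simp [kd]; ring
      · simp [kd, h2, Ne.symm h2]
    · by_cases h2 : i = c
      · subst h2; simp [kd, h]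
      · simp [kd, h2, h]
  · by_cases h : a = b
    · simp [kd, h]; ring
    · simp [h]
  · by_cases h : a = b
    · simp [kd, h]; ring
    · simp [h]
  · have hA : A = B := Subtype.ext
      ((Pic.multi_seven_eq hd A).2.trans (Pic.multi_seven_eq hd B).2.symm)
    subst hA
    by_cases h : x = y
    · subst h
      by_cases h2 : x = c
      · subst h2; simp [kd]; ring
      · simp [kd, h2, Ne.symm h2]; ring
    · by_cases h2 : x = c
      · subst h2; simp [kd, h, Ne.symm h]
      · simp [kd, h2, h]

lemma excK_of_ne (hd : d ≤ 7) {c k : Fin d} (h : c ≠ k) : excK c k =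
    Pic.sg (Pic.q (0, Pi.single c 1) (0, Pi.single k 1)) •
      rootVec (0, Pi.single k 1 - Pi.single c 1) := by
  have hkd : kd c k = 0 := if_neg h
  have hroot := isRoot_gl hd h
  have hck : Pic.q (0, Pi.single c 1) (0, Pi.single k 1)
      + Pic.q (0, Pi.single k 1) (0, Pi.single c 1) = 1 := by
    rw [Pic.q_add_q_swap]; simp [Pi.single_apply, h.symm]
  have hcc := q_single_single c c
  have hkk := q_single_single k k
  rw [if_neg (lt_irrefl _)] at hcc hkk
  rw [excK, hkd, zero_div, zero_smul, add_zero]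
  have hform : ∀ (q : ℕ) (a b : Multi d (q + 1)) (h₁ : ℤ) (s : ℝ), s * s = 1 →
      glForm q c k a b = Pic.sg (Pic.q (0, Pi.single c 1) (0, Pi.single k 1)) *
        if ((h₁, Pic.ind a.1) : Pic d) = (h₁, Pic.ind b.1) + (0, Pi.single k 1 - Pi.single c 1)
        then s * s * Pic.sg (Pic.q (0, Pi.single k 1 - Pi.single c 1) (h₁, Pic.ind b.1))
        else 0 := by
    intro q a b h₁ s hs
    rw [glForm_eq, mul_ite, mul_zero]
    refine ite_zero_congr ?_ fun h' => ?_
    · simp only [Prod.mk_add_mk, Prod.mk.injEq, add_zero, true_and]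
      constructor
      · rintro ⟨-, h'⟩
        rw [← add_sub_assoc, ← h']; abel
      · intro h'
        refine ⟨?_, by rw [h']; abel⟩
        by_contra hk
        have := congrFun h' k
        simp only [Pi.add_apply, Pi.sub_apply, Pi.single_eq_same, Pi.single_eq_of_ne h.symm,
          Pic.ind, if_neg hk] at this
        split_ifs at this <;> omega
    · have h2 : Pic.ind b.1 = Pic.ind a.1 + Pi.single c 1 - Pi.single k 1 := by
        rw [add_comm (Pic.ind a.1), h'.2]; abel
      rw [hs, one_mul, h2, ← Pic.sg_add, ← Pic.sg_add]
      simp only [q_congr, q_add_right', q_sub_left', q_sub_right']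
      symm
      apply Pic.sg_eq_neg
      omega
  ext (i | a | a | ⟨A, x⟩) (j | b | b | ⟨B, y⟩)
  all_goals
    simp only [Matrix.smul_apply, smul_eq_mul, rootVec_apply, of_apply]
    try (rw [if_neg (by simp [Pic.wt]), mul_zero]; done)
  · rw [mul_ite, mul_zero, kd_mul_kd]
    refine ite_zero_congr ?_ fun h' => ?_
    · simp only [Pic.wt, Prod.mk_add_mk, Prod.mk.injEq, add_zero, true_and]
      constructor
      · rintro ⟨rfl, rfl⟩; abel
      · intro h'
        have e1 := congrFun h' c
        have e2 := congrFun h' k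
        simp only [Pi.add_apply, Pi.sub_apply, Pi.neg_apply, Pi.single_apply, h, h.symm, if_true,
          if_false] at e1 e2
        constructor
        · by_contra hn
          rw [if_neg (fun h' : c = i => hn h'.symm)] at e1
          split_ifs at e1 <;> omega
        · by_contra hn
          rw [if_neg hn] at e2
          split_ifs at e2 <;> omega
    · obtain ⟨rfl, rfl⟩ := h'
      have hn : (0, -Pi.single k 1) = -((0, Pi.single k 1) : Pic d) := by simp
      simp only [basisSign, Pic.wt, hn, Pic.q_neg_right, q_sub_left', one_mul]
      rw [← Pic.sg_add, ← Pic.sg_zero]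
      apply Pic.sg_eq
      omega
  · exact hform 1 a b 1 1 (by norm_num)
  · exact hform 4 a b 2 (-1) (by norm_num)
  · have hA : A = B := Subtype.ext
      ((Pic.multi_seven_eq hd A).2.trans (Pic.multi_seven_eq hd B).2.symm)
    subst hA
    obtain ⟨hd7, hA⟩ := Pic.multi_seven_eq hd A
    rw [glForm_eq, if_neg, zero_mul, zero_sub, mul_ite, mul_zero]
    · rw [kd_mul_kd, kd, if_pos rfl, one_mul]
      rw [← neg_one_mul, mul_ite, mul_zero]
      refine ite_zero_congr ?_ fun h' => ?_
      · simp only [Pic.wt, Prod.mk_add_mk, Prod.mk.injEq, add_zero, true_and, add_assoc,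
          add_right_inj]
        constructor
        · rintro ⟨rfl, rfl⟩; abel
        · intro h'
          have e1 := congrFun h' c
          have e2 := congrFun h' k
          simp only [Pi.add_apply, Pi.sub_apply, Pi.single_apply, h, h.symm, if_true,
            if_false] at e1 e2
          constructor
          · by_contra hn
            rw [if_neg (fun h' : k = x => hn h'.symm)] at e2
            split_ifs at e2 <;> omega
          · by_contra hn
            rw [if_neg (fun h' : c = y => hn h'.symm)] at e1
            split_ifs at e1 <;> omega
      · obtain ⟨rfl, rfl⟩ := h'
        have h1 := q_single_one_swap x
        have h2 := q_single_one_swap y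
        simp only [basisSign, Pic.wt, q_congr, hA, Pic.ind_univ, q_add_right', q_sub_left']
        simp only [← Pic.sg_add]
        rw [mul_one, ← Pic.sg_zero]
        symm
        apply Pic.sg_eq_neg
        omega
    · rintro ⟨-, h'⟩
      rw [add_comm, add_right_inj] at h'
      have := congrFun h' c
      simp [h] at this

end

section

/-! ### The quadratic Casimir of `E_d` -/

variable {d : ℕ}

/-- The contribution of a pair of opposite roots to the Casimir: only the root `g = J - K` enters in
the component `K, J`, so that the sum over all roots collapses. -/
lemma rootVec_neg_mul_rootVec (g : Pic d) (K J L I : ExcIdx d) :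
    rootVec (-g) K J * rootVec g L I = (if g = Pic.wt J - Pic.wt K then 1 else 0) *
      (if Pic.wt K + Pic.wt L = Pic.wt J + Pic.wt I then
        basisSign K * basisSign J * basisSign L * basisSign I *
          Pic.sg (Pic.q (Pic.wt J - Pic.wt K) (Pic.wt J + Pic.wt I)) else 0) := by
  rw [rootVec_apply, rootVec_apply]
  by_cases hg : g = Pic.wt J - Pic.wt K
  · rw [if_pos hg, one_mul, if_pos (by rw [hg]; abel), ← hg, mul_ite, mul_zero]
    refine ite_zero_congr ?_ fun _ => ?_
    · rw [hg]
      constructor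
      · intro h; rw [h]; abel
      · intro h
        have : Pic.wt L = Pic.wt K + Pic.wt L - Pic.wt K := by abel
        rw [this, h]; abel
    · rw [Pic.q_neg_left, Pic.q_add_right, Pic.sg_add]
      have : Pic.sg (-Pic.q g (Pic.wt J)) = Pic.sg (Pic.q g (Pic.wt J)) :=
        Pic.sg_eq (by omega)
      rw [this]; ring
  · rw [if_neg hg, zero_mul, if_neg, zero_mul]
    intro h
    exact hg (by rw [h]; abel)

lemma sum_excK_self (hd : d ≤ 7) : ∑ a : Fin d, excK a a =
    diagonal fun K : ExcIdx d => 9 * (1 / (9 - (d : ℝ))) - 3 * ((Pic.wt K).1 : ℝ) := by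
  have hne : (9 - (d : ℝ)) ≠ 0 := by
    have : (d : ℝ) ≤ 7 := by exact_mod_cast hd
    linarith
  ext K J
  rw [Matrix.sum_apply]
  simp only [excK_self hd, diagonal_apply]
  by_cases h : K = J
  · simp only [if_pos h, Finset.sum_sub_distrib]
    have h1 := (Pic.wt_isLine hd K).2
    rw [Pic.ip_kap] at h1
    have h2 : (∑ i, ((Pic.wt K).2 i : ℝ)) = 3 * (Pic.wt K).1 - 1 := by
      have : ∑ i, (Pic.wt K).2 i = 3 * (Pic.wt K).1 - 1 := by linarith
      exact_mod_cast this
    rw [h2]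
    simp
    field_simp
    ring
  · simp [h]

/-- The contribution of a `gl(d)` generator to the Casimir, split into that of a root and that of
the Cartan subalgebra. -/
lemma excGl_mul (hd : d ≤ 7) (p : Fin d × Fin d) (K J L I : ExcIdx d) :
    (- excK p.2 p.1 + (kd p.1 p.2 / 9) • ∑ a : Fin d, excK a a) K J * excK p.1 p.2 L I =
    (if p.1 ≠ p.2 ∧ (0, Pi.single p.2 1 - Pi.single p.1 1) = Pic.wt J - Pic.wt K then 1 else 0) *
      (if Pic.wt K + Pic.wt L = Pic.wt J + Pic.wt I then
        basisSign K * basisSign J * basisSign L * basisSign I *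
          Pic.sg (Pic.q (Pic.wt J - Pic.wt K) (Pic.wt J + Pic.wt I)) else 0)
    + if p.1 = p.2 then (if K = J then (if L = I then
        ((Pic.wt K).2 p.1 - (Pic.wt K).1 / 3) * (1 / (9 - (d : ℝ)) - (Pic.wt L).2 p.1) else 0)
        else 0) else 0 := by
  obtain ⟨c, k⟩ := p
  by_cases h : c = k
  · subst h
    rw [if_neg (fun h => h.1 rfl), zero_mul, zero_add, if_pos rfl, Matrix.add_apply,
      Matrix.neg_apply, Matrix.smul_apply, sum_excK_self hd, excK_self hd, diagonal_apply,
      diagonal_apply, diagonal_apply]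
    simp only [kd, if_true]
    split_ifs
    · rw [smul_eq_mul]; ring
    · ring
    · simp
    · simp
  · rw [kd, if_neg h, zero_div, zero_smul, add_zero, if_neg h, add_zero, excK_of_ne hd h,
      excK_of_ne hd (Ne.symm h), Matrix.neg_apply, Matrix.smul_apply, Matrix.smul_apply]
    have hr := rootVec_neg_mul_rootVec (0, Pi.single k 1 - Pi.single c 1) K J L I
    have hneg : -((0, Pi.single k 1 - Pi.single c 1) : Pic d)
        = (0, Pi.single c 1 - Pi.single k 1) := by simp
    rw [hneg] at hr
    simp only [ne_eq, h, not_false_eq_true, true_and]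
    rw [← hr, smul_eq_mul, smul_eq_mul]
    have hs : Pic.sg (Pic.q (0, Pi.single k 1) (0, Pi.single c 1))
        * Pic.sg (Pic.q (0, Pi.single c 1) (0, Pi.single k 1)) = -1 := by
      rw [← Pic.sg_add, Pic.q_add_q_swap, ← Pic.sg_zero]
      apply Pic.sg_eq_neg
      simp [Pi.single_apply, h]
    linear_combination (-(rootVec (0, Pi.single c 1 - Pi.single k 1) K J) *
      rootVec (0, Pi.single k 1 - Pi.single c 1) L I) * hs

/-- The quadratic Casimir of `E_d`, shifted by a multiple of the identity, in the weight basis.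
Its Cartan part is the intersection form: the shift by `β` makes up for the anticanonical
direction of the Picard lattice. -/
lemma exc_casimir (hd : d ≤ 7) (K J L I : ExcIdx d) :
    ∑ a, excGenDual a K J * excGen a L I + 1 / (9 - (d : ℝ)) * (kd I L * kd J K)
    = basisSign K * basisSign J * basisSign L * basisSign I *
      Pic.casimir (Pic.wt K) (Pic.wt J) (Pic.wt L) (Pic.wt I) := by
  classical
  have hne : (9 - (d : ℝ)) ≠ 0 := by
    have : (d : ℝ) ≤ 7 := by exact_mod_cast hd
    linarith
  have hsum := Pic.sum_roots hd (Pic.wt J - Pic.wt K)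
  simp only [Fintype.sum_sum_type, excGenDual, excGen, excR3Lo_eq hd, excR3Up_eq hd,
    excR6Lo_eq hd, excR6Up_eq hd, excGl_mul hd]
  have hn3 : ∀ c : Multi d 3, rootVec (1, Pic.ind c.1) K J * rootVec (-(1, Pic.ind c.1)) L I
      = rootVec (- -(1, Pic.ind c.1)) K J * rootVec (-(1, Pic.ind c.1)) L I := by simp
  have hn6 : ∀ c : Multi d 6, rootVec (2, Pic.ind c.1) K J * rootVec (-(2, Pic.ind c.1)) L I
      = rootVec (- -(2, Pic.ind c.1)) K J * rootVec (-(2, Pic.ind c.1)) L I := by simp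
  simp only [hn3, hn6]
  simp only [rootVec_neg_mul_rootVec, Finset.sum_add_distrib, ← Finset.sum_mul]
  have hdiag : (∑ p : Fin d × Fin d, if p.1 = p.2 then (if K = J then (if L = I then
        (((Pic.wt K).2 p.1 : ℝ) - (Pic.wt K).1 / 3) * (1 / (9 - (d : ℝ)) - (Pic.wt L).2 p.1) else 0)
        else 0) else 0) = if K = J then (if L = I then
          (Pic.ip (Pic.wt K) (Pic.wt L) : ℝ) - 1 / (9 - (d : ℝ)) else 0) else 0 := by
    rw [Fintype.sum_prod_type]
    simp only [Finset.sum_ite_eq, Finset.mem_univ, if_true]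
    split_ifs
    · have hs : ∀ K : ExcIdx d, (∑ i, ((Pic.wt K).2 i : ℝ)) = 3 * (Pic.wt K).1 - 1 := by
        intro K
        have h1 := (Pic.wt_isLine hd K).2
        rw [Pic.ip_kap] at h1
        have : ∑ i, (Pic.wt K).2 i = 3 * (Pic.wt K).1 - 1 := by linarith
        exact_mod_cast this
      have e : ∀ c : Fin d, (((Pic.wt K).2 c : ℝ) - (Pic.wt K).1 / 3) *
          (1 / (9 - (d : ℝ)) - (Pic.wt L).2 c) = 1 / (9 - (d : ℝ)) * (Pic.wt K).2 c
          - (Pic.wt K).2 c * (Pic.wt L).2 c - (Pic.wt K).1 / 3 * (1 / (9 - (d : ℝ)))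
          + (Pic.wt K).1 / 3 * (Pic.wt L).2 c := fun c => by ring
      simp only [e, Finset.sum_add_distrib, Finset.sum_sub_distrib, ← Finset.mul_sum, hs, Pic.ip]
      simp
      field_simp
      ring
    all_goals simp
  rw [hdiag]
  have hV : ∀ a b c e f V D w : ℝ, a * V + (b * V + (c * V + (e * V + (f * V + D)))) + w
      = (a + b + c + e + f) * V + D + w := fun _ _ _ _ _ _ _ _ => by ring
  rw [hV, hsum]
  have hroot : Pic.IsRoot (Pic.wt J - Pic.wt K) ↔ Pic.ip (Pic.wt J) (Pic.wt K) = 0 :=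
    (Pic.wt_isLine hd J).sub_isRoot (Pic.wt_isLine hd K)
  unfold Pic.casimir
  by_cases hKJ : K = J
  · subst hKJ
    rw [if_neg (by rw [hroot, (Pic.wt_isLine hd K).1]; norm_num), zero_mul, if_pos rfl, if_pos rfl,
      kd, kd, if_pos rfl]
    by_cases hLI : L = I
    · subst hLI
      simp only [if_true]
      linear_combination (- (Pic.ip (Pic.wt K) (Pic.wt L) : ℝ)) * (basisSign_mul_self K)
        - (Pic.ip (Pic.wt K) (Pic.wt L) : ℝ) * (basisSign K * basisSign K) * (basisSign_mul_self L)
    · rw [if_neg hLI, if_neg (Ne.symm hLI), if_neg (mt (@Pic.wt_injective d hd L I) hLI)]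
      ring
  · rw [if_neg hKJ, kd, kd, if_neg (Ne.symm hKJ), if_neg (mt (@Pic.wt_injective d hd K J) hKJ),
      hroot, Pic.ip_comm]
    by_cases h1 : Pic.wt K + Pic.wt L = Pic.wt J + Pic.wt I
    · by_cases h2 : Pic.ip (Pic.wt K) (Pic.wt J) = 0
      · rw [if_pos h1, if_pos h2, if_pos (And.intro h1 h2)]
        have := Pic.q_swap (Pic.wt J - Pic.wt K) (Pic.wt J - Pic.wt K)
        have hr := hroot.2 (by rw [Pic.ip_comm]; exact h2)
        rw [hr.1, hr.2] at this
        have hs : Pic.sg (Pic.q (Pic.wt J - Pic.wt K) (Pic.wt J + Pic.wt I))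
            = - Pic.sg (Pic.q (Pic.wt J - Pic.wt K) (Pic.wt K + Pic.wt I)) := by
          apply Pic.sg_eq_neg
          have e : Pic.wt J + Pic.wt I = (Pic.wt K + Pic.wt I) + (Pic.wt J - Pic.wt K) := by abel
          rw [e, Pic.q_add_right _ (Pic.wt K + Pic.wt I)]
          omega
        rw [hs]; ring
      · simp [h2]
    · simp [h1]

end

section

/-! ### Invariance of the Y-tensor and covariance of the generalized torsion -/

variable {κ : Type} [Fintype κ] [DecidableEq κ]

/-- A tensor `Y^{IJ}_{KL}` as an operator on `R₁ ⊗ R₁`, from the index pair `J, I` to `K, L`. -/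
def yMat (Y : κ → κ → κ → κ → ℝ) : Matrix (κ × κ) (κ × κ) ℝ :=
  Matrix.of fun p q => Y q.2 q.1 p.1 p.2

/-- The algebraic facts about a Lie algebra, a set of frames and a tensor `Y` on which the
covariance of the generalized torsion rests. -/
structure IsCovariantY (𝔤 : Submodule ℝ (Matrix κ κ ℝ)) (F : Set (Matrix κ κ ℝ))
    (Y : κ → κ → κ → κ → ℝ) : Prop where
  symm : ∀ K J L I, Y I J K L = Y J I L K
  invariant : ∀ A ∈ 𝔤, Commute (A ⊗ₖ 1 + 1 ⊗ₖ A) (yMat Y)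
  isUnit_det : ∀ g ∈ F, IsUnit g.det
  frame : ∀ g ∈ F, Commute (g ⊗ₖ g) (yMat Y)
  /-- The quadratic identity satisfied by second derivatives `s` that obey the section
  condition. -/
  quadratic : ∀ s : κ → κ → ℝ, (∀ L N, s L N = s N L) →
    (∀ P Q, ∑ L, ∑ N, Y L N P Q * s L N = 0) → ∀ J K P I,
    ∑ L, ∑ N, ∑ M, Y L J K M * Y M N P I * s L N = ∑ N, Y J N P I * s K N

/-- `IsCovariantY` for the Y-tensor of a duality group. -/
def DualityDatum.IsCovariant (D : DualityDatum) : Prop :=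
  IsCovariantY D.lieAlgebra D.frameGroup D.Y

/-- The operator that exchanges the two factors of `R₁ ⊗ R₁`. -/
def swapMat (κ : Type) [DecidableEq κ] : Matrix (κ × κ) (κ × κ) ℝ :=
  Matrix.of fun p q => kd q.2 p.1 * kd q.1 p.2

lemma commute_swapMat_add (A : Matrix κ κ ℝ) : Commute (A ⊗ₖ 1 + 1 ⊗ₖ A) (swapMat κ) := by
  ext ⟨K, L⟩ ⟨J, I⟩
  simp [swapMat, mul_apply, Fintype.sum_prod_type, kd]
  simp only [one_apply]
  ring

/-- `A ↦ A ⊗ 1`. -/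
def kronLeft (κ : Type) [Fintype κ] [DecidableEq κ] :
    Matrix κ κ ℝ →+* Matrix (κ × κ) (κ × κ) ℝ where
  toFun A := A ⊗ₖ 1
  map_one' := one_kronecker_one
  map_mul' A B := by rw [← mul_kronecker_mul, one_mul]
  map_zero' := zero_kronecker _
  map_add' A B := add_kronecker _ _ _

/-- `A ↦ 1 ⊗ A`. -/
def kronRight (κ : Type) [Fintype κ] [DecidableEq κ] :
    Matrix κ κ ℝ →+* Matrix (κ × κ) (κ × κ) ℝ where
  toFun A := 1 ⊗ₖ A
  map_one' := one_kronecker_one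
  map_mul' A B := by rw [← mul_kronecker_mul, one_mul]
  map_zero' := kronecker_zero _
  map_add' A B := kronecker_add _ _ _

lemma exp_kronecker_exp (A : Matrix κ κ ℝ) :
    NormedSpace.exp A ⊗ₖ NormedSpace.exp A = NormedSpace.exp (A ⊗ₖ 1 + 1 ⊗ₖ A) := by
  have hl : NormedSpace.exp (A ⊗ₖ (1 : Matrix κ κ ℝ)) = NormedSpace.exp A ⊗ₖ 1 := by
    have hc : Continuous (kronLeft κ) := by
      refine continuous_matrix fun i j => ?_
      show Continuous fun A : Matrix κ κ ℝ => A i.1 j.1 * (1 : Matrix κ κ ℝ) i.2 j.2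
      fun_prop
    open scoped Norms.Operator in
    exact (NormedSpace.map_exp (kronLeft κ) hc A).symm
  have hr : NormedSpace.exp ((1 : Matrix κ κ ℝ) ⊗ₖ A) = 1 ⊗ₖ NormedSpace.exp A := by
    have hc : Continuous (kronRight κ) := by
      refine continuous_matrix fun i j => ?_
      show Continuous fun A : Matrix κ κ ℝ => (1 : Matrix κ κ ℝ) i.1 j.1 * A i.2 j.2
      fun_prop
    open scoped Norms.Operator in
    exact (NormedSpace.map_exp (kronRight κ) hc A).symm
  rw [Matrix.exp_add_of_commute, hl, hr, ← mul_kronecker_mul, one_mul, mul_one]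
  rw [Commute, SemiconjBy, ← mul_kronecker_mul, ← mul_kronecker_mul, one_mul, mul_one]

lemma commute_exp {A : Matrix κ κ ℝ} {B : Matrix (κ × κ) (κ × κ) ℝ}
    (hA : Commute (A ⊗ₖ 1 + 1 ⊗ₖ A) B) :
    Commute (NormedSpace.exp A ⊗ₖ NormedSpace.exp A) B := by
  rw [exp_kronecker_exp]
  exact hA.exp_left

lemma sum_sum_comm {κ M : Type*} [Fintype κ] [AddCommMonoid M] (h : κ → κ → κ → κ → M) :
    ∑ a, ∑ b, ∑ c, ∑ d, h a b c d = ∑ c, ∑ d, ∑ a, ∑ b, h a b c d := by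
  calc ∑ a, ∑ b, ∑ c, ∑ d, h a b c d = ∑ a, ∑ c, ∑ d, ∑ b, h a b c d :=
        Finset.sum_congr rfl fun a _ => Finset.sum_comm.trans <|
          Finset.sum_congr rfl fun c _ => Finset.sum_comm
    _ = ∑ c, ∑ a, ∑ d, ∑ b, h a b c d := Finset.sum_comm
    _ = _ := Finset.sum_congr rfl fun c _ => Finset.sum_comm

/-- Components of a connection in another frame: `g` acts on the two lower indices and `g⁻¹` on the
upper index. -/
def conj (g : Matrix κ κ ℝ) (Gam : κ → κ → κ → ℝ)
    (A B C : κ) : ℝ :=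
  ∑ I, ∑ K, ∑ J, g A I * g B K * Gam I K J * g⁻¹ J C

lemma conj_eq_sum (g : Matrix κ κ ℝ) (Gam : κ → κ → κ → ℝ)
    (A B C : κ) : conj g Gam A B C = ∑ I, g A I * (g * Matrix.of (Gam I) * g⁻¹) B C := by
  simp only [conj, mul_apply, Finset.mul_sum, Finset.sum_mul, Matrix.of_apply]
  refine Finset.sum_congr rfl fun I _ => ?_
  rw [Finset.sum_comm]
  exact Finset.sum_congr rfl fun J _ => Finset.sum_congr rfl fun K _ => by ring

namespace DualityDatum
variable {D : DualityDatum}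

/-- Invariance of the Y-tensor, in a form that moves a frame through it. -/
lemma sum_Y_mul {g : Matrix D.Idx D.Idx ℝ} (hg : IsUnit g.det)
    (hY : Commute (g ⊗ₖ g) (yMat D.Y)) (B C I J : D.Idx) :
    ∑ F, ∑ G, D.Y F C B G * g F I * g⁻¹ J G = ∑ K, ∑ P, g B K * D.Y I P K J * g⁻¹ P C := by
  have hgi : (1 ⊗ₖ g⁻¹) * (g ⊗ₖ g) = g ⊗ₖ (1 : Matrix D.Idx D.Idx ℝ) := by
    rw [← mul_kronecker_mul, one_mul, nonsing_inv_mul _ hg]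
  have hig : (g ⊗ₖ g) * (g⁻¹ ⊗ₖ (1 : Matrix D.Idx D.Idx ℝ)) = 1 ⊗ₖ g := by
    rw [← mul_kronecker_mul, mul_one, mul_nonsing_inv _ hg]
  have h : (1 ⊗ₖ g⁻¹) * (yMat D.Y) * (1 ⊗ₖ g)
      = (g ⊗ₖ 1) * (yMat D.Y) * (g⁻¹ ⊗ₖ (1 : Matrix D.Idx D.Idx ℝ)) := by
    rw [← hig, ← mul_assoc, mul_assoc _ (yMat D.Y), ← hY.eq, ← mul_assoc, hgi]
  have := congrFun (congrFun h (B, J)) (C, I)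
  simp only [mul_apply, Fintype.sum_prod_type, kroneckerMap_apply, one_apply, yMat, of_apply,
    ite_mul, mul_ite, zero_mul, mul_zero, one_mul, mul_one, Finset.sum_ite_eq, Finset.sum_ite_eq',
    Finset.mem_univ, if_true, Finset.sum_mul] at this
  rw [Finset.sum_comm (f := fun K P => g B K * D.Y I P K J * g⁻¹ P C), ← this,
    Finset.sum_comm (f := fun K P => ite (K = C) _ _)]
  refine Finset.sum_congr rfl fun F _ => ?_
  rw [Finset.sum_ite_eq' Finset.univ C, if_pos (Finset.mem_univ _), Finset.sum_comm]
  refine Finset.sum_congr rfl fun G _ => ?_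
  rw [Finset.sum_ite_eq, if_pos (Finset.mem_univ _)]
  ring

/-- A change of frame that leaves the Y-tensor invariant commutes with taking the generalized
torsion. -/
lemma genTorsion_conj {g : Matrix D.Idx D.Idx ℝ} (hg : IsUnit g.det)
    (hY : Commute (g ⊗ₖ g) (yMat D.Y)) (Gam : D.Idx → D.Idx → D.Idx → ℝ) :
    genTorsion D (conj g Gam) = conj g (genTorsion D Gam) := by
  funext A B C
  have h1 : conj g (genTorsion D Gam) A B C = conj g Gam A B C - conj g Gam B A C
      + ∑ I, ∑ K, ∑ J, g A I * g B K * (∑ F, ∑ G, D.Y F J K G * Gam F I G) * g⁻¹ J C := by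
    have h2 : conj g Gam B A C = ∑ I, ∑ K, ∑ J, g A I * g B K * Gam K I J * g⁻¹ J C := by
      rw [conj, Finset.sum_comm]
      exact Finset.sum_congr rfl fun I _ => Finset.sum_congr rfl fun K _ =>
        Finset.sum_congr rfl fun J _ => by ring
    rw [h2]
    simp only [conj, genTorsion, ← Finset.sum_sub_distrib, ← Finset.sum_add_distrib]
    exact Finset.sum_congr rfl fun I _ => Finset.sum_congr rfl fun K _ =>
        Finset.sum_congr rfl fun J _ => by ring
  rw [h1, genTorsion]
  congr 1
  calc ∑ F, ∑ G, D.Y F C B G * conj g Gam F A G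
      = ∑ F, ∑ G, ∑ x : D.Idx × D.Idx × D.Idx,
          g A x.2.1 * Gam x.1 x.2.1 x.2.2 * (D.Y F C B G * g F x.1 * g⁻¹ x.2.2 G) := by
        simp only [conj, Fintype.sum_prod_type, Finset.mul_sum]
        refine Finset.sum_congr rfl fun F _ => Finset.sum_congr rfl fun G _ =>
          Finset.sum_congr rfl fun I _ => Finset.sum_congr rfl fun K _ =>
          Finset.sum_congr rfl fun J _ => by ring
    _ = ∑ x : D.Idx × D.Idx × D.Idx, ∑ F, ∑ G,
          g A x.2.1 * Gam x.1 x.2.1 x.2.2 * (D.Y F C B G * g F x.1 * g⁻¹ x.2.2 G) := by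
        rw [Finset.sum_comm' (t' := Finset.univ) (s' := fun _ => Finset.univ) (by simp)]
        exact (Finset.sum_congr rfl fun G _ => Finset.sum_comm).trans <| Finset.sum_comm.trans <|
          Finset.sum_congr rfl fun x _ => Finset.sum_comm
    _ = ∑ x : D.Idx × D.Idx × D.Idx, ∑ K, ∑ P,
          g A x.2.1 * Gam x.1 x.2.1 x.2.2 * (g B K * D.Y x.1 P K x.2.2 * g⁻¹ P C) := by
        simp only [← Finset.mul_sum, sum_Y_mul hg hY]
    _ = _ := by
        simp only [Fintype.sum_prod_type, Finset.mul_sum, Finset.sum_mul]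
        rw [Finset.sum_comm]
        refine Finset.sum_congr rfl fun I _ => ?_
        rw [sum_sum_comm]
        exact Finset.sum_congr rfl fun K _ => Finset.sum_congr rfl fun J _ =>
          Finset.sum_congr rfl fun F _ => Finset.sum_congr rfl fun G _ => by ring

end DualityDatum

end

section

/-! ### The orthogonal groups -/

variable {d m : ℕ}

lemma orthEta_transpose (d m : ℕ) : (orthEta d m)ᵀ = orthEta d m := by
  ext (i | i | i) (j | j | j) <;> simp [orthEta, kd, eq_comm]

lemma orthEta_symm (K L : OrthIdx d m) : orthEta d m K L = orthEta d m L K :=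
  congrFun (congrFun (orthEta_transpose d m) L) K

lemma orthEta_mul_self (d m : ℕ) : orthEta d m * orthEta d m = 1 := by
  ext (i | i | i) (j | j | j) <;>
    simp [orthEta, kd, mul_apply, Fintype.sum_sum_type, one_apply]

lemma orthEta_mul_apply (K L : OrthIdx d m) :
    ∑ N, orthEta d m K N * orthEta d m N L = kd K L := by
  rw [← mul_apply, orthEta_mul_self]
  rfl

/-- The quadratic Casimir of `O(d, d + m)`: two of the four products of generators combine into the
metric term, the other two into the exchange term. -/
lemma orth_casimir (K J L I : OrthIdx d m) :
    ∑ a, (orthDatum d m).tDual a K J * (orthDatum d m).t a L I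
      = orthEta d m K L * orthEta d m J I - kd K I * kd J L := by
  show ∑ a : OrthIdx d m × OrthIdx d m, (1 / 2) * (kd a.1 K * orthEta d m a.2 J
      - kd a.2 K * orthEta d m a.1 J)
    * (orthEta d m a.1 L * kd a.2 I - orthEta d m a.2 L * kd a.1 I) = _
  have h : ∀ J L : OrthIdx d m, ∑ N, orthEta d m N J * orthEta d m N L = kd J L := fun J L => by
    rw [← orthEta_mul_apply]
    exact Finset.sum_congr rfl fun N _ => by rw [orthEta_symm N J]
  have hp : ∀ a : OrthIdx d m × OrthIdx d m, (1 / 2) * (kd a.1 K * orthEta d m a.2 J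
      - kd a.2 K * orthEta d m a.1 J)
      * (orthEta d m a.1 L * kd a.2 I - orthEta d m a.2 L * kd a.1 I)
      = (1 / 2) * ((kd a.1 K * orthEta d m a.1 L) * (kd a.2 I * orthEta d m a.2 J)
        - (kd a.1 K * kd a.1 I) * (orthEta d m a.2 J * orthEta d m a.2 L)
        - (orthEta d m a.1 J * orthEta d m a.1 L) * (kd a.2 K * kd a.2 I)
        + (kd a.1 I * orthEta d m a.1 J) * (kd a.2 K * orthEta d m a.2 L)) := fun a => by ring
  simp only [hp, ← Finset.mul_sum, Finset.sum_add_distrib, Finset.sum_sub_distrib,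
    Fintype.sum_prod_type, ← Finset.sum_mul, h]
  simp only [kd, ite_mul, one_mul, zero_mul, Finset.sum_ite_eq', Finset.mem_univ, if_true]
  rw [orthEta_symm I J]
  by_cases hK : K = I <;> by_cases hJ : J = L <;> simp [hK, hJ] <;> ring

/-- The exchange term of the Casimir cancels the first term of the Y-tensor. -/
lemma orth_Y (I J K L : OrthIdx d m) :
    (orthDatum d m).Y I J K L = orthEta d m I J * orthEta d m K L := by
  show kd I K * kd J L + ∑ a, (orthDatum d m).tDual a K J * (orthDatum d m).t a L I + 0 * _ = _
  rw [orth_casimir]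
  rw [orthEta_symm J I, show kd I K = kd K I by simp [kd, eq_comm]]
  ring

/-- The Lie algebra of `O(d, d + m)`. -/
def orthLie (d m : ℕ) : Submodule ℝ (Matrix (OrthIdx d m) (OrthIdx d m) ℝ) :=
  (orthDatum d m).lieAlgebra

/-- The metric as an element of `R₁ ⊗ R₁`. -/
def orthVec (d m : ℕ) (p : OrthIdx d m × OrthIdx d m) : ℝ := orthEta d m p.1 p.2

lemma yMat_orth : yMat (fun I J K L => orthEta d m I J * orthEta d m K L)
    = vecMulVec (orthVec d m) (orthVec d m) := by
  ext ⟨K, L⟩ ⟨J, I⟩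
  simp only [yMat, of_apply, vecMulVec_apply, orthVec]
  rw [orthEta_symm I J, mul_comm]

lemma kronecker_mulVec_orthVec (A B : Matrix (OrthIdx d m) (OrthIdx d m) ℝ)
    (p : OrthIdx d m × OrthIdx d m) :
    ((A ⊗ₖ B) *ᵥ orthVec d m) p = (A * orthEta d m * Bᵀ) p.1 p.2 := by
  simp only [mulVec, dotProduct, mul_apply, kroneckerMap_apply, Fintype.sum_prod_type, orthVec,
    transpose_apply, Finset.sum_mul]
  rw [Finset.sum_comm]
  exact Finset.sum_congr rfl fun _ _ => Finset.sum_congr rfl fun _ _ => by ring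

lemma orthVec_vecMul_kronecker (A B : Matrix (OrthIdx d m) (OrthIdx d m) ℝ)
    (p : OrthIdx d m × OrthIdx d m) :
    (orthVec d m ᵥ* (A ⊗ₖ B)) p = (Aᵀ * orthEta d m * B) p.1 p.2 := by
  rw [← mulVec_transpose, ← kroneckerMap_transpose, kronecker_mulVec_orthVec, transpose_transpose]

lemma orth_lieAlgebra {A : Matrix (OrthIdx d m) (OrthIdx d m) ℝ}
    (hA : A ∈ orthLie d m) : A * orthEta d m + orthEta d m * Aᵀ = 0 := by
  refine Submodule.span_induction
    (p := fun (A : Matrix (OrthIdx d m) (OrthIdx d m) ℝ) _ =>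
      A * orthEta d m + orthEta d m * Aᵀ = 0)
    ?_ ?_ ?_ ?_ (show A ∈ Submodule.span ℝ (Set.range fun a => show Matrix (OrthIdx d m)
      (OrthIdx d m) ℝ from (orthDatum d m).t a) from hA)
  · rintro _ ⟨a, rfl⟩
    have h : ∀ x : OrthIdx d m × OrthIdx d m,
        ((show Matrix (OrthIdx d m) (OrthIdx d m) ℝ from (orthDatum d m).t a) * orthEta d m) x.1 x.2
        = orthEta d m a.1 x.1 * orthEta d m a.2 x.2
          - orthEta d m a.2 x.1 * orthEta d m a.1 x.2 := fun x => by
      show ∑ I, (orthEta d m a.1 x.1 * kd a.2 I - orthEta d m a.2 x.1 * kd a.1 I)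
        * orthEta d m I x.2 = _
      simp [sub_mul, Finset.sum_sub_distrib, kd]
    have h' : ∀ A : Matrix (OrthIdx d m) (OrthIdx d m) ℝ,
        orthEta d m * Aᵀ = (A * orthEta d m)ᵀ := fun A => by
      rw [transpose_mul, orthEta_transpose]
    ext K L
    rw [h', Matrix.add_apply, transpose_apply, h (K, L), h (L, K)]
    simp only [Matrix.zero_apply]
    ring
  · simp
  · intro A B _ _ hA hB
    rw [transpose_add, add_mul, mul_add, add_add_add_comm, hA, hB, add_zero]
  · intro c A _ hA
    rw [transpose_smul, smul_mul_assoc, mul_smul_comm, ← smul_add, hA, smul_zero]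

lemma transpose_mul_orthEta_mul {g : Matrix (OrthIdx d m) (OrthIdx d m) ℝ}
    (hg : g * orthEta d m * gᵀ = orthEta d m) : gᵀ * orthEta d m * g = orthEta d m := by
  have h1 : (g * orthEta d m) * (gᵀ * orthEta d m) = 1 := by
    rw [← mul_assoc, hg, orthEta_mul_self]
  calc gᵀ * orthEta d m * g
      = (gᵀ * orthEta d m) * (g * orthEta d m) * orthEta d m := by
        rw [mul_assoc _ _ (orthEta d m), mul_assoc g, orthEta_mul_self, mul_one]
    _ = orthEta d m := by rw [mul_eq_one_comm.mp h1, one_mul]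

/-- The Y-tensor of `O(d, d + m)` is the projector on the metric, which both the Lie algebra and the
group preserve. -/
lemma orth_isCovariantY (d m : ℕ) : IsCovariantY (orthLie d m)
    {g | g * orthEta d m * gᵀ = orthEta d m}
    (fun I J K L => orthEta d m I J * orthEta d m K L) where
  symm K J L I := by rw [orthEta_symm I J, orthEta_symm K L]
  invariant A hA := by
    have hη := orth_lieAlgebra hA
    have hη' : Aᵀ * orthEta d m + orthEta d m * A = 0 := by
      have := congrArg (fun M => orthEta d m * M * orthEta d m) hη
      simp only [mul_add, add_mul, mul_zero, zero_mul] at this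
      rw [add_comm, ← this]
      congr 1
      · rw [mul_assoc, mul_assoc, orthEta_mul_self, mul_one]
      · rw [← mul_assoc, orthEta_mul_self, one_mul]
    rw [yMat_orth, Commute, SemiconjBy, mul_vecMulVec, vecMulVec_mul]
    have h1 : (A ⊗ₖ 1 + 1 ⊗ₖ A) *ᵥ orthVec d m = 0 := by
      funext p
      rw [add_mulVec, Pi.add_apply, kronecker_mulVec_orthVec, kronecker_mulVec_orthVec,
        transpose_one, mul_one, one_mul, ← Matrix.add_apply, hη]
      rfl
    have h2 : orthVec d m ᵥ* (A ⊗ₖ 1 + 1 ⊗ₖ A) = 0 := by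
      funext p
      rw [vecMul_add, Pi.add_apply, orthVec_vecMul_kronecker, orthVec_vecMul_kronecker,
        transpose_one, mul_one, one_mul, ← Matrix.add_apply, hη']
      rfl
    rw [h1, h2]
    simp
  isUnit_det g hg := by
    have hg' : g * orthEta d m * gᵀ = orthEta d m := hg
    have h1 : g * (orthEta d m * gᵀ * orthEta d m) = 1 := by
      rw [← mul_assoc, ← mul_assoc, hg', orthEta_mul_self]
    exact isUnit_det_of_right_inverse h1
  frame g hg := by
    have hg' : g * orthEta d m * gᵀ = orthEta d m := hg
    rw [yMat_orth, Commute, SemiconjBy, mul_vecMulVec, vecMulVec_mul]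
    have h1 : (g ⊗ₖ g) *ᵥ orthVec d m = orthVec d m := by
      funext p
      rw [kronecker_mulVec_orthVec, hg', orthVec]
    have h2 : orthVec d m ᵥ* (g ⊗ₖ g) = orthVec d m := by
      funext p
      rw [orthVec_vecMul_kronecker, transpose_mul_orthEta_mul hg', orthVec]
    rw [h1, h2]
  quadratic s hs _ J K P I := by
    have h : ∀ L N : OrthIdx d m, ∑ M, orthEta d m L J * orthEta d m K M *
        (orthEta d m M N * orthEta d m P I) * s L N
        = orthEta d m L J * orthEta d m P I * s L N * kd K N := fun L N => by
      rw [← orthEta_mul_apply, Finset.mul_sum]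
      exact Finset.sum_congr rfl fun M _ => by ring
    simp only [h, kd, mul_ite, mul_one, mul_zero, Finset.sum_ite_eq, Finset.mem_univ, if_true]
    exact Finset.sum_congr rfl fun L _ => by
      rw [orthEta_symm L J]
      exact congrArg _ (hs L K)

lemma orth_isCovariant (d m : ℕ) : (orthDatum d m).IsCovariant := by
  have h : (orthDatum d m).Y = fun I J K L => orthEta d m I J * orthEta d m K L := by
    funext I J K L
    exact orth_Y I J K L
  rw [DualityDatum.IsCovariant, h]
  exact orth_isCovariantY d m

end

section

/-! ### The quadratic identity from a symplectic form -/

section Quadratic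

variable {κ : Type} [Fintype κ] [DecidableEq κ]

/-- The quadratic identity for a tensor `Y^{IJ}_{KL} = δ^I_K δ^J_L + B_{KJLI}` whose antisymmetric
part is controlled by an antisymmetric form `σ`. The second derivatives `s` enter through
`u_{MN} = B_{KJM}{}^L s_{LN}`: the symmetric part of `u` is the action of an element of the Lie
algebra on `s`, and is annihilated with `s` because `Y` is invariant; the antisymmetric part
enters only through `σ^{MN} u_{MN}`, which vanishes by the crossing relation. -/
lemma quadratic_of_crossing {Y B : κ → κ → κ → κ → ℝ} {σ : κ → κ → ℝ}
    (hYB : ∀ I J K L, Y I J K L = kd I K * kd J L + B K J L I)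
    (hinv : ∀ K J, Commute (Matrix.of (B K J) ⊗ₖ 1 + 1 ⊗ₖ Matrix.of (B K J)) (yMat Y))
    (hanti : ∀ I J K L, Y I J K L - Y J I K L = - (σ I J * σ K L))
    (hcross : ∀ K J L N, ∑ M, σ M N * B K J M L + ∑ M, σ M L * B K J M N
      = ∑ M, σ M J * (Y L N K M + Y N L K M))
    (s : κ → κ → ℝ) (hs : ∀ L N, s L N = s N L)
    (hY : ∀ P Q, ∑ L, ∑ N, Y L N P Q * s L N = 0) (J K P I : κ) :
    ∑ L, ∑ N, ∑ M, Y L J K M * Y M N P I * s L N = ∑ N, Y J N P I * s K N := by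
  set u : κ → κ → ℝ := fun M N => ∑ L, B K J M L * s L N with hu
  have hY' : ∀ P Q, ∑ L, ∑ N, Y N L P Q * s L N = 0 := fun P Q => by
    rw [← hY P Q, Finset.sum_comm]
    exact Finset.sum_congr rfl fun _ _ => Finset.sum_congr rfl fun _ _ => by rw [hs]
  -- The first term of the first factor gives the right hand side; `Y u` remains.
  have h1 : ∑ L, ∑ N, ∑ M, Y L J K M * Y M N P I * s L N
      = ∑ N, Y J N P I * s K N + ∑ M, ∑ N, Y M N P I * u M N := by
    have e : ∀ L N M, Y L J K M * Y M N P I * s L N = kd L K * (kd J M * (Y M N P I * s L N))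
        + Y M N P I * (B K J M L * s L N) := fun L N M => by rw [hYB L J K M]; ring
    simp only [e, Finset.sum_add_distrib]
    congr 1
    · simp [kd]
    · rw [Finset.sum_comm, Finset.sum_comm (f := fun M N => Y M N P I * u M N)]
      refine Finset.sum_congr rfl fun N _ => ?_
      rw [Finset.sum_comm]
      simp only [hu, Finset.mul_sum]
  -- The crossing relation, contracted with the symmetric `s`.
  have h2 : ∑ M, ∑ N, σ M N * u M N = 0 := by
    have e1 : ∑ M, ∑ N, σ M N * u M N = ∑ L, ∑ N, (∑ M, σ M N * B K J M L) * s L N := by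
      simp only [hu, Finset.mul_sum, Finset.sum_mul]
      rw [Finset.sum_comm, Finset.sum_comm (f := fun L N => ∑ M, σ M N * B K J M L * s L N)]
      refine Finset.sum_congr rfl fun N _ => ?_
      rw [Finset.sum_comm]
      exact Finset.sum_congr rfl fun _ _ => Finset.sum_congr rfl fun _ _ => by ring
    have e2 : ∑ M, ∑ N, σ M N * u M N = ∑ L, ∑ N, (∑ M, σ M L * B K J M N) * s L N := by
      rw [e1, Finset.sum_comm]
      exact Finset.sum_congr rfl fun _ _ => Finset.sum_congr rfl fun _ _ => by rw [hs]
    have e3 : ∑ L, ∑ N, (∑ M, σ M N * B K J M L + ∑ M, σ M L * B K J M N) * s L N = 0 := by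
      calc _ = ∑ L, ∑ N, ∑ M, σ M J * (Y L N K M * s L N + Y N L K M * s L N) := by
            simp only [hcross, Finset.sum_mul]
            exact Finset.sum_congr rfl fun _ _ => Finset.sum_congr rfl fun _ _ =>
              Finset.sum_congr rfl fun _ _ => by ring
        _ = ∑ M, σ M J * (∑ L, ∑ N, Y L N K M * s L N + ∑ L, ∑ N, Y N L K M * s L N) := by
            rw [Finset.sum_congr rfl fun L _ => Finset.sum_comm, Finset.sum_comm]
            simp only [← Finset.sum_add_distrib, Finset.mul_sum]
        _ = 0 := by simp [hY, hY']
    simp only [add_mul, Finset.sum_add_distrib] at e3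
    linarith
  -- Hence `Y` sees only the symmetric part of `u`.
  have h3 : ∑ M, ∑ N, Y M N P I * u M N = ∑ M, ∑ N, Y N M P I * u M N := by
    rw [← sub_eq_zero]
    simp only [← Finset.sum_sub_distrib]
    have e : ∀ M N, Y M N P I * u M N - Y N M P I * u M N = - σ P I * (σ M N * u M N) :=
      fun M N => by linear_combination u M N * hanti M N P I
    simp only [e, ← Finset.mul_sum, h2, mul_zero]
  -- Invariance of `Y`, applied to `s`.
  have h4 : ∑ M, ∑ N, Y M N P I * u M N + ∑ M, ∑ N, Y N M P I * u M N = 0 := by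
    set x : κ × κ → ℝ := fun p => s p.2 p.1 with hx
    have hyx : yMat Y *ᵥ x = 0 := by
      funext p
      simp only [mulVec, dotProduct, Fintype.sum_prod_type, yMat, of_apply, hx]
      rw [Finset.sum_comm]
      exact hY p.1 p.2
    have e := congrFun (congrArg (fun M => M *ᵥ x) (hinv K J).eq) (P, I)
    simp only [← mulVec_mulVec, hyx, mulVec_zero] at e
    rw [← e.symm.trans (Pi.zero_apply _)]
    have hact : ∀ N M, ((Matrix.of (B K J) ⊗ₖ 1 + 1 ⊗ₖ Matrix.of (B K J)) *ᵥ x) (N, M)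
        = u N M + u M N := fun N M => by
      simp only [mulVec, dotProduct, Fintype.sum_prod_type, hx, Matrix.add_apply,
        kroneckerMap_apply, of_apply, one_apply, add_mul, Finset.sum_add_distrib, hu,
        mul_ite, ite_mul, mul_one, one_mul, mul_zero, zero_mul]
      simp [hs]
    have : ∀ p, (yMat Y *ᵥ ((Matrix.of (B K J) ⊗ₖ 1 + 1 ⊗ₖ Matrix.of (B K J)) *ᵥ x)) p
        = ∑ N, ∑ M, Y M N p.1 p.2 * (u N M + u M N) := fun p => by
      rw [mulVec, dotProduct, Fintype.sum_prod_type]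
      simp only [hact, yMat, of_apply]
    rw [this]
    simp only [mul_add, Finset.sum_add_distrib]
    rw [add_comm, Finset.sum_comm (f := fun M N => Y M N P I * u M N)]
  rw [h1]
  linarith

end Quadratic

end

section

/-! ### The Y-tensor of the exceptional groups -/

variable {d : ℕ}

/-- The invariant `(t^a)_K^J (t_a)_L^I + β δ_K^J δ_L^I`. -/
def excB (K J L I : ExcIdx d) : ℝ :=
  basisSign K * basisSign J * basisSign L * basisSign I *
    Pic.casimir (Pic.wt K) (Pic.wt J) (Pic.wt L) (Pic.wt I)

/-- The Y-tensor in terms of `excB`. -/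
def excY (I J K L : ExcIdx d) : ℝ := kd I K * kd J L + excB K J L I

/-- `excB` as an operator on `R₁ ⊗ R₁`. -/
def excBMat (d : ℕ) : Matrix (ExcIdx d × ExcIdx d) (ExcIdx d × ExcIdx d) ℝ :=
  Matrix.of fun p q => excB p.1 q.1 p.2 q.2

lemma yMat_excY : yMat (excY (d := d)) = swapMat (ExcIdx d) + excBMat d := by
  ext p q
  simp [yMat, excY, swapMat, excBMat]

/-- A root vector acts by shifting weights, on a function given in the weight basis. -/
lemma sum_rootVec_mul (hd : d ≤ 7) {g : Pic d} (hg : Pic.IsRoot g) (F : Pic d → ℝ)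
    (K : ExcIdx d) :
    ∑ X, rootVec g K X * (basisSign X * F (Pic.wt X)) = basisSign K *
      (if Pic.ip (Pic.wt K) g = -1 then
        Pic.sg (Pic.q g (Pic.wt K - g)) * F (Pic.wt K - g) else 0) := by
  by_cases h : Pic.ip (Pic.wt K) g = -1
  · obtain ⟨X, hX⟩ := Pic.IsLine.exists_wt hd (((Pic.wt_isLine hd K).sub_root hg).2 h)
    rw [if_pos h, Finset.sum_eq_single X, rootVec_apply, if_pos (by rw [hX]; abel), hX]
    · linear_combination basisSign K * Pic.sg (Pic.q g (Pic.wt K - g)) * F (Pic.wt K - g)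
        * basisSign_mul_self X
    · intro Z _ hZ
      rw [rootVec_apply, if_neg, zero_mul]
      rintro hK
      refine hZ (Pic.wt_injective hd ?_)
      rw [hX, hK]; abel
    · simp
  · rw [if_neg h, mul_zero]
    refine Finset.sum_eq_zero fun X _ => ?_
    rw [rootVec_apply, if_neg, zero_mul]
    intro hK
    refine h (((Pic.wt_isLine hd K).sub_root hg).1 ?_)
    rw [hK, add_sub_cancel_right]
    exact Pic.wt_isLine hd X

lemma sum_mul_rootVec (hd : d ≤ 7) {g : Pic d} (hg : Pic.IsRoot g) (F : Pic d → ℝ)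
    (J : ExcIdx d) :
    ∑ X, (basisSign X * F (Pic.wt X)) * rootVec g X J = basisSign J *
      (if Pic.ip (Pic.wt J) g = 1 then
        Pic.sg (Pic.q g (Pic.wt J)) * F (Pic.wt J + g) else 0) := by
  by_cases h : Pic.ip (Pic.wt J) g = 1
  · obtain ⟨X, hX⟩ := Pic.IsLine.exists_wt hd (((Pic.wt_isLine hd J).add_root hg).2 h)
    rw [if_pos h, Finset.sum_eq_single X, rootVec_apply, if_pos hX, hX]
    · linear_combination basisSign J * Pic.sg (Pic.q g (Pic.wt J)) * F (Pic.wt J + g)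
        * basisSign_mul_self X
    · intro Z _ hZ
      rw [rootVec_apply, if_neg, mul_zero]
      rintro hK
      exact hZ (Pic.wt_injective hd (hK.trans hX.symm))
    · simp
  · rw [if_neg h, mul_zero]
    refine Finset.sum_eq_zero fun X _ => ?_
    rw [rootVec_apply, if_neg, mul_zero]
    intro hK
    refine h (((Pic.wt_isLine hd J).add_root hg).1 ?_)
    rw [← hK]
    exact Pic.wt_isLine hd X

lemma kronecker_add_mul_apply {κ : Type} [Fintype κ] [DecidableEq κ] (A : Matrix κ κ ℝ)
    (C : Matrix (κ × κ) (κ × κ) ℝ) (K L J I : κ) :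
    ((A ⊗ₖ (1 : Matrix κ κ ℝ) + (1 : Matrix κ κ ℝ) ⊗ₖ A) * C) (K, L) (J, I)
      = ∑ X, A K X * C (X, L) (J, I) + ∑ X, A L X * C (K, X) (J, I) := by
  simp [mul_apply, Fintype.sum_prod_type, add_mul, Finset.sum_add_distrib, one_apply]

lemma mul_kronecker_add_apply {κ : Type} [Fintype κ] [DecidableEq κ] (A : Matrix κ κ ℝ)
    (C : Matrix (κ × κ) (κ × κ) ℝ) (K L J I : κ) :
    (C * (A ⊗ₖ (1 : Matrix κ κ ℝ) + (1 : Matrix κ κ ℝ) ⊗ₖ A)) (K, L) (J, I)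
      = ∑ X, C (K, L) (X, I) * A X J + ∑ X, C (K, L) (J, X) * A X I := by
  simp [mul_apply, Fintype.sum_prod_type, mul_add, Finset.sum_add_distrib, one_apply]

lemma commute_rootVec (hd : d ≤ 7) {g : Pic d} (hg : Pic.IsRoot g) :
    Commute (rootVec g ⊗ₖ 1 + 1 ⊗ₖ rootVec g) (excBMat d) := by
  ext ⟨K, L⟩ ⟨J, I⟩
  rw [kronecker_add_mul_apply, mul_kronecker_add_apply]
  simp only [excBMat, of_apply, excB]
  have h1 := sum_rootVec_mul hd hg (fun x => basisSign J * basisSign L * basisSign I *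
    Pic.casimir x (Pic.wt J) (Pic.wt L) (Pic.wt I)) K
  have h2 := sum_rootVec_mul hd hg (fun x => basisSign K * basisSign J * basisSign I *
    Pic.casimir (Pic.wt K) (Pic.wt J) x (Pic.wt I)) L
  have h3 := sum_mul_rootVec hd hg (fun x => basisSign K * basisSign L * basisSign I *
    Pic.casimir (Pic.wt K) x (Pic.wt L) (Pic.wt I)) J
  have h4 := sum_mul_rootVec hd hg (fun x => basisSign K * basisSign J * basisSign L *
    Pic.casimir (Pic.wt K) (Pic.wt J) (Pic.wt L) x) I
  have h := Pic.rootAction_eq_zero hd (Pic.wt_isLine hd K) (Pic.wt_isLine hd J)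
    (Pic.wt_isLine hd L) (Pic.wt_isLine hd I) hg
  rw [Pic.rootAction] at h
  have hpull : ∀ (p : Prop) [Decidable p] (a b c : ℝ),
      (if p then a * (b * c) else 0) = b * (if p then a * c else 0) := fun p _ a b c => by
    split_ifs <;> ring
  calc _ = (∑ X, rootVec g K X * (basisSign X * (basisSign J * basisSign L * basisSign I *
        Pic.casimir (Pic.wt X) (Pic.wt J) (Pic.wt L) (Pic.wt I))))
      + ∑ X, rootVec g L X * (basisSign X * (basisSign K * basisSign J * basisSign I *
        Pic.casimir (Pic.wt K) (Pic.wt J) (Pic.wt X) (Pic.wt I))) := by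
        congr 1 <;> exact Finset.sum_congr rfl fun X _ => by ring
    _ = (∑ X, (basisSign X * (basisSign K * basisSign L * basisSign I *
        Pic.casimir (Pic.wt K) (Pic.wt X) (Pic.wt L) (Pic.wt I))) * rootVec g X J)
      + ∑ X, (basisSign X * (basisSign K * basisSign J * basisSign L *
        Pic.casimir (Pic.wt K) (Pic.wt J) (Pic.wt L) (Pic.wt X))) * rootVec g X I := by
        rw [h1, h2, h3, h4]
        simp only [hpull]
        linear_combination basisSign K * basisSign J * basisSign L * basisSign I * h
    _ = _ := by
        congr 1 <;> exact Finset.sum_congr rfl fun X _ => by ring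

/-- An additive function of the weights acts as a Cartan element, and `excB` has weight zero. -/
lemma commute_diagonal {a : ExcIdx d → ℝ} (ha : ∀ K J L I : ExcIdx d,
      Pic.wt K + Pic.wt L = Pic.wt J + Pic.wt I → a K + a L = a J + a I) :
    Commute (diagonal a ⊗ₖ 1 + 1 ⊗ₖ diagonal a) (excBMat d) := by
  ext ⟨K, L⟩ ⟨J, I⟩
  rw [kronecker_add_mul_apply, mul_kronecker_add_apply]
  simp only [diagonal_apply, ite_mul, mul_ite, zero_mul, mul_zero, Finset.sum_ite_eq,
    Finset.sum_ite_eq', Finset.mem_univ, if_true, excBMat, of_apply]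
  by_cases h : Pic.wt K + Pic.wt L = Pic.wt J + Pic.wt I
  · linear_combination excB K J L I * ha K J L I h
  · rw [excB, Pic.casimir_eq_zero h]
    ring

lemma kronecker_add_add {κ : Type} [DecidableEq κ] (A B : Matrix κ κ ℝ) :
    (A + B) ⊗ₖ (1 : Matrix κ κ ℝ) + (1 : Matrix κ κ ℝ) ⊗ₖ (A + B)
      = (A ⊗ₖ 1 + 1 ⊗ₖ A) + (B ⊗ₖ 1 + 1 ⊗ₖ B) := by
  rw [add_kronecker, kronecker_add]
  abel

lemma kronecker_smul_add {κ : Type} [DecidableEq κ] (c : ℝ) (A : Matrix κ κ ℝ) :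
    (c • A) ⊗ₖ (1 : Matrix κ κ ℝ) + (1 : Matrix κ κ ℝ) ⊗ₖ (c • A) = c • (A ⊗ₖ 1 + 1 ⊗ₖ A) := by
  rw [smul_kronecker, kronecker_smul, smul_add]

lemma excGen_commute (hd : d ≤ 7) (a : ExcAdj d) :
    Commute (excGen a ⊗ₖ 1 + 1 ⊗ₖ excGen a) (excBMat d) := by
  have hneg : ∀ {g : Pic d}, Pic.IsRoot g → Pic.IsRoot (-g) := fun {g} hg => by
    refine ⟨?_, ?_⟩
    · rw [Pic.ip_neg_left, Pic.ip_neg_right, neg_neg]; exact hg.1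
    · rw [Pic.ip_neg_right, hg.2, neg_zero]
  rcases a with c | c | c | c | ⟨c, k⟩
  · rw [excGen, excR3Lo_eq hd]
    exact commute_rootVec hd (isRoot_three hd c)
  · rw [excGen, excR3Up_eq hd]
    exact commute_rootVec hd (hneg (isRoot_three hd c))
  · rw [excGen, excR6Lo_eq hd]
    exact commute_rootVec hd (isRoot_six hd c)
  · rw [excGen, excR6Up_eq hd]
    exact commute_rootVec hd (hneg (isRoot_six hd c))
  · show Commute (excK c k ⊗ₖ 1 + 1 ⊗ₖ excK c k) (excBMat d)
    by_cases h : c = k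
    · subst h
      rw [excK_self hd]
      refine commute_diagonal fun K J L I h => ?_
      have h2 := congrFun (congrArg Prod.snd h) c
      simp only [Prod.snd_add, Pi.add_apply] at h2
      have h3 : ((Pic.wt K).2 c : ℝ) + (Pic.wt L).2 c = (Pic.wt J).2 c + (Pic.wt I).2 c := by
        exact_mod_cast h2
      linarith
    · rw [excK_of_ne hd h, kronecker_smul_add]
      exact (commute_rootVec hd (isRoot_gl hd h)).smul_left _

/-- The Lie algebra of `E_{d(d)}`. -/
def excLie (d : ℕ) : Submodule ℝ (Matrix (ExcIdx d) (ExcIdx d) ℝ) :=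
  Submodule.span ℝ (Set.range (excGen (d := d)))

lemma excLie_commute (hd : d ≤ 7) {A : Matrix (ExcIdx d) (ExcIdx d) ℝ} (hA : A ∈ excLie d) :
    Commute (A ⊗ₖ 1 + 1 ⊗ₖ A) (yMat excY) := by
  rw [yMat_excY]
  refine (commute_swapMat_add A).add_right ?_
  refine Submodule.span_induction ?_ ?_ ?_ ?_ hA
  · rintro _ ⟨a, rfl⟩
    exact excGen_commute hd a
  · simp
  · intro A B _ _ hA hB
    rw [kronecker_add_add]
    exact hA.add_left hB
  · intro c A _ hA
    rw [kronecker_smul_add]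
    exact hA.smul_left c

lemma excDatum_Y (hd : d ≤ 7) : (excDatum d).Y = excY := by
  funext I J K L
  show kd I K * kd J L + ∑ a, excGenDual a K J * excGen a L I
    + 1 / (9 - (d : ℝ)) * (kd I L * kd J K) = _
  exact (add_assoc _ _ _).trans (congrArg _ (exc_casimir hd K J L I))

/-- `excB K J` is the matrix of an element of the Lie algebra plus a multiple of the identity. -/
lemma excB_commute (hd : d ≤ 7) (K J : ExcIdx d) :
    Commute (Matrix.of (excB K J) ⊗ₖ 1 + 1 ⊗ₖ Matrix.of (excB K J)) (yMat excY) := by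
  have h : Matrix.of (excB K J) = ∑ a, excGenDual a K J • excGen a
      + (1 / (9 - (d : ℝ)) * kd J K) • (1 : Matrix (ExcIdx d) (ExcIdx d) ℝ) := by
    ext L I
    rw [of_apply, excB, ← exc_casimir hd, Matrix.add_apply, Matrix.sum_apply, Matrix.smul_apply,
      show (1 : Matrix (ExcIdx d) (ExcIdx d) ℝ) L I = kd I L by
        rw [one_apply, kd]; simp only [eq_comm]]
    simp only [Matrix.smul_apply, smul_eq_mul]
    ring
  rw [h, kronecker_add_add, kronecker_smul_add]
  refine Commute.add_left (excLie_commute hd ?_) ?_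
  · exact Submodule.sum_mem _ fun a _ => Submodule.smul_mem _ _
      (Submodule.subset_span (Set.mem_range_self a))
  · rw [one_kronecker_one]
    exact ((Commute.one_left _).add_left (Commute.one_left _)).smul_left _

/-- The symplectic form of `E_{7(7)}`; it vanishes for `d < 7`. -/
def excSympl (K L : ExcIdx d) : ℝ :=
  basisSign K * basisSign L * Pic.sympl (Pic.wt K) (Pic.wt L)

/-- The antisymmetric part of the Y-tensor of `E_d`. -/
lemma excY_sub (hd : d ≤ 7) (I J K L : ExcIdx d) :
    excY I J K L - excY J I K L = - (excSympl I J * excSympl K L) := by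
  have h := Pic.casimir_sub_casimir hd (Pic.wt_isLine hd K) (Pic.wt_isLine hd J)
    (Pic.wt_isLine hd L) (Pic.wt_isLine hd I)
  have hk : ∀ (a b c e : ExcIdx d), kd a b * kd c e = basisSign a * basisSign b *
      (basisSign c * basisSign e) *
        (if Pic.wt a = Pic.wt b ∧ Pic.wt c = Pic.wt e then 1 else 0) := by
    intro a b c e
    simp only [(Pic.wt_injective hd).eq_iff, kd]
    split_ifs <;> simp_all [basisSign_mul_self]
  rw [excY, excY, hk, hk, excB, excB, excSympl, excSympl]
  linear_combination basisSign K * basisSign J * basisSign L * basisSign I * h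

lemma excSympl_of_lt (hd : d ≤ 6) (K L : ExcIdx d) : excSympl K L = 0 := by
  have h := (Pic.wt_isLine (hd.trans (by norm_num)) K).ip_le_one hd
    (Pic.wt_isLine (hd.trans (by norm_num)) L)
  rw [excSympl, Pic.sympl, if_neg, mul_zero]
  rw [(Pic.wt_isLine (hd.trans (by norm_num)) K).add_eq_kap_iff (hd.trans (by norm_num))
    (Pic.wt_isLine (hd.trans (by norm_num)) L)]
  omega

/-- The symplectic form pairs each weight with its image under the Geiser involution. -/
lemma sum_excSympl (hd : d = 7) (F : Pic d → ℝ) (N : ExcIdx d) :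
    ∑ M, excSympl M N * (basisSign M * F (Pic.wt M)) = basisSign N *
      (F (Pic.kap d - Pic.wt N) * Pic.sg (Pic.q (Pic.kap d - Pic.wt N) (Pic.kap d))) := by
  subst hd
  obtain ⟨X, hX⟩ := Pic.IsLine.exists_wt le_rfl (Pic.wt_isLine le_rfl N).kap_sub
  rw [Finset.sum_eq_single X, excSympl, Pic.sympl, if_pos (by rw [hX]; abel), hX]
  · linear_combination basisSign N * F (Pic.kap 7 - Pic.wt N)
      * Pic.sg (Pic.q (Pic.kap 7 - Pic.wt N) (Pic.kap 7)) * basisSign_mul_self X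
  · intro Z _ hZ
    rw [excSympl, Pic.sympl, if_neg]
    · ring
    · intro h
      exact hZ (Pic.wt_injective le_rfl (by rw [hX, ← h]; abel))
  · simp

lemma excB_crossing (hd : d ≤ 7) (K J L N : ExcIdx d) :
    ∑ M, excSympl M N * excB K J M L + ∑ M, excSympl M L * excB K J M N
      = ∑ M, excSympl M J * (excY L N K M + excY N L K M) := by
  rcases Nat.lt_or_eq_of_le hd with h6 | h7
  · simp [excSympl_of_lt (Nat.le_of_lt_succ h6)]
  have h := Pic.casimir_sympl h7 (Pic.wt_isLine hd K) (Pic.wt_isLine hd J)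
    (Pic.wt_isLine hd N) (Pic.wt_isLine hd L)
  have h1 := sum_excSympl h7 (fun x => basisSign K * basisSign J * basisSign L *
    Pic.casimir (Pic.wt K) (Pic.wt J) x (Pic.wt L)) N
  have h2 := sum_excSympl h7 (fun x => basisSign K * basisSign J * basisSign N *
    Pic.casimir (Pic.wt K) (Pic.wt J) x (Pic.wt N)) L
  have h3 := sum_excSympl h7 (fun x => basisSign K * basisSign N * basisSign L *
    Pic.casimir (Pic.wt K) (Pic.wt N) x (Pic.wt L)) J
  have h4 := sum_excSympl h7 (fun x => basisSign K * basisSign L * basisSign N *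
    Pic.casimir (Pic.wt K) (Pic.wt L) x (Pic.wt N)) J
  have e1 : ∑ M, excSympl M N * excB K J M L = ∑ M, excSympl M N * (basisSign M *
      (basisSign K * basisSign J * basisSign L *
        Pic.casimir (Pic.wt K) (Pic.wt J) (Pic.wt M) (Pic.wt L))) :=
    Finset.sum_congr rfl fun M _ => by rw [excB]; ring
  have e2 : ∑ M, excSympl M L * excB K J M N = ∑ M, excSympl M L * (basisSign M *
      (basisSign K * basisSign J * basisSign N *
        Pic.casimir (Pic.wt K) (Pic.wt J) (Pic.wt M) (Pic.wt N))) :=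
    Finset.sum_congr rfl fun M _ => by rw [excB]; ring
  have e3 : ∑ M, excSympl M J * (excY L N K M + excY N L K M)
      = kd L K * excSympl N J + kd N K * excSympl L J
      + ∑ M, excSympl M J * (basisSign M * (basisSign K * basisSign N * basisSign L *
          Pic.casimir (Pic.wt K) (Pic.wt N) (Pic.wt M) (Pic.wt L)))
      + ∑ M, excSympl M J * (basisSign M * (basisSign K * basisSign L * basisSign N *
          Pic.casimir (Pic.wt K) (Pic.wt L) (Pic.wt M) (Pic.wt N))) := by
    have hkd : ∀ (c : ℝ) (X : ExcIdx d), c * excSympl X J = ∑ M, excSympl M J * (c * kd X M) :=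
      fun c X => by
        simp only [kd, mul_ite, mul_one, mul_zero, Finset.sum_ite_eq, Finset.mem_univ, if_true]
        ring
    rw [hkd (kd L K) N, hkd (kd N K) L]
    simp only [← Finset.sum_add_distrib]
    exact Finset.sum_congr rfl fun M _ => by rw [excY, excY, excB, excB]; ring
  have hk : ∀ a b c e : ExcIdx d, kd a b * excSympl c e = basisSign a * basisSign b *
      basisSign c * basisSign e * (if Pic.wt a = Pic.wt b then Pic.sympl (Pic.wt c) (Pic.wt e)
        else 0) := by
    intro a b c e
    simp only [(Pic.wt_injective hd).eq_iff, kd, excSympl]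
    split_ifs with hab
    · rw [hab]
      linear_combination (-basisSign c * basisSign e * Pic.sympl (Pic.wt c) (Pic.wt e))
        * basisSign_mul_self b
    · ring
  rw [e1, e2, e3, h1, h2, h3, h4, hk, hk]
  linear_combination basisSign K * basisSign J * basisSign L * basisSign N * h

lemma exc_isUnit_det_of_mem {g : Matrix (ExcIdx d) (ExcIdx d) ℝ} (hg : g ∈ excFrameGroup d) :
    IsUnit g.det := by
  obtain ⟨c, hc, h, hh, rfl⟩ := hg
  have h1 : IsUnit h := by
    refine Submonoid.closure_induction ?_ isUnit_one (fun _ _ _ _ => IsUnit.mul) hh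
    rintro _ ⟨A, _, rfl⟩
    exact Matrix.isUnit_exp A
  rw [det_smul]
  exact (isUnit_iff_ne_zero.2 (pow_ne_zero _ hc.ne')).mul ((isUnit_iff_isUnit_det h).1 h1)

lemma exc_commute_of_mem (hd : d ≤ 7) {g : Matrix (ExcIdx d) (ExcIdx d) ℝ}
    (hg : g ∈ excFrameGroup d) : Commute (g ⊗ₖ g) (yMat excY) := by
  obtain ⟨c, hc, h, hh, rfl⟩ := hg
  have h1 : Commute (h ⊗ₖ h) (yMat (excY (d := d))) := by
    refine Submonoid.closure_induction
      (motive := fun h _ => Commute (h ⊗ₖ h) (yMat (excY (d := d)))) ?_ ?_ ?_ hh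
    · rintro _ ⟨A, hA, rfl⟩
      exact commute_exp (excLie_commute hd hA)
    · rw [one_kronecker_one]
      exact Commute.one_left _
    · intro a b _ _ ha hb
      rw [mul_kronecker_mul]
      exact ha.mul_left hb
  rw [smul_kronecker, kronecker_smul]
  exact (h1.smul_left c).smul_left c

lemma excY_symm (hd : d ≤ 7) (I J K L : ExcIdx d) : excY I J K L = excY J I L K := by
  rw [excY, excY, excB, excB, Pic.casimir_symm hd (Pic.wt_isLine hd K) (Pic.wt_isLine hd J)
    (Pic.wt_isLine hd L) (Pic.wt_isLine hd I)]
  ring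

lemma exc_isCovariantY (hd : d ≤ 7) :
    IsCovariantY (excLie d) (excFrameGroup d) (excY (d := d)) where
  symm K J L I := excY_symm hd I J K L
  invariant _ hA := excLie_commute hd hA
  isUnit_det _ hg := exc_isUnit_det_of_mem hg
  frame _ hg := exc_commute_of_mem hd hg
  quadratic s hs hY J K P I := quadratic_of_crossing (fun _ _ _ _ => rfl) (excB_commute hd)
    (excY_sub hd) (excB_crossing hd) s hs hY J K P I

lemma exc_isCovariant (hd : d ≤ 7) : (excDatum d).IsCovariant := by
  rw [DualityDatum.IsCovariant, excDatum_Y hd]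
  exact exc_isCovariantY hd

theorem DualityGroup.isCovariant (G : DualityGroup) : G.datum.IsCovariant := by
  cases G with
  | orthogonal d m => exact orth_isCovariant d m
  | exceptional d hd => exact exc_isCovariant hd

end

section

/-! ### Calculus of matrix-valued functions -/

section Calculus

variable {X : Type*} [NormedAddCommGroup X] [NormedSpace ℝ X] {κ ι τ : Type} [Fintype κ]

/-- Entrywise differentiability of a matrix-valued function. -/
def DiffAt (F : X → Matrix ι τ ℝ) (x : X) : Prop :=
  ∀ A B, DifferentiableAt ℝ (fun z => F z A B) x

/-- Entrywise derivative of a matrix-valued function at `x` in the direction `v`. -/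
def dirDeriv (F : X → Matrix ι τ ℝ) (x v : X) : Matrix ι τ ℝ :=
  Matrix.of fun A B => fderiv ℝ (fun z => F z A B) x v

lemma DiffAt.add {F G : X → Matrix ι τ ℝ} {x : X} (hF : DiffAt F x) (hG : DiffAt G x) :
    DiffAt (fun z => F z + G z) x := fun A B => (hF A B).add (hG A B)

lemma DiffAt.mul {F : X → Matrix ι κ ℝ} {G : X → Matrix κ τ ℝ} {x : X} (hF : DiffAt F x)
    (hG : DiffAt G x) : DiffAt (fun z => F z * G z) x := fun A B => by
  simp only [mul_apply]
  exact DifferentiableAt.fun_sum fun C _ => (hF A C).mul (hG C B)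

lemma DiffAt.smul {f : X → ℝ} {F : X → Matrix ι τ ℝ} {x : X} (hf : DifferentiableAt ℝ f x)
    (hF : DiffAt F x) : DiffAt (fun z => f z • F z) x := fun A B => hf.mul (hF A B)

lemma DiffAt.sum {F : κ → X → Matrix ι τ ℝ} {x : X} (hF : ∀ k, DiffAt (F k) x) :
    DiffAt (fun z => ∑ k, F k z) x := fun A B => by
  simp only [Matrix.sum_apply]
  exact DifferentiableAt.fun_sum fun k _ => hF k A B

lemma DiffAt.const (M : Matrix ι τ ℝ) (x : X) : DiffAt (fun _ => M) x :=
  fun _ _ => differentiableAt_const _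

lemma DiffAt.det [Fintype ι] [DecidableEq ι] {F : X → Matrix ι ι ℝ} {x : X} (hF : DiffAt F x) :
    DifferentiableAt ℝ (fun z => (F z).det) x := by
  simp only [det_apply']
  refine DifferentiableAt.fun_sum fun σ _ => DifferentiableAt.const_mul ?_ _
  exact (HasFDerivAt.finsetProd fun i _ => (hF (σ i) i).hasFDerivAt).differentiableAt

lemma DiffAt.inv [Fintype ι] [DecidableEq ι] {F : X → Matrix ι ι ℝ} {x : X} (hF : DiffAt F x)
    (h : IsUnit (F x).det) : DiffAt (fun z => (F z)⁻¹) x := fun A B => by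
  simp only [inv_def, Ring.inverse_eq_inv', Matrix.smul_apply, smul_eq_mul, adjugate_apply]
  refine (hF.det.inv h.ne_zero).mul (DiffAt.det fun C D => ?_)
  simp only [updateRow_apply]
  split_ifs
  · exact differentiableAt_const _
  · exact hF _ _

lemma dirDeriv_add {F G : X → Matrix ι τ ℝ} {x : X} (hF : DiffAt F x) (hG : DiffAt G x) (v : X) :
    dirDeriv (fun z => F z + G z) x v = dirDeriv F x v + dirDeriv G x v := by
  ext A B
  exact congrArg (· v) (fderiv_fun_add (hF A B) (hG A B))

lemma dirDeriv_mul {F : X → Matrix ι κ ℝ} {G : X → Matrix κ τ ℝ} {x : X} (hF : DiffAt F x)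
    (hG : DiffAt G x) (v : X) :
    dirDeriv (fun z => F z * G z) x v = dirDeriv F x v * G x + F x * dirDeriv G x v := by
  ext A B
  simp only [dirDeriv, of_apply, Matrix.add_apply, mul_apply]
  rw [fderiv_fun_sum fun C _ => (hF A C).fun_mul (hG C B), _root_.sum_apply,
    ← Finset.sum_add_distrib]
  refine Finset.sum_congr rfl fun C _ => ?_
  rw [fderiv_fun_mul (hF A C) (hG C B)]
  simp only [_root_.add_apply, _root_.smul_apply, smul_eq_mul]
  ring

lemma dirDeriv_smul {f : X → ℝ} {F : X → Matrix ι τ ℝ} {x : X} (hf : DifferentiableAt ℝ f x)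
    (hF : DiffAt F x) (v : X) :
    dirDeriv (fun z => f z • F z) x v = fderiv ℝ f x v • F x + f x • dirDeriv F x v := by
  ext A B
  simp only [dirDeriv, of_apply, Matrix.add_apply, Matrix.smul_apply, smul_eq_mul]
  rw [fderiv_fun_mul hf (hF A B)]
  simp only [_root_.add_apply, _root_.smul_apply, smul_eq_mul]
  ring

lemma dirDeriv_sum {F : κ → X → Matrix ι τ ℝ} {x : X} (hF : ∀ k, DiffAt (F k) x) (v : X) :
    dirDeriv (fun z => ∑ k, F k z) x v = ∑ k, dirDeriv (F k) x v := by
  ext A B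
  simp only [dirDeriv, of_apply, Matrix.sum_apply]
  rw [fderiv_fun_sum fun k _ => hF k A B, _root_.sum_apply]

lemma dirDeriv_const (M : Matrix ι τ ℝ) (x v : X) : dirDeriv (fun _ => M) x v = 0 := by
  ext A B
  simp [dirDeriv]

lemma dirDeriv_congr {F G : X → Matrix ι τ ℝ} {x : X} (h : F =ᶠ[nhds x] G) (v : X) :
    dirDeriv F x v = dirDeriv G x v := by
  ext A B
  have h' : (fun z => F z A B) =ᶠ[nhds x] fun z => G z A B := h.mono fun z hz => by
    show F z A B = G z A B
    rw [hz]
  exact congrArg (fun L : X →L[ℝ] ℝ => L v) h'.fderiv_eq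

lemma eventually_isUnit_det [Fintype ι] [DecidableEq ι] {F : X → Matrix ι ι ℝ} {x : X}
    (hF : DiffAt F x) (h : IsUnit (F x).det) : ∀ᶠ z in nhds x, IsUnit (F z).det :=
  (hF.det.continuousAt.eventually_ne h.ne_zero).mono fun _ hz => isUnit_iff_ne_zero.2 hz

lemma dirDeriv_inv [Fintype ι] [DecidableEq ι] {F : X → Matrix ι ι ℝ} {x : X} (hF : DiffAt F x)
    (h : IsUnit (F x).det) (v : X) :
    dirDeriv (fun z => (F z)⁻¹) x v = - ((F x)⁻¹ * dirDeriv F x v * (F x)⁻¹) := by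
  have h1 := dirDeriv_congr (F := fun z => (F z)⁻¹ * F z) (G := fun _ => 1) (x := x)
    ((eventually_isUnit_det hF h).mono fun z hz => nonsing_inv_mul _ hz) v
  rw [dirDeriv_mul (hF.inv h) hF, dirDeriv_const, add_comm] at h1
  have h2 := congrArg (· * (F x)⁻¹) h1
  simp only [add_mul, zero_mul, mul_assoc, mul_nonsing_inv _ h, mul_one] at h2
  rw [eq_neg_iff_add_eq_zero, add_comm, mul_assoc, h2]

end Calculus

/-! ### The affine connection of a frame -/

section Connection

variable {D : DualityDatum} {n : ℕ} {tS : Fin n → Matrix D.Idx D.Idx ℝ}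
  {E : (D.Idx → ℝ) → Matrix D.Idx D.Idx ℝ} {Om : (D.Idx → ℝ) → Matrix D.Idx (Fin n) ℝ}

/-- The matrix of `∂_I E`. -/
def pdMat {ι τ κ : Type} [Fintype κ] [DecidableEq κ] (I : κ) (F : (κ → ℝ) → Matrix ι τ ℝ)
    (y : κ → ℝ) : Matrix ι τ ℝ := dirDeriv F y (Pi.single I 1)

/-- The matrix `Ω_{IA}^B`, for a fixed curved index `I`. -/
def spinMat (tS : Fin n → Matrix D.Idx D.Idx ℝ) (E : (D.Idx → ℝ) → Matrix D.Idx D.Idx ℝ)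
    (Om : (D.Idx → ℝ) → Matrix D.Idx (Fin n) ℝ) (y : D.Idx → ℝ) (I : D.Idx) :
    Matrix D.Idx D.Idx ℝ := Matrix.of (spinConnCurved D tS E Om y I)

lemma affineConn_eq (y : D.Idx → ℝ) (I : D.Idx) :
    Matrix.of (affineConn D tS E Om y I)
      = (E y)⁻¹ * (-pdMat I E y + spinMat tS E Om y I * E y) := by
  ext K J
  rfl

lemma vielbeinPostulate_iff_mat (Gam : (D.Idx → ℝ) → D.Idx → D.Idx → D.Idx → ℝ) (y : D.Idx → ℝ) :
    VielbeinPostulate D tS E Om Gam y ↔ ∀ I : D.Idx,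
      pdMat I E y - spinMat tS E Om y I * E y + E y * Matrix.of (Gam y I) = 0 := by
  have h : ∀ I A J : D.Idx, (pdMat I E y - spinMat tS E Om y I * E y
      + E y * Matrix.of (Gam y I)) A J = pd I (fun z => E z A J) y
      - ∑ B, spinConnCurved D tS E Om y I A B * E y B J + ∑ K, Gam y I K J * E y A K := by
    intro I A J
    simp only [Matrix.add_apply, Matrix.sub_apply, mul_apply, of_apply, mul_comm (E y A _)]
    rfl
  constructor
  · intro hv I
    ext A J
    rw [h]
    exact hv I A J
  · intro hv I A J
    rw [← h, hv]
    rfl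

/-- The vielbein postulate can be solved for the affine connection, as the frame is invertible. -/
lemma vielbeinPostulate_iff (Gam : (D.Idx → ℝ) → D.Idx → D.Idx → D.Idx → ℝ) {y : D.Idx → ℝ}
    (hE : IsUnit (E y).det) : VielbeinPostulate D tS E Om Gam y ↔
      ∀ I K J, Gam y I K J = affineConn D tS E Om y I K J := by
  rw [vielbeinPostulate_iff_mat]
  refine forall_congr' fun I => ?_
  have h1 : (∀ K J, Gam y I K J = affineConn D tS E Om y I K J) ↔
      Matrix.of (Gam y I) = Matrix.of (affineConn D tS E Om y I) :=
    ⟨fun h => by ext K J; exact h K J, fun h K J => congrFun (congrFun h K) J⟩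
  rw [h1, affineConn_eq]
  constructor
  · intro h
    have h2 : E y * Matrix.of (Gam y I) = -pdMat I E y + spinMat tS E Om y I * E y := by
      rw [← sub_eq_zero, ← h]; abel
    rw [← h2, ← mul_assoc, nonsing_inv_mul _ hE, one_mul]
  · intro h
    rw [h, ← mul_assoc, mul_nonsing_inv _ hE, one_mul]
    abel

/-- The flat components of the connection defined by `Ω`: the Weitzenböck connection of the frame
plus `Ω`. -/
lemma flatConn_affineConn {y : D.Idx → ℝ} (hE : IsUnit (E y).det) (A : D.Idx) :
    Matrix.of (flatConn D E (affineConn D tS E Om) y A)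
      = - ∑ I, E y A I • (pdMat I E y * (E y)⁻¹) + ∑ α, Om y A α • tS α := by
  have h1 : ∀ I, E y * Matrix.of (affineConn D tS E Om y I) * (E y)⁻¹
      = - (pdMat I E y * (E y)⁻¹) + spinMat tS E Om y I := fun I => by
    rw [affineConn_eq, ← mul_assoc, mul_nonsing_inv _ hE, one_mul, add_mul, mul_assoc,
      mul_nonsing_inv _ hE, mul_one, neg_mul]
  have h2 : ∑ I, E y A I • spinMat tS E Om y I = ∑ α, Om y A α • tS α := by
    ext B C
    simp only [Matrix.sum_apply, Matrix.smul_apply, smul_eq_mul, spinMat, of_apply, spinConnCurved,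
      Finset.mul_sum]
    rw [Finset.sum_comm]
    have : ∀ F, ∑ I, E y A I * ((E y)⁻¹ I F * spinConn D tS Om y F B C)
        = (1 : Matrix D.Idx D.Idx ℝ) A F * spinConn D tS Om y F B C := fun F => by
      rw [← mul_nonsing_inv _ hE, mul_apply, Finset.sum_mul]
      exact Finset.sum_congr rfl fun I _ => by ring
    simp only [this, one_apply, ite_mul, one_mul, zero_mul, Finset.sum_ite_eq, Finset.mem_univ,
      if_true]
    rfl
  ext B C
  rw [← h2, of_apply, show flatConn D E (affineConn D tS E Om) y A B C
    = conj (E y) (affineConn D tS E Om y) A B C from rfl, conj_eq_sum]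
  simp only [h1, Matrix.add_apply, Matrix.neg_apply, Matrix.sum_apply, Matrix.smul_apply,
    smul_eq_mul, mul_add, Finset.sum_add_distrib, mul_neg, Finset.sum_neg_distrib]

end Connection

end

section

/-! ### The fluxes of the mega-space frame -/

section MegaTensor

variable (D : DualityDatum) {n : ℕ}

lemma megaL_inr_inr (A B : D.Idx) : megaL D (n := n) (.inr A) (.inr B) = - kd A B := by
  simp [megaL, megaK, kd, Matrix.sub_apply, Matrix.sum_apply, one_apply]

lemma megaL_inl (α : Fin n) (P : MegaIdx D n) : megaL D (.inl α) P = 0 := by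
  rcases P with β | B
  · simp [megaL, megaK, kd, Matrix.sub_apply, Matrix.sum_apply, one_apply]
  · simp [megaL, megaK, Matrix.sub_apply, Matrix.sum_apply]

lemma megaL_inr_inl (A : D.Idx) (β : Fin n) : megaL D (.inr A) (.inl β) = 0 := by
  simp [megaL, megaK, Matrix.sub_apply, Matrix.sum_apply]

/-- With both outer indices in level 0, the Y-tensor of the mega-space has no component that mixes
levels, so that only level-0 components of the connection enter in the flux. -/
lemma megaY_inr_inl (P : MegaIdx D n) (B C : D.Idx) (α : Fin n) :
    megaY D P (.inr C) (.inr B) (.inl α) = 0 := by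
  simp [megaY, megaL_inl, megaEmb, megaRNeg, megaRPos, megaK, kd]
  rcases P with P | P <;> simp

lemma megaY_inl_inr (α : Fin n) (B C : D.Idx) (P : MegaIdx D n) :
    megaY D (.inl α) (.inr C) (.inr B) P = 0 := by
  rcases P with β | A
  · exact megaY_inr_inl D _ _ _ _
  · simp [megaY, megaL_inr_inl, megaEmb, megaRNeg, megaRPos, megaK, kd]

/-- The restriction to level 0 is the Y-tensor of the duality group; the term with `β` comes from
the dilation `megaL`, which acts there by `-1`. -/
lemma megaY_inr (F C B G : D.Idx) :
    megaY D (n := n) (.inr F) (.inr C) (.inr B) (.inr G) = D.Y F C B G := by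
  simp [megaY, megaL_inr_inr, megaEmb, megaRNeg, megaRPos, megaK, kd, DualityDatum.Y, eq_comm]
  split_ifs <;> simp

end MegaTensor

section MegaFlux

variable {X X' : Type*} [NormedAddCommGroup X] [NormedSpace ℝ X] [NormedAddCommGroup X']
  [NormedSpace ℝ X'] {ι τ : Type}

lemma DiffAt.comp_clm {F : X' → Matrix ι τ ℝ} (L : X →L[ℝ] X') {x : X} (hF : DiffAt F (L x)) :
    DiffAt (fun z => F (L z)) x := fun A B =>
  DifferentiableAt.comp x (hF A B) L.differentiableAt

lemma dirDeriv_comp_clm {F : X' → Matrix ι τ ℝ} (L : X →L[ℝ] X') {x : X} (hF : DiffAt F (L x))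
    (v : X) : dirDeriv (fun z => F (L z)) x v = dirDeriv F (L x) (L v) := by
  ext A B
  have h := fderiv_comp x (hF A B) L.differentiableAt
  rw [L.fderiv] at h
  exact congrArg (fun l : X →L[ℝ] ℝ => l v) h

lemma dirDeriv_zero (F : X → Matrix ι τ ℝ) (x : X) : dirDeriv F x 0 = 0 := by
  ext A B
  simp [dirDeriv]

/-- Differentiability of `s ↦ exp (s^μ t_μ)`. -/
lemma diffAt_exp {κ : Type} [Fintype κ] [DecidableEq κ] {n : ℕ} (t : Fin n → Matrix κ κ ℝ)
    (s : Fin n → ℝ) : DiffAt (fun s : Fin n → ℝ => NormedSpace.exp (∑ μ, s μ • t μ)) s := by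
  intro A B
  open scoped Norms.Operator in
  have h1 : DifferentiableAt ℝ (NormedSpace.exp : Matrix κ κ ℝ → Matrix κ κ ℝ) (∑ μ, s μ • t μ) :=
    (NormedSpace.exp_analytic (𝕂 := ℝ) _).differentiableAt
  have h2 : DifferentiableAt ℝ (fun s : Fin n → ℝ => ∑ μ, s μ • t μ) s := by fun_prop
  have h3 : DifferentiableAt ℝ (fun M : Matrix κ κ ℝ => M A B) (NormedSpace.exp (∑ μ, s μ • t μ)) :=
    (LinearMap.toContinuousLinearMap (Matrix.entryLinearMap ℝ ℝ A B)).differentiableAt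
  exact h3.comp s (h1.comp s h2)

end MegaFlux

section MegaFrame

variable {D : DualityDatum} {n : ℕ} {tS : Fin n → Matrix D.Idx D.Idx ℝ}
  {f : Fin n → Fin n → Fin n → ℝ} {v : (Fin n → ℝ) → Matrix (Fin n) (Fin n) ℝ}
  {E : (D.Idx → ℝ) → Matrix D.Idx D.Idx ℝ} {Om : (D.Idx → ℝ) → Matrix D.Idx (Fin n) ℝ}

/-- The twist in the representation `R₁`. -/
def twist (tS : Fin n → Matrix D.Idx D.Idx ℝ) (s : Fin n → ℝ) : Matrix D.Idx D.Idx ℝ :=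
  NormedSpace.exp (∑ μ, s μ • tS μ)

lemma isUnit_det_twist (s : Fin n → ℝ) : IsUnit (twist tS s).det :=
  (isUnit_iff_isUnit_det _).1 (Matrix.isUnit_exp _)

lemma commute_twist_inv (hD : D.IsCovariant) (htS : ∀ α, tS α ∈ D.lieAlgebra) (s : Fin n → ℝ) :
    Commute ((twist tS s)⁻¹ ⊗ₖ (twist tS s)⁻¹) (yMat D.Y) := by
  rw [twist, ← Matrix.exp_neg]
  exact commute_exp (hD.invariant _ (Submodule.neg_mem _ (Submodule.sum_mem _ fun μ _ =>
    Submodule.smul_mem _ _ (htS μ))))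

lemma megaFrame_eq (x : MegaIdx D n → ℝ) : megaFrame D tS f v E Om x =
    fromBlocks (NormedSpace.exp (∑ μ, x (.inl μ) • adjRep f μ) * v (x ∘ Sum.inl)) 0
      (-(twist tS (x ∘ Sum.inl) * Om (x ∘ Sum.inr) * v (x ∘ Sum.inl)))
      (twist tS (x ∘ Sum.inl) * E (x ∘ Sum.inr)) := by
  simp [megaFrame, megaM, megaN, megaV, fromBlocks_multiply, twist]

lemma megaM_inv (s : Fin n → ℝ) : (megaM D tS f s)⁻¹ =
    fromBlocks (NormedSpace.exp (∑ μ, s μ • adjRep f μ))⁻¹ 0 0 (twist tS s)⁻¹ := by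
  rw [megaM, inv_fromBlocks_zero₁₂_of_isUnit_iff]
  · simp [twist]
  · exact iff_of_true (Matrix.isUnit_exp _) (Matrix.isUnit_exp _)

lemma megaFrame_inv {x : MegaIdx D n → ℝ} (hv : IsUnit (v (x ∘ Sum.inl)).det)
    (hE : IsUnit (E (x ∘ Sum.inr)).det) : ∃ A C, (megaFrame D tS f v E Om x)⁻¹ =
    fromBlocks A 0 C (twist tS (x ∘ Sum.inl) * E (x ∘ Sum.inr))⁻¹ := by
  rw [megaFrame_eq, inv_fromBlocks_zero₁₂_of_isUnit_iff]
  · exact ⟨_, _, rfl⟩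
  · refine iff_of_true ((Matrix.isUnit_exp _).mul ((isUnit_iff_isUnit_det _).2 hv)) ?_
    exact (Matrix.isUnit_exp _).mul ((isUnit_iff_isUnit_det _).2 hE)

/-- The level-0 block of the frame. -/
def levelZero (tS : Fin n → Matrix D.Idx D.Idx ℝ) (E : (D.Idx → ℝ) → Matrix D.Idx D.Idx ℝ)
    (x : MegaIdx D n → ℝ) : Matrix D.Idx D.Idx ℝ :=
  twist tS (x ∘ Sum.inl) * E (x ∘ Sum.inr)

/-- The level-0 components of the Weitzenböck connection only involve the level-0 block of the
frame and its derivatives along all directions of the mega-space. -/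
lemma megaWeitzenbock_inr {x : MegaIdx D n → ℝ} (hv : IsUnit (v (x ∘ Sum.inl)).det)
    (hE : IsUnit (E (x ∘ Sum.inr)).det) (P : MegaIdx D n) (B C : D.Idx) :
    megaWeitzenbock D tS f v E Om x P (.inr B) (.inr C)
      = - ∑ J, megaFrame D tS f v E Om x P J *
          (pdMat J (levelZero tS E) x * (levelZero tS E x)⁻¹) B C := by
  obtain ⟨A, C', h⟩ := megaFrame_inv (tS := tS) (f := f) (Om := Om) hv hE
  rw [megaWeitzenbock]
  congr 1
  refine Finset.sum_congr rfl fun J _ => ?_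
  rw [h, Fintype.sum_sum_type]
  simp only [fromBlocks_apply₁₂, fromBlocks_apply₂₂, Matrix.zero_apply, mul_zero,
    Finset.sum_const_zero, zero_add, mul_apply, Finset.mul_sum]
  refine Finset.sum_congr rfl fun I _ => ?_
  rw [mul_assoc]
  congr 2
  simp only [megaFrame_eq, fromBlocks_apply₂₂]
  rfl

/-- The level-0 fluxes are the generalized torsion of the level-0 Weitzenböck connection. -/
lemma megaFlux_inr {x : MegaIdx D n → ℝ} (A B C : D.Idx) :
    megaFlux D tS f v E Om x (.inr A) (.inr B) (.inr C)
      = genTorsion D (fun A B C => megaWeitzenbock D tS f v E Om x (.inr A) (.inr B) (.inr C))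
          A B C := by
  simp only [megaFlux, genTorsion, Fintype.sum_sum_type, megaY_inr_inl, megaY_inl_inr, megaY_inr,
    zero_mul, Finset.sum_const_zero, zero_add]

lemma untwistedFlux_inr (x : MegaIdx D n → ℝ) (A B C : D.Idx) :
    untwistedFlux D tS f v E Om x (.inr A) (.inr B) (.inr C)
      = conj (twist tS (x ∘ Sum.inl))⁻¹ (fun A B C =>
          megaFlux D tS f v E Om x (.inr A) (.inr B) (.inr C)) A B C := by
  rw [conj, nonsing_inv_nonsing_inv _ (isUnit_det_twist _)]
  simp only [untwistedFlux, megaM_inv]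
  simp [Fintype.sum_sum_type, megaM, twist]

/-- Restriction of the coordinates of the mega-space to one of its two factors, as a linear map. -/
def coordRestrict {α β : Type} [Fintype α] [Fintype β] (e : α → β) : (β → ℝ) →L[ℝ] (α → ℝ) :=
  LinearMap.toContinuousLinearMap (LinearMap.funLeft ℝ ℝ e)

lemma diffAt_twist (s : Fin n → ℝ) : DiffAt (twist tS) s := diffAt_exp tS s

lemma pdMat_levelZero {x : MegaIdx D n → ℝ} (hE : DiffAt E (x ∘ Sum.inr)) (J : MegaIdx D n) :
    pdMat J (levelZero tS E) x
      = dirDeriv (twist tS) (x ∘ Sum.inl) (Pi.single J 1 ∘ Sum.inl) * E (x ∘ Sum.inr)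
        + twist tS (x ∘ Sum.inl) * dirDeriv E (x ∘ Sum.inr) (Pi.single J 1 ∘ Sum.inr) := by
  have h1 : DiffAt (twist tS) (coordRestrict Sum.inl x) := diffAt_twist _
  have h2 : DiffAt E (coordRestrict Sum.inr x) := hE
  have h := dirDeriv_mul (h1.comp_clm (coordRestrict (Sum.inl (β := D.Idx))))
    (h2.comp_clm (coordRestrict (Sum.inr (α := Fin n)))) (Pi.single J 1)
  rw [dirDeriv_comp_clm _ h1, dirDeriv_comp_clm _ h2] at h
  exact h

lemma pdMat_inl_levelZero {x : MegaIdx D n → ℝ} (hE : DiffAt E (x ∘ Sum.inr)) (μ : Fin n) :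
    pdMat (.inl μ) (levelZero tS E) x
      = pdMat μ (twist tS) (x ∘ Sum.inl) * E (x ∘ Sum.inr) := by
  rw [pdMat_levelZero hE]
  have h1 : (Pi.single (Sum.inl μ) 1 : MegaIdx D n → ℝ) ∘ Sum.inl = Pi.single μ 1 := by
    funext ν
    simp [Pi.single_apply]
  have h2 : (Pi.single (Sum.inl μ) 1 : MegaIdx D n → ℝ) ∘ Sum.inr = 0 := by
    funext ν
    simp
  rw [h1, h2, dirDeriv_zero, mul_zero, add_zero]
  rfl

lemma pdMat_inr_levelZero {x : MegaIdx D n → ℝ} (hE : DiffAt E (x ∘ Sum.inr)) (I : D.Idx) :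
    pdMat (.inr I) (levelZero tS E) x
      = twist tS (x ∘ Sum.inl) * pdMat I E (x ∘ Sum.inr) := by
  rw [pdMat_levelZero hE]
  have h1 : (Pi.single (Sum.inr I) 1 : MegaIdx D n → ℝ) ∘ Sum.inr = Pi.single I 1 := by
    funext ν
    simp [Pi.single_apply]
  have h2 : (Pi.single (Sum.inr I) 1 : MegaIdx D n → ℝ) ∘ Sum.inl = 0 := by
    funext ν
    simp
  rw [h1, h2, dirDeriv_zero, zero_mul, zero_add]
  rfl

/-- The defining property of the group frame, restricted to level 0. -/
lemma IsGroupFrame.sum_pdMat_twist {S : Set (Fin n → ℝ)} (hv : IsGroupFrame D tS f S v)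
    {s : Fin n → ℝ} (hs : s ∈ S) (α : Fin n) :
    ∑ μ, v s α μ • ((twist tS s)⁻¹ * pdMat μ (twist tS) s) = tS α := by
  have h : ∑ μ, v s α μ • pdMat μ (twist tS) s = twist tS s * tS α := by
    ext B C
    have := hv.2.2.2 s hs α (.inr B) (.inr C)
    rw [megaM, megaT, fromBlocks_multiply, fromBlocks_apply₂₂, Matrix.mul_zero, zero_add] at this
    rw [twist, ← this]
    simp only [Matrix.sum_apply, Matrix.smul_apply, smul_eq_mul]
    rfl
  simp only [← mul_smul_comm]
  rw [← Finset.mul_sum, h, ← mul_assoc, nonsing_inv_mul _ (isUnit_det_twist s), one_mul]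

/-- Untwisting the level-0 components of the Weitzenböck connection gives the flat components of
the connection defined by `Ω`: the derivatives along the group produce `Ω`. -/
lemma conj_megaWeitzenbock {S : Set (Fin n → ℝ)} (hv : IsGroupFrame D tS f S v)
    {s : Fin n → ℝ} (hs : s ∈ S) {y : D.Idx → ℝ} (hE : IsUnit (E y).det) (hdE : DiffAt E y) :
    conj (twist tS s)⁻¹ (fun A B C =>
        megaWeitzenbock D tS f v E Om (Sum.elim s y) (.inr A) (.inr B) (.inr C))
      = flatConn D E (affineConn D tS E Om) y := by
  have hM := isUnit_det_twist (tS := tS) s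
  have hx1 : (Sum.elim s y : MegaIdx D n → ℝ) ∘ Sum.inl = s := rfl
  have hx2 : (Sum.elim s y : MegaIdx D n → ℝ) ∘ Sum.inr = y := rfl
  set x : MegaIdx D n → ℝ := Sum.elim s y with hx
  set M := twist tS s with hMdef
  set F := megaFrame D tS f v E Om x with hF
  have hW : ∀ T, Matrix.of (fun B C => megaWeitzenbock D tS f v E Om x (.inr T) (.inr B) (.inr C))
      = - ∑ J, F (.inr T) J • (pdMat J (levelZero tS E) x * (levelZero tS E x)⁻¹) := by
    intro T
    ext B C
    rw [of_apply, megaWeitzenbock_inr (hv.2.2.1 s hs) hE]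
    simp only [Matrix.neg_apply, Matrix.sum_apply, Matrix.smul_apply, smul_eq_mul]
    rfl
  have hL : levelZero tS E x = M * E y := rfl
  -- Derivatives along the group hit the twist, those along `y^I` the frame `E`.
  have hinl : ∀ μ, M⁻¹ * (pdMat (.inl μ) (levelZero tS E) x * (levelZero tS E x)⁻¹) * M
      = M⁻¹ * pdMat μ (twist tS) s := fun μ => by
    rw [pdMat_inl_levelZero hdE, hx1, hx2, hL, Matrix.mul_inv_rev]
    simp only [mul_assoc, nonsing_inv_mul _ hM, mul_one]
    rw [mul_nonsing_inv _ hE, mul_one]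
  have hinr : ∀ I, M⁻¹ * (pdMat (.inr I) (levelZero tS E) x * (levelZero tS E x)⁻¹) * M
      = pdMat I E y * (E y)⁻¹ := fun I => by
    rw [pdMat_inr_levelZero hdE, hx1, hx2, hL, Matrix.mul_inv_rev]
    simp only [mul_assoc, nonsing_inv_mul _ hM, mul_one]
    rw [← mul_assoc, nonsing_inv_mul _ hM, one_mul]
  -- The level-0 rows of the untwisted mega-space frame are `(-Ω v, E)`.
  have hcl : ∀ A μ, ∑ T, M⁻¹ A T * F (.inr T) (.inl μ) = - ∑ α, Om y A α * v s α μ := fun A μ => by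
    have : M⁻¹ * (-(M * Om y * v s)) = - (Om y * v s) := by
      rw [Matrix.mul_neg, Matrix.mul_assoc M, ← Matrix.mul_assoc M⁻¹, nonsing_inv_mul _ hM,
        Matrix.one_mul]
    have h := congrFun (congrFun this A) μ
    rw [mul_apply, Matrix.neg_apply, mul_apply] at h
    rw [← h, hF, megaFrame_eq]
    rfl
  have hcr : ∀ A I, ∑ T, M⁻¹ A T * F (.inr T) (.inr I) = E y A I := fun A I => by
    have : M⁻¹ * (M * E y) = E y := by
      rw [← mul_assoc, nonsing_inv_mul _ hM, one_mul]
    have h := congrFun (congrFun this A) I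
    rw [mul_apply] at h
    rw [← h, hF, megaFrame_eq]
    rfl
  funext A B C
  have hmat : ∑ T, M⁻¹ A T • (M⁻¹ * (- ∑ J, F (.inr T) J •
      (pdMat J (levelZero tS E) x * (levelZero tS E x)⁻¹)) * M)
      = Matrix.of (flatConn D E (affineConn D tS E Om) y A) := by
    calc _ = - ∑ J, (∑ T, M⁻¹ A T * F (.inr T) J) •
          (M⁻¹ * (pdMat J (levelZero tS E) x * (levelZero tS E x)⁻¹) * M) := by
          simp only [mul_neg, neg_mul, smul_neg, Finset.sum_neg_distrib, Finset.mul_sum,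
            Finset.sum_mul, Finset.smul_sum, Finset.sum_smul, mul_smul_comm, smul_mul_assoc,
            smul_smul]
          rw [Finset.sum_comm]
      _ = _ := by
          rw [Fintype.sum_sum_type]
          simp only [hinl, hinr, hcl, hcr, neg_smul, Finset.sum_neg_distrib]
          rw [flatConn_affineConn hE, neg_add, neg_neg, add_comm]
          congr 1
          simp only [Finset.sum_smul, ← smul_smul]
          rw [Finset.sum_comm]
          simp only [← Finset.smul_sum]
          exact Finset.sum_congr rfl fun α _ => congrArg _ (hv.sum_pdMat_twist hs α)
  have h := congrFun (congrFun hmat B) C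
  rw [of_apply] at h
  rw [← h, conj_eq_sum, nonsing_inv_nonsing_inv _ hM]
  simp only [hW, Matrix.sum_apply, Matrix.smul_apply, smul_eq_mul]

/-- The level-0 component of the untwisted fluxes is the generalized torsion. -/
lemma untwistedFlux_eq_torsion (hD : D.IsCovariant) (htS : ∀ α, tS α ∈ D.lieAlgebra)
    {S : Set (Fin n → ℝ)} (hv : IsGroupFrame D tS f S v)
    {s : Fin n → ℝ} (hs : s ∈ S) {y : D.Idx → ℝ} (hE : IsUnit (E y).det) (hdE : DiffAt E y)
    (A B C : D.Idx) :
    untwistedFlux D tS f v E Om (Sum.elim s y) (.inr A) (.inr B) (.inr C)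
      = torsion D tS E Om y A B C := by
  rw [untwistedFlux_inr, torsion, ← conj_megaWeitzenbock hv hs hE hdE,
    DualityDatum.genTorsion_conj ((isUnit_nonsing_inv_det_iff).2 (isUnit_det_twist s))
      (commute_twist_inv hD htS s)]
  have h : (fun A B C => megaFlux D tS f v E Om (Sum.elim s y) (.inr A) (.inr B) (.inr C))
      = genTorsion D (fun A B C =>
        megaWeitzenbock D tS f v E Om (Sum.elim s y) (.inr A) (.inr B) (.inr C)) := by
    funext A B C
    exact megaFlux_inr A B C
  rw [h]
  rfl

end MegaFrame

end

section

/-! ### Infinitesimal covariance of the generalized torsion -/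

section Torsion

variable {D : DualityDatum}

lemma genTorsion_add (Γ Γ' : D.Idx → D.Idx → D.Idx → ℝ) (A B C : D.Idx) :
    genTorsion D (fun A B C => Γ A B C + Γ' A B C) A B C
      = genTorsion D Γ A B C + genTorsion D Γ' A B C := by
  simp only [genTorsion, mul_add, Finset.sum_add_distrib]
  ring

lemma genTorsion_mul (c : ℝ) (Γ : D.Idx → D.Idx → D.Idx → ℝ) (A B C : D.Idx) :
    genTorsion D (fun A B C => c * Γ A B C) A B C = c * genTorsion D Γ A B C := by
  simp only [genTorsion, mul_left_comm _ c, ← Finset.mul_sum]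
  ring

lemma genTorsion_sum {κ : Type} [Fintype κ] (Γ : κ → D.Idx → D.Idx → D.Idx → ℝ) (A B C : D.Idx) :
    genTorsion D (fun A B C => ∑ k, Γ k A B C) A B C = ∑ k, genTorsion D (Γ k) A B C := by
  simp only [genTorsion, Finset.sum_add_distrib, Finset.sum_sub_distrib, Finset.mul_sum]
  congr 1
  symm
  rw [Finset.sum_comm]
  exact Finset.sum_congr rfl fun F _ => Finset.sum_comm

/-- The infinitesimal action of `λ` on the flat indices of a connection. -/
def rotate {κ : Type} [Fintype κ] (l : Matrix κ κ ℝ) (Γ : κ → κ → κ → ℝ) (A B C : κ) : ℝ :=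
  ∑ G, l A G * Γ G B C + ∑ G, l B G * Γ A G C - ∑ G, Γ A B G * l G C

/-- Infinitesimal invariance of the Y-tensor: taking the generalized torsion commutes with rotations
from the Lie algebra. -/
lemma genTorsion_rotate (hD : D.IsCovariant) {l : Matrix D.Idx D.Idx ℝ} (hl : l ∈ D.lieAlgebra)
    (Γ : D.Idx → D.Idx → D.Idx → ℝ) (A B C : D.Idx) :
    genTorsion D (rotate l Γ) A B C = rotate l (genTorsion D Γ) A B C := by
  have hY : ∀ F G, ∑ H, l B H * D.Y F C H G + ∑ H, l G H * D.Y F C B H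
      = ∑ H, D.Y F H B G * l H C + ∑ H, D.Y H C B G * l H F := fun F G => by
    have h := congrFun (congrFun (hD.invariant l hl).eq (B, G)) (C, F)
    rw [kronecker_add_mul_apply, mul_kronecker_add_apply] at h
    exact h
  have h1 : ∑ F, ∑ G, D.Y F C B G * rotate l Γ F A G
      = ∑ F, ∑ G, (D.Y F C B G * ∑ H, l A H * Γ F H G)
        + ∑ F, ∑ G, (∑ H, D.Y H C B G * l H F - ∑ H, l G H * D.Y F C B H) * Γ F A G := by
    have e1 : ∑ F, ∑ G, D.Y F C B G * ∑ H, l F H * Γ H A G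
        = ∑ F, ∑ G, (∑ H, D.Y H C B G * l H F) * Γ F A G := by
      simp only [Finset.mul_sum, Finset.sum_mul]
      rw [Finset.sum_congr rfl fun F _ => Finset.sum_comm, Finset.sum_comm]
      refine Finset.sum_congr rfl fun H _ => ?_
      rw [Finset.sum_comm]
      exact Finset.sum_congr rfl fun _ _ => Finset.sum_congr rfl fun _ _ => by ring
    have e2 : ∑ F, ∑ G, D.Y F C B G * ∑ H, Γ F A H * l H G
        = ∑ F, ∑ G, (∑ H, l G H * D.Y F C B H) * Γ F A G := by
      simp only [Finset.mul_sum, Finset.sum_mul]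
      refine Finset.sum_congr rfl fun F _ => ?_
      rw [Finset.sum_comm]
      exact Finset.sum_congr rfl fun _ _ => Finset.sum_congr rfl fun _ _ => by ring
    simp only [rotate, mul_add, mul_sub, sub_mul, Finset.sum_add_distrib, Finset.sum_sub_distrib,
      e1, e2]
    ring
  have h2 : ∀ F G, ∑ H, D.Y H C B G * l H F - ∑ H, l G H * D.Y F C B H
      = ∑ H, l B H * D.Y F C H G - ∑ H, D.Y F H B G * l H C := fun F G => by
    linarith [hY F G]
  have h3 : ∑ H, l A H * (∑ F, ∑ G, D.Y F C B G * Γ F H G)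
      = ∑ F, ∑ G, (D.Y F C B G * ∑ H, l A H * Γ F H G) := by
    simp only [Finset.mul_sum]
    rw [Finset.sum_comm]
    refine Finset.sum_congr rfl fun F _ => ?_
    rw [Finset.sum_comm]
    exact Finset.sum_congr rfl fun _ _ => Finset.sum_congr rfl fun _ _ => by ring
  have h4 : ∑ H, l B H * (∑ F, ∑ G, D.Y F C H G * Γ F A G)
      = ∑ F, ∑ G, (∑ H, l B H * D.Y F C H G) * Γ F A G := by
    simp only [Finset.mul_sum, Finset.sum_mul]
    rw [Finset.sum_comm]
    refine Finset.sum_congr rfl fun F _ => ?_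
    rw [Finset.sum_comm]
    exact Finset.sum_congr rfl fun _ _ => Finset.sum_congr rfl fun _ _ => by ring
  have h5 : ∑ H, (∑ F, ∑ G, D.Y F H B G * Γ F A G) * l H C
      = ∑ F, ∑ G, (∑ H, D.Y F H B G * l H C) * Γ F A G := by
    simp only [Finset.sum_mul]
    rw [Finset.sum_comm]
    refine Finset.sum_congr rfl fun F _ => ?_
    rw [Finset.sum_comm]
    exact Finset.sum_congr rfl fun _ _ => Finset.sum_congr rfl fun _ _ => by ring
  rw [genTorsion, h1]
  simp only [h2, sub_mul, Finset.sum_sub_distrib]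
  rw [← h3, ← h4, ← h5]
  simp only [rotate, genTorsion, mul_add, mul_sub, add_mul, sub_mul, Finset.sum_add_distrib,
    Finset.sum_sub_distrib]
  ring

/-- The tensor `- s^C_{IL} + Y^{CJ}_{KL} s^K_{IJ}` has no generalized torsion: this is where the
quadratic identity for the Y-tensor enters. -/
lemma genTorsion_eq_zero_of_quadratic (hD : D.IsCovariant) {s : D.Idx → D.Idx → D.Idx → ℝ}
    (hs : ∀ K I J, s K I J = s K J I)
    (hY : ∀ K P Q, ∑ I, ∑ J, D.Y I J P Q * s K I J = 0) (A B C : D.Idx) :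
    genTorsion D (fun I L C => - s C I L + ∑ J, ∑ K, D.Y C J K L * s K I J) A B C = 0 := by
  have h1 : ∑ F, ∑ G, D.Y F C B G * ∑ J, ∑ K, D.Y G J K A * s K F J
      = ∑ J, ∑ K, D.Y C J K A * s K B J := by
    calc _ = ∑ K, ∑ F, ∑ J, ∑ G, D.Y F C B G * D.Y G J K A * s K F J := by
          symm
          rw [Finset.sum_comm]
          refine Finset.sum_congr rfl fun F _ => ?_
          simp only [Finset.mul_sum]
          rw [Finset.sum_comm, Finset.sum_congr rfl fun J _ => Finset.sum_comm, Finset.sum_comm]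
          exact Finset.sum_congr rfl fun _ _ => Finset.sum_congr rfl fun _ _ =>
            Finset.sum_congr rfl fun _ _ => by ring
      _ = ∑ K, ∑ J, D.Y C J K A * s K B J :=
          Finset.sum_congr rfl fun K _ => hD.quadratic (s K) (hs K) (hY K) C B K A
      _ = _ := Finset.sum_comm
  have h2 : ∑ F, ∑ G, D.Y F C B G * s G F A = ∑ J, ∑ K, D.Y C J K B * s K A J :=
    Finset.sum_congr rfl fun F _ => Finset.sum_congr rfl fun G _ => by
      rw [hs G F A, hD.symm]
  rw [genTorsion]
  simp only [mul_add, mul_neg, Finset.sum_add_distrib, Finset.sum_neg_distrib, h1, h2, hs C A B]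
  ring

end Torsion

/-! ### Variation of the flat connection -/

section Variation

variable {κ : Type} [Fintype κ] [DecidableEq κ] {n : ℕ}

/-- The flat connection built from a frame `F`, its derivatives `P`, and `Ω`. -/
def flatGamma (tS : Fin n → Matrix κ κ ℝ) (F : Matrix κ κ ℝ) (P : κ → Matrix κ κ ℝ)
    (O : Matrix κ (Fin n) ℝ) (A : κ) : Matrix κ κ ℝ :=
  - ∑ I, F A I • (P I * F⁻¹) + ∑ α, O A α • tS α

/-- The variation of `flatGamma` under variations of `F`, `P` and `O`. -/
def flatGammaVar (tS : Fin n → Matrix κ κ ℝ) (F : Matrix κ κ ℝ) (P : κ → Matrix κ κ ℝ) (A : κ) :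
    Matrix κ κ ℝ × (κ → Matrix κ κ ℝ) × Matrix κ (Fin n) ℝ →ₗ[ℝ] Matrix κ κ ℝ where
  toFun t := - ∑ I, (t.1 A I • (P I * F⁻¹) + F A I • (t.2.1 I * F⁻¹ - P I * F⁻¹ * t.1 * F⁻¹))
    + ∑ α, t.2.2 A α • tS α
  map_add' t t' := by
    simp only [Prod.fst_add, Prod.snd_add, Pi.add_apply, Matrix.add_apply, add_smul, mul_add,
      add_mul, Finset.sum_add_distrib, smul_sub, smul_add, Finset.sum_sub_distrib]
    abel
  map_smul' c t := by
    simp only [Prod.smul_fst, Prod.smul_snd, Pi.smul_apply, Matrix.smul_apply, smul_eq_mul,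
      mul_smul, smul_mul_assoc, mul_smul_comm, RingHom.id_apply, smul_add, smul_neg,
      Finset.smul_sum, smul_sub, smul_comm (F A _) c]

lemma flatGammaVar_apply (tS : Fin n → Matrix κ κ ℝ) (F : Matrix κ κ ℝ) (P : κ → Matrix κ κ ℝ)
    (A : κ) (dF : Matrix κ κ ℝ) (dP : κ → Matrix κ κ ℝ) (dO : Matrix κ (Fin n) ℝ) :
    flatGammaVar tS F P A (dF, dP, dO) = - ∑ I, (dF A I • (P I * F⁻¹)
      + F A I • (dP I * F⁻¹ - P I * F⁻¹ * dF * F⁻¹)) + ∑ α, dO A α • tS α := rfl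

/-- A diffeomorphism-like variation of the frame: the first derivatives of `X` cancel by the
section condition, the second derivatives remain. -/
lemma flatGammaVar_diffeo (tS : Fin n → Matrix κ κ ℝ) {F : Matrix κ κ ℝ} (hF : IsUnit F.det)
    (P : κ → Matrix κ κ ℝ) (A : κ) (dxi Z : Matrix κ κ ℝ) (dX : κ → Matrix κ κ ℝ)
    (hZ : ∀ L, ∑ I, Z L I • P I = 0) :
    flatGammaVar tS F P A (F * (-dxi + Z),
      fun I => P I * (-dxi + Z) + F * dX I + ∑ J, dxi I J • P J, 0)
      = - ∑ I, F A I • (F * dX I * F⁻¹) := by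
  rw [flatGammaVar_apply]
  have h1 : ∀ I, (P I * (-dxi + Z) + F * dX I + ∑ J, dxi I J • P J) * F⁻¹
      - P I * F⁻¹ * (F * (-dxi + Z)) * F⁻¹ = F * dX I * F⁻¹ + ∑ J, dxi I J • (P J * F⁻¹) := by
    intro I
    rw [← mul_assoc (P I * F⁻¹), mul_assoc (P I), nonsing_inv_mul _ hF, mul_one, add_mul, add_mul,
      Finset.sum_mul]
    simp only [smul_mul_assoc]
    abel
  have h2 : ∑ I, (F * (-dxi + Z)) A I • (P I * F⁻¹)
      = - ∑ I, F A I • ∑ J, dxi I J • (P J * F⁻¹) := by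
    have h3 : ∀ L, ∑ I, (-dxi + Z) L I • (P I * F⁻¹) = - ∑ I, dxi L I • (P I * F⁻¹) := fun L => by
      have : ∑ I, Z L I • (P I * F⁻¹) = 0 := by
        simp only [← smul_mul_assoc]
        rw [← Finset.sum_mul, hZ, zero_mul]
      simp only [Matrix.add_apply, Matrix.neg_apply, add_smul, neg_smul, Finset.sum_add_distrib,
        this, add_zero, Finset.sum_neg_distrib]
    simp only [mul_apply, Finset.sum_smul, mul_smul]
    rw [Finset.sum_comm]
    simp only [← Finset.smul_sum, h3, smul_neg, Finset.sum_neg_distrib]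
  simp only [h1, Finset.sum_add_distrib, h2, smul_add, Matrix.zero_apply, zero_smul,
    Finset.sum_const_zero]
  abel

/-- A local `G_S` rotation acts on the flat connection by rotating its three indices; the
derivatives of the parameter cancel between the frame and `Ω`. -/
lemma flatGammaVar_rotate {tS : Fin n → Matrix κ κ ℝ} {f : Fin n → Fin n → Fin n → ℝ}
    (hf : ∀ α β, tS α * tS β - tS β * tS α = ∑ γ, f α β γ • tS γ)
    {F : Matrix κ κ ℝ} (hF : IsUnit F.det)
    (P : κ → Matrix κ κ ℝ) (O : Matrix κ (Fin n) ℝ) (A : κ) (lam : Fin n → ℝ)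
    (dlam : κ → Fin n → ℝ) :
    flatGammaVar tS F P A ((∑ γ, lam γ • tS γ) * F,
      fun I => (∑ γ, dlam I γ • tS γ) * F + (∑ γ, lam γ • tS γ) * P I,
      Matrix.of fun A α => ∑ C, (∑ γ, lam γ • tS γ) A C * O C α
        + ∑ β, ∑ γ, O A β * lam γ * f γ β α + ∑ I, F A I * dlam I α)
      = ∑ C, (∑ γ, lam γ • tS γ) A C • flatGamma tS F P O C
        + (∑ γ, lam γ • tS γ) * flatGamma tS F P O A
        - flatGamma tS F P O A * (∑ γ, lam γ • tS γ) := by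
  rw [flatGammaVar_apply]
  set l := ∑ γ, lam γ • tS γ with hl
  have h1 : ∀ I, ((∑ γ, dlam I γ • tS γ) * F + l * P I) * F⁻¹ - P I * F⁻¹ * (l * F) * F⁻¹
      = ∑ γ, dlam I γ • tS γ + l * (P I * F⁻¹) - P I * F⁻¹ * l := fun I => by
    rw [add_mul, mul_assoc _ F, mul_nonsing_inv _ hF, mul_one, mul_assoc _ (l * F), mul_assoc l F,
      mul_nonsing_inv _ hF, mul_one, mul_assoc l]
  have h2 : ∑ I, (l * F) A I • (P I * F⁻¹) = ∑ C, l A C • ∑ I, F C I • (P I * F⁻¹) := by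
    simp only [mul_apply, Finset.sum_smul, mul_smul]
    rw [Finset.sum_comm]
    simp only [← Finset.smul_sum]
  have h3 : ∑ α, (∑ C, l A C * O C α) • tS α = ∑ C, l A C • ∑ α, O C α • tS α := by
    simp only [Finset.sum_smul, mul_smul]
    rw [Finset.sum_comm]
    simp only [← Finset.smul_sum]
  have h4 : ∑ α, (∑ β, ∑ γ, O A β * lam γ * f γ β α) • tS α
      = l * (∑ β, O A β • tS β) - (∑ β, O A β • tS β) * l := by
    have e : l * (∑ β, O A β • tS β) - (∑ β, O A β • tS β) * l
        = ∑ β, ∑ γ, (O A β * lam γ) • (tS γ * tS β - tS β * tS γ) := by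
      simp only [smul_sub, Finset.sum_sub_distrib]
      congr 1
      · rw [Finset.mul_sum]
        refine Finset.sum_congr rfl fun β _ => ?_
        rw [hl, Finset.sum_mul]
        exact Finset.sum_congr rfl fun γ _ => by rw [smul_mul_smul_comm, mul_comm (lam γ)]
      · rw [Finset.sum_mul]
        refine Finset.sum_congr rfl fun β _ => ?_
        rw [hl, Finset.mul_sum]
        exact Finset.sum_congr rfl fun γ _ => by rw [smul_mul_smul_comm]
    rw [e]
    simp only [hf, Finset.smul_sum, Finset.sum_smul, smul_smul]
    rw [Finset.sum_comm]
    exact Finset.sum_congr rfl fun _ _ => Finset.sum_comm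
  have h5 : ∑ α, (∑ I, F A I * dlam I α) • tS α = ∑ I, F A I • ∑ γ, dlam I γ • tS γ := by
    simp only [Finset.sum_smul, mul_smul]
    rw [Finset.sum_comm]
    simp only [← Finset.smul_sum]
  simp only [of_apply, h1]
  simp only [add_smul, Finset.sum_add_distrib, h2, h3, h4, h5, flatGamma, smul_add,
    smul_sub, smul_neg, Finset.sum_sub_distrib, mul_add, add_mul, mul_neg, neg_mul,
    Finset.sum_neg_distrib]
  simp only [Finset.mul_sum, Finset.sum_mul, mul_smul_comm, smul_mul_assoc]
  abel

end Variation

end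

section

/-! ### Covariance of the generalized torsion -/

section Smooth

variable {κ ι τ : Type} [Fintype κ] [DecidableEq κ]

lemma contDiffAt_pd {g : (κ → ℝ) → ℝ} {y : κ → ℝ} (hg : ContDiffAt ℝ ∞ g y) (J : κ) :
    ContDiffAt ℝ ∞ (pd J g) y :=
  (hg.fderiv_right (m := ∞) (by simp)).clm_apply contDiffAt_const

lemma pd_comm {g : (κ → ℝ) → ℝ} {y : κ → ℝ} (hg : ContDiffAt ℝ ∞ g y) (I J : κ) :
    pd I (pd J g) y = pd J (pd I g) y := by
  have h1 : DifferentiableAt ℝ (fderiv ℝ g) y :=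
    (hg.fderiv_right (m := ∞) (by simp)).differentiableAt (by simp)
  have h2 : ∀ I J : κ, pd I (pd J g) y
      = fderiv ℝ (fderiv ℝ g) y (Pi.single I 1) (Pi.single J 1) := fun I J => by
    show fderiv ℝ (fun z => fderiv ℝ g z (Pi.single J 1)) y (Pi.single I 1) = _
    rw [fderiv_clm_apply h1 (differentiableAt_const _)]
    simp
  rw [h2, h2]
  exact hg.isSymmSndFDerivAt (by
    rw [minSmoothness_of_isRCLikeNormedField]
    exact WithTop.coe_le_coe.2 le_top) _ _

/-- Entrywise smoothness of a matrix-valued function. -/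
def SmoothAt (F : (κ → ℝ) → Matrix ι τ ℝ) (y : κ → ℝ) : Prop :=
  ∀ A B, ContDiffAt ℝ ∞ (fun z => F z A B) y

lemma SmoothAt.diffAt {F : (κ → ℝ) → Matrix ι τ ℝ} {y : κ → ℝ} (hF : SmoothAt F y) : DiffAt F y :=
  fun A B => (hF A B).differentiableAt (by simp)

lemma SmoothAt.pdMat {F : (κ → ℝ) → Matrix ι τ ℝ} {y : κ → ℝ} (hF : SmoothAt F y) (J : κ) :
    SmoothAt (pdMat J F) y := fun A B => contDiffAt_pd (hF A B) J

lemma SmoothAt.pdMat_comm {F : (κ → ℝ) → Matrix ι τ ℝ} {y : κ → ℝ} (hF : SmoothAt F y) (I J : κ) :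
    GenGeom.pdMat I (GenGeom.pdMat J F) y = GenGeom.pdMat J (GenGeom.pdMat I F) y := by
  ext A B
  exact pd_comm (hF A B) I J

end Smooth

section TorsionDeriv

variable {D : DualityDatum} {X : Type*} [NormedAddCommGroup X] [NormedSpace ℝ X]

/-- The generalized torsion is linear in the connection. -/
lemma fderiv_genTorsion {Γ : X → D.Idx → Matrix D.Idx D.Idx ℝ} {x : X}
    (hΓ : ∀ A, DiffAt (fun z => Γ z A) x) (A B C : D.Idx) :
    DifferentiableAt ℝ (fun z => genTorsion D (fun A B C => Γ z A B C) A B C) x ∧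
    ∀ w, fderiv ℝ (fun z => genTorsion D (fun A B C => Γ z A B C) A B C) x w
      = genTorsion D (fun A B C => dirDeriv (fun z => Γ z A) x w B C) A B C := by
  have h : HasFDerivAt (fun z => genTorsion D (fun A B C => Γ z A B C) A B C)
      (fderiv ℝ (fun z => Γ z A B C) x - fderiv ℝ (fun z => Γ z B A C) x
        + ∑ F, ∑ G, D.Y F C B G • fderiv ℝ (fun z => Γ z F A G) x) x := by
    refine HasFDerivAt.add ((hΓ A B C).hasFDerivAt.sub (hΓ B A C).hasFDerivAt) ?_
    exact HasFDerivAt.fun_sum fun F _ => HasFDerivAt.fun_sum fun G _ =>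
      (hΓ F A G).hasFDerivAt.const_mul _
  refine ⟨h.differentiableAt, fun w => ?_⟩
  rw [h.fderiv]
  simp [genTorsion, dirDeriv, _root_.sum_apply]

lemma DiffAt.flatGamma {κ : Type} [Fintype κ] [DecidableEq κ] {n : ℕ}
    (tS : Fin n → Matrix κ κ ℝ) {F : X → Matrix κ κ ℝ} {P : κ → X → Matrix κ κ ℝ}
    {O : X → Matrix κ (Fin n) ℝ} {x : X} (hF : DiffAt F x) (hu : IsUnit (F x).det)
    (hP : ∀ I, DiffAt (P I) x) (hO : DiffAt O x) (A : κ) :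
    DiffAt (fun z => GenGeom.flatGamma tS (F z) (fun I => P I z) (O z) A) x ∧
    ∀ w, dirDeriv (fun z => GenGeom.flatGamma tS (F z) (fun I => P I z) (O z) A) x w
      = flatGammaVar tS (F x) (fun I => P I x) A
        (dirDeriv F x w, fun I => dirDeriv (P I) x w, dirDeriv O x w) := by
  have e : (fun z => GenGeom.flatGamma tS (F z) (fun I => P I z) (O z) A)
      = fun z => (∑ I, (-F z A I) • (P I z * (F z)⁻¹)) + ∑ α, O z A α • tS α := by
    funext z
    simp only [GenGeom.flatGamma, neg_smul, Finset.sum_neg_distrib]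
  have hi := hF.inv hu
  have h1 : ∀ I, DiffAt (fun z => (-F z A I) • (P I z * (F z)⁻¹)) x := fun I =>
    DiffAt.smul (hF A I).fun_neg ((hP I).mul hi)
  have h2 : ∀ α, DiffAt (fun z => O z A α • tS α) x := fun α =>
    DiffAt.smul (hO A α) (DiffAt.const _ _)
  rw [e]
  refine ⟨(DiffAt.sum h1).add (DiffAt.sum h2), fun w => ?_⟩
  rw [dirDeriv_add (DiffAt.sum h1) (DiffAt.sum h2), dirDeriv_sum h1, dirDeriv_sum h2,
    flatGammaVar_apply, ← Finset.sum_neg_distrib]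
  congr 1
  · refine Finset.sum_congr rfl fun I _ => ?_
    rw [dirDeriv_smul (hF A I).fun_neg ((hP I).mul hi), dirDeriv_mul (hP I) hi, dirDeriv_inv hF hu,
      fderiv_fun_neg]
    simp only [_root_.neg_apply, neg_smul, mul_neg, ← sub_eq_add_neg, mul_assoc, dirDeriv, of_apply]
    abel
  · refine Finset.sum_congr rfl fun α _ => ?_
    rw [dirDeriv_smul (hO A α) (DiffAt.const _ _), dirDeriv_const, smul_zero, add_zero]
    rfl

/-- Both the variation and the partial derivatives of the torsion are instances of this
derivative. -/
lemma fderiv_genTorsion_flatGamma {n : ℕ}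
    (tS : Fin n → Matrix D.Idx D.Idx ℝ) {F : X → Matrix D.Idx D.Idx ℝ}
    {P : D.Idx → X → Matrix D.Idx D.Idx ℝ}
    {O : X → Matrix D.Idx (Fin n) ℝ} {x : X} (hF : DiffAt F x) (hu : IsUnit (F x).det)
    (hP : ∀ I, DiffAt (P I) x) (hO : DiffAt O x) (A B C : D.Idx) :
    DifferentiableAt ℝ (fun z => genTorsion D
      (fun A B C => flatGamma tS (F z) (fun I => P I z) (O z) A B C) A B C) x ∧
    ∀ w, fderiv ℝ (fun z => genTorsion D
      (fun A B C => flatGamma tS (F z) (fun I => P I z) (O z) A B C) A B C) x w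
      = genTorsion D (fun A B C => flatGammaVar tS (F x) (fun I => P I x) A
        (dirDeriv F x w, fun I => dirDeriv (P I) x w, dirDeriv O x w) B C) A B C := by
  have h := fderiv_genTorsion (Γ := fun z A => flatGamma tS (F z) (fun I => P I z) (O z) A)
    (fun A => (DiffAt.flatGamma tS hF hu hP hO A).1) A B C
  refine ⟨h.1, fun w => ?_⟩
  rw [h.2 w]
  congr 1
  funext A
  rw [(DiffAt.flatGamma tS hF hu hP hO A).2 w]

end TorsionDeriv

section Covariance

variable {D : DualityDatum} {n : ℕ} {tS : Fin n → Matrix D.Idx D.Idx ℝ}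
  {f : Fin n → Fin n → Fin n → ℝ}
  {E : (D.Idx → ℝ) → Matrix D.Idx D.Idx ℝ} {Om : (D.Idx → ℝ) → Matrix D.Idx (Fin n) ℝ}
  {xi : (D.Idx → ℝ) → D.Idx → ℝ} {lam : (D.Idx → ℝ) → Fin n → ℝ} {y : D.Idx → ℝ}

lemma torsion_eq (hE : IsUnit (E y).det) (A B C : D.Idx) :
    torsion D tS E Om y A B C = genTorsion D (fun A B C =>
      flatGamma tS (E y) (fun I => pdMat I E y) (Om y) A B C) A B C := by
  rw [torsion]
  congr 1
  funext A B C
  exact congrFun (congrFun (flatConn_affineConn hE A) B) C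

lemma pd_torsion (hEs : SmoothAt E y) (hOs : SmoothAt Om y) (hE : IsUnit (E y).det)
    (K A B C : D.Idx) :
    pd K (fun z => torsion D tS E Om z A B C) y
      = genTorsion D (fun A B C => flatGammaVar tS (E y) (fun I => pdMat I E y) A
        (pdMat K E y, fun I => pdMat K (pdMat I E) y, pdMat K Om y) B C) A B C := by
  have h : (fun z => torsion D tS E Om z A B C) =ᶠ[nhds y] fun z => genTorsion D (fun A B C =>
      flatGamma tS (E z) (fun I => pdMat I E z) (Om z) A B C) A B C :=
    (eventually_isUnit_det hEs.diffAt hE).mono fun z hz => torsion_eq hz A B C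
  rw [pd, h.fderiv_eq]
  exact (fderiv_genTorsion_flatGamma tS hEs.diffAt hE (fun I => (hEs.pdMat I).diffAt) hOs.diffAt
    A B C).2 _

/-- Linear variations of the frame and of `Ω` change the torsion by the torsion of the variation
of the flat connection. -/
lemma hasDerivAt_torsion {dE : (D.Idx → ℝ) → Matrix D.Idx D.Idx ℝ}
    {dOm : (D.Idx → ℝ) → Matrix D.Idx (Fin n) ℝ} (hEs : DiffAt E y) (hdE : DiffAt dE y)
    (hE : IsUnit (E y).det) (A B C : D.Idx) :
    HasDerivAt (fun ε : ℝ => torsion D tS (fun z => E z + ε • dE z) (fun z => Om z + ε • dOm z)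
        y A B C)
      (genTorsion D (fun A B C => flatGammaVar tS (E y) (fun I => pdMat I E y) A
        (dE y, fun I => pdMat I dE y, dOm y) B C) A B C) 0 := by
  have hlin : ∀ {ι τ : Type} (M N : Matrix ι τ ℝ), DiffAt (fun ε : ℝ => M + ε • N) 0 ∧
      dirDeriv (fun ε : ℝ => M + ε • N) 0 1 = N := by
    intro ι τ M N
    have h := DiffAt.smul (f := fun ε : ℝ => ε) (x := (0 : ℝ)) differentiableAt_fun_id
      (DiffAt.const N 0)
    refine ⟨(DiffAt.const M 0).add h, ?_⟩
    rw [dirDeriv_add (DiffAt.const M 0) h, dirDeriv_smul differentiableAt_fun_id (DiffAt.const N 0),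
      dirDeriv_const, dirDeriv_const, fderiv_fun_id]
    simp
  have hpd : ∀ (ε : ℝ) I, pdMat I (fun z => E z + ε • dE z) y = pdMat I E y + ε • pdMat I dE y := by
    intro ε I
    have h := DiffAt.smul (f := fun _ : D.Idx → ℝ => ε) (differentiableAt_const ε) hdE
    rw [pdMat, dirDeriv_add hEs h, dirDeriv_smul (f := fun _ => ε) (differentiableAt_const ε) hdE]
    simp [pdMat]
  have hu : IsUnit (E y + (0 : ℝ) • dE y).det := by rwa [zero_smul, add_zero]
  have hev : (fun ε : ℝ => torsion D tS (fun z => E z + ε • dE z) (fun z => Om z + ε • dOm z)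
      y A B C) =ᶠ[nhds 0] fun ε => genTorsion D (fun A B C => flatGamma tS (E y + ε • dE y)
        (fun I => pdMat I E y + ε • pdMat I dE y) (Om y + ε • dOm y) A B C) A B C := by
    refine (eventually_isUnit_det (hlin (E y) (dE y)).1 hu).mono fun ε hε => ?_
    have := torsion_eq (tS := tS) (E := fun z => E z + ε • dE z) (Om := fun z => Om z + ε • dOm z)
      hε A B C
    simp only [hpd] at this
    exact this
  have h := fderiv_genTorsion_flatGamma tS (F := fun ε : ℝ => E y + ε • dE y)
    (P := fun I ε => pdMat I E y + ε • pdMat I dE y) (O := fun ε => Om y + ε • dOm y)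
    (hlin _ _).1 hu (fun I => (hlin _ _).1) (hlin _ _).1 A B C
  have h2 := h.2 1
  simp only [(hlin _ _).2, zero_smul, add_zero] at h2
  rw [← h2]
  exact (h.1.hasDerivAt.congr_of_eventuallyEq hev).congr_deriv fderiv_apply_one_eq_deriv.symm

/-- The matrix `∂_L ξ^I`. -/
def xiMat (xi : (D.Idx → ℝ) → D.Idx → ℝ) (y : D.Idx → ℝ) : Matrix D.Idx D.Idx ℝ :=
  Matrix.of fun L I => pd L (fun z => xi z I) y

/-- The matrix `Y^{IJ}_{KL} ∂_J ξ^K`, with row `L` and column `I`. -/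
def xiYMat (xi : (D.Idx → ℝ) → D.Idx → ℝ) (y : D.Idx → ℝ) : Matrix D.Idx D.Idx ℝ :=
  Matrix.of fun L I => ∑ J, ∑ K, D.Y I J K L * pd J (fun z => xi z K) y

/-- The variation of the frame as transport along `ξ`, right multiplication by the derivatives of
`ξ`, and a rotation. The weight of the frame is such that the divergence of `ξ` drops out. -/
lemma deltaE_eq (z : D.Idx → ℝ) : deltaE D tS E xi lam z
    = ∑ J, xi z J • pdMat J E z + E z * (-xiMat xi z + xiYMat xi z)
      + (∑ γ, lam z γ • tS γ) * E z := by
  ext A I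
  have h1 : ∑ J, ∑ K, ∑ L, D.Y I J K L * pd J (fun z => xi z K) z * E z A L
      = (E z * xiYMat xi z) A I := by
    simp only [mul_apply, xiYMat, of_apply, Finset.mul_sum]
    rw [Finset.sum_congr rfl fun J _ => Finset.sum_comm, Finset.sum_comm]
    exact Finset.sum_congr rfl fun _ _ => Finset.sum_congr rfl fun _ _ =>
      Finset.sum_congr rfl fun _ _ => by ring
  rw [deltaE, of_apply, genLie, h1, mul_add, mul_neg, sub_self, zero_mul, zero_mul, add_zero]
  simp only [Matrix.add_apply, Matrix.neg_apply, Matrix.sum_apply, Matrix.smul_apply, smul_eq_mul]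
  rw [← add_assoc, ← sub_eq_add_neg]
  rfl

/-- The derivative of the variation of the frame, split in the same way. -/
lemma pdMat_deltaE (hEs : SmoothAt E y) (hxi : ∀ I, ContDiffAt ℝ ∞ (fun z => xi z I) y)
    (hlam : ∀ α, ContDiffAt ℝ ∞ (fun z => lam z α) y) :
    DiffAt (deltaE D tS E xi lam) y ∧ ∀ I, pdMat I (deltaE D tS E xi lam) y
    = ∑ J, xi y J • pdMat J (pdMat I E) y
      + (pdMat I E y * (-xiMat xi y + xiYMat xi y)
        + E y * pdMat I (fun z => -xiMat xi z + xiYMat xi z) y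
        + ∑ J, xiMat xi y I J • pdMat J E y)
      + ((∑ γ, pd I (fun z => lam z γ) y • tS γ) * E y + (∑ γ, lam y γ • tS γ) * pdMat I E y) := by
  have hdxi : ∀ J, DifferentiableAt ℝ (fun z => xi z J) y :=
    fun J => (hxi J).differentiableAt (by simp)
  have h1 : ∀ J, DiffAt (fun z => xi z J • pdMat J E z) y := fun J =>
    DiffAt.smul (hdxi J) (hEs.pdMat J).diffAt
  have hX : DiffAt (fun z => -xiMat xi z + xiYMat xi z) y := by
    intro L I
    have hd : ∀ J K, DifferentiableAt ℝ (pd J (fun z => xi z K)) y := fun J K =>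
      (contDiffAt_pd (hxi K) J).differentiableAt (by simp)
    exact (hd L I).fun_neg.fun_add (DifferentiableAt.fun_sum fun J _ =>
      DifferentiableAt.fun_sum fun K _ => (hd J K).const_mul _)
  have hdlam : ∀ γ, DifferentiableAt ℝ (fun z => lam z γ) y :=
    fun γ => (hlam γ).differentiableAt (by simp)
  have h2 : ∀ γ, DiffAt (fun z => lam z γ • tS γ) y := fun γ =>
    DiffAt.smul (hdlam γ) (DiffAt.const _ _)
  have e : deltaE D tS E xi lam = fun z => ∑ J, xi z J • pdMat J E z
      + E z * (-xiMat xi z + xiYMat xi z) + (∑ γ, lam z γ • tS γ) * E z := funext deltaE_eq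
  have d1 := DiffAt.sum h1
  have d2 := hEs.diffAt.mul hX
  have d3 := (DiffAt.sum h2).mul hEs.diffAt
  rw [e]
  refine ⟨(d1.add d2).add d3, fun I => ?_⟩
  rw [pdMat, dirDeriv_add (d1.add d2) d3, dirDeriv_add d1 d2, dirDeriv_sum h1,
    dirDeriv_mul hEs.diffAt hX, dirDeriv_mul (DiffAt.sum h2) hEs.diffAt, dirDeriv_sum h2]
  have e1 : ∀ J, dirDeriv (fun z => xi z J • pdMat J E z) y (Pi.single I 1)
      = xiMat xi y I J • pdMat J E y + xi y J • pdMat J (pdMat I E) y := fun J => by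
    rw [dirDeriv_smul (hdxi J) (hEs.pdMat J).diffAt, hEs.pdMat_comm J I]
    rfl
  have e2 : ∀ γ, dirDeriv (fun z => lam z γ • tS γ) y (Pi.single I 1)
      = pd I (fun z => lam z γ) y • tS γ := fun γ => by
    rw [dirDeriv_smul (hdlam γ) (DiffAt.const _ _), dirDeriv_const, smul_zero, add_zero]
    rfl
  simp only [e1, e2, Finset.sum_add_distrib]
  simp only [pdMat]
  abel

lemma pdMat_xi (hxi : ∀ I, ContDiffAt ℝ ∞ (fun z => xi z I) y) (I L C : D.Idx) :
    pdMat I (fun z => -xiMat xi z + xiYMat xi z) y L C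
      = - pd I (pd L (fun z => xi z C)) y
        + ∑ J, ∑ K, D.Y C J K L * pd I (pd J (fun z => xi z K)) y := by
  have hd : ∀ J K, HasFDerivAt (pd J (fun z => xi z K)) (fderiv ℝ (pd J (fun z => xi z K)) y) y :=
    fun J K => ((contDiffAt_pd (hxi K) J).differentiableAt (by simp)).hasFDerivAt
  have h : HasFDerivAt (fun z => (-xiMat xi z + xiYMat xi z) L C)
      (-fderiv ℝ (pd L (fun z => xi z C)) y
        + ∑ J, ∑ K, D.Y C J K L • fderiv ℝ (pd J (fun z => xi z K)) y) y :=
    (hd L C).fun_neg.fun_add (HasFDerivAt.fun_sum fun J _ => HasFDerivAt.fun_sum fun K _ =>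
      (hd J K).const_mul _)
  rw [pdMat, dirDeriv, of_apply, h.fderiv]
  simp [pd, _root_.sum_apply]

/-- The generalized torsion is covariant under gauge transformations. -/
lemma hasDerivAt_torsion_gauge (hD : D.IsCovariant) (htS : ∀ α, tS α ∈ D.lieAlgebra)
    (hf : ∀ α β, tS α * tS β - tS β * tS α = ∑ γ, f α β γ • tS γ)
    {U : Set (D.Idx → ℝ)} (hy : y ∈ U)
    (hsec : SectionCondition D U (components D E Om xi lam))
    (hEs : SmoothAt E y) (hOs : SmoothAt Om y) (hE : IsUnit (E y).det) (hEG : E y ∈ D.frameGroup)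
    (hxi : ∀ I, ContDiffAt ℝ ∞ (fun z => xi z I) y)
    (hlam : ∀ α, ContDiffAt ℝ ∞ (fun z => lam z α) y) (A B C : D.Idx) :
    HasDerivAt (fun ε : ℝ => torsion D tS (fun z => E z + ε • deltaE D tS E xi lam z)
        (fun z => Om z + ε • deltaOm D tS f E Om xi lam z) y A B C)
      (covariantVariation D tS xi lam (torsion D tS E Om) y A B C) 0 := by
  set l := ∑ γ, lam y γ • tS γ with hl
  have hlmem : l ∈ D.lieAlgebra :=
    Submodule.sum_mem _ fun γ _ => Submodule.smul_mem _ _ (htS γ)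
  have hEmem : ∀ A I, (fun y => E y A I) ∈ components D E Om xi lam :=
    fun A I => Or.inl ⟨A, I, rfl⟩
  have hximem : ∀ I, (fun y => xi y I) ∈ components D E Om xi lam :=
    fun I => Or.inr (Or.inr (Or.inl ⟨I, rfl⟩))
  -- The section condition for a component of `E` and one of `ξ`.
  have hZ : ∀ L, ∑ I, xiYMat xi y L I • pdMat I E y = 0 := fun L => by
    ext A B
    simp only [Matrix.sum_apply, Matrix.smul_apply, smul_eq_mul, xiYMat, of_apply,
      Matrix.zero_apply, Finset.sum_mul]
    rw [Finset.sum_congr rfl fun I _ => Finset.sum_comm, Finset.sum_comm]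
    refine Finset.sum_eq_zero fun K _ => ?_
    rw [← hsec.1 _ (hEmem A B) _ (hximem K) y hy K L]
    exact Finset.sum_congr rfl fun I _ => Finset.sum_congr rfl fun J _ => by
      rw [mul_assoc, mul_comm (pd J _ y)]
      rfl
  have hδE := pdMat_deltaE (tS := tS) hEs hxi hlam
  -- The variation of all data as the sum of transport, frame transformation and rotation.
  have hT : (deltaE D tS E xi lam y, (fun I => pdMat I (deltaE D tS E xi lam) y),
        deltaOm D tS f E Om xi lam y)
      = (∑ K, xi y K • (pdMat K E y, (fun I => pdMat K (pdMat I E) y), pdMat K Om y))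
        + (E y * (-xiMat xi y + xiYMat xi y), (fun I =>
            pdMat I E y * (-xiMat xi y + xiYMat xi y)
              + E y * pdMat I (fun z => -xiMat xi z + xiYMat xi z) y
              + ∑ J, xiMat xi y I J • pdMat J E y), 0)
        + (l * E y, (fun I => (∑ γ, pd I (fun z => lam z γ) y • tS γ) * E y + l * pdMat I E y),
            Matrix.of fun A α => ∑ C, l A C * Om y C α
              + ∑ β, ∑ γ, Om y A β * lam y γ * f γ β α
              + ∑ I, E y A I * pd I (fun z => lam z α) y) := by
    refine Prod.ext ?_ (Prod.ext ?_ ?_)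
    · simp only [Prod.fst_add, Prod.fst_sum, Prod.smul_fst]
      exact deltaE_eq y
    · funext I
      simp only [Prod.fst_add, Prod.snd_add, Prod.fst_sum, Prod.snd_sum, Prod.smul_fst,
        Prod.smul_snd, Pi.add_apply, Finset.sum_apply, Pi.smul_apply]
      exact hδE.2 I
    · ext A α
      simp only [Prod.snd_add, Prod.snd_sum, Prod.smul_snd, Matrix.add_apply, Matrix.sum_apply,
        Matrix.smul_apply, smul_eq_mul, Matrix.zero_apply, add_zero, of_apply, ← add_assoc]
      rfl
  have hvar : (fun A B C => flatGammaVar tS (E y) (fun I => pdMat I E y) A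
        (deltaE D tS E xi lam y, (fun I => pdMat I (deltaE D tS E xi lam) y),
          deltaOm D tS f E Om xi lam y) B C)
      = fun A B C => (∑ K, xi y K * flatGammaVar tS (E y) (fun I => pdMat I E y) A
          (pdMat K E y, (fun I => pdMat K (pdMat I E) y), pdMat K Om y) B C
        + (-1) * conj (E y) (fun I L C =>
            pdMat I (fun z => -xiMat xi z + xiYMat xi z) y L C) A B C)
        + rotate l (fun A B C => flatGamma tS (E y) (fun I => pdMat I E y) (Om y) A B C) A B C := by
    funext A B C
    rw [hT, map_add, map_add, map_sum, flatGammaVar_diffeo tS hE _ A _ _ _ hZ,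
      flatGammaVar_rotate hf hE, conj_eq_sum, ← hl]
    simp only [map_smul, Matrix.add_apply, Matrix.sub_apply, Matrix.neg_apply, Matrix.sum_apply,
      Matrix.smul_apply, smul_eq_mul, neg_one_mul, rotate, mul_apply, of_apply, ← add_sub_assoc]
  have hmain := hasDerivAt_torsion (tS := tS) (Om := Om) (dOm := deltaOm D tS f E Om xi lam)
    hEs.diffAt hδE.1 hE A B C
  rw [hvar, genTorsion_add, genTorsion_add, genTorsion_sum, genTorsion_mul,
    genTorsion_rotate hD hlmem] at hmain
  -- The second derivatives of `ξ` have no generalized torsion: frames preserve the Y-tensor, and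
  -- in curved indices this is the quadratic identity.
  have hzero : genTorsion D (fun A B C => conj (E y) (fun I L C =>
      pdMat I (fun z => -xiMat xi z + xiYMat xi z) y L C) A B C) A B C = 0 := by
    have h0 : genTorsion D (fun I L C =>
        pdMat I (fun z => -xiMat xi z + xiYMat xi z) y L C) = fun _ _ _ => 0 := by
      funext I L C
      simp only [pdMat_xi hxi]
      exact genTorsion_eq_zero_of_quadratic hD
        (s := fun K I J => pd I (pd J (fun z => xi z K)) y)
        (fun K I J => pd_comm (hxi K) I J) (fun K P Q => hsec.2 _ (hximem K) y hy P Q) I L C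
    have h1 := DualityDatum.genTorsion_conj hE (hD.frame _ hEG) (fun I L C =>
        pdMat I (fun z => -xiMat xi z + xiYMat xi z) y L C)
    rw [h0] at h1
    have h2 := congrFun (congrFun (congrFun h1 A) B) C
    simp only [conj, mul_zero, zero_mul, Finset.sum_const_zero] at h2
    exact h2
  rw [hzero, mul_zero, add_zero] at hmain
  refine hmain.congr_deriv ?_
  have ht : genTorsion D (fun A B C => flatGamma tS (E y) (fun I => pdMat I E y) (Om y) A B C)
      = torsion D tS E Om y := by
    funext A B C
    exact (torsion_eq hE A B C).symm
  have hsum : ∑ K, genTorsion D (fun A B C => xi y K *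
      flatGammaVar tS (E y) (fun I => pdMat I E y) A
      (pdMat K E y, (fun I => pdMat K (pdMat I E) y), pdMat K Om y) B C) A B C
      = ∑ K, xi y K * pd K (fun z => torsion D tS E Om z A B C) y :=
    Finset.sum_congr rfl fun K _ => by
      rw [pd_torsion hEs hOs hE]
      exact genTorsion_mul _ _ _ _ _
  rw [hsum, ht, rotate, ← add_sub_assoc, ← add_assoc]
  rfl

end Covariance

end

end GenGeom

end

open GenGeom in
theorem mainTheorem3 (G : DualityGroup) (n : ℕ)
    (tS : Fin n → Matrix G.datum.Idx G.datum.Idx ℝ) (f : Fin n → Fin n → Fin n → ℝ)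
    (htS : ∀ α, tS α ∈ G.datum.lieAlgebra) (hlin : LinearIndependent ℝ tS)
    (hf : ∀ α β, tS α * tS β - tS β * tS α = ∑ γ, f α β γ • tS γ)
    (U : Set (G.datum.Idx → ℝ)) (hU : IsOpen U)
    (E : (G.datum.Idx → ℝ) → Matrix G.datum.Idx G.datum.Idx ℝ)
    (hE : ∀ A I, ContDiffOn ℝ ∞ (fun y => E y A I) U)
    (hEG : ∀ y ∈ U, E y ∈ G.datum.frameGroup)
    (Om : (G.datum.Idx → ℝ) → Matrix G.datum.Idx (Fin n) ℝ)
    (hOm : ∀ A α, ContDiffOn ℝ ∞ (fun y => Om y A α) U) :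
    (∀ Gam : (G.datum.Idx → ℝ) → G.datum.Idx → G.datum.Idx → G.datum.Idx → ℝ,
      (∀ y ∈ U, VielbeinPostulate G.datum tS E Om Gam y) ↔
        ∀ y ∈ U, ∀ I K J, Gam y I K J = affineConn G.datum tS E Om y I K J) ∧
    (∀ (S : Set (Fin n → ℝ)) (v : (Fin n → ℝ) → Matrix (Fin n) (Fin n) ℝ),
      IsGroupFrame G.datum tS f S v → ∀ s ∈ S, ∀ y ∈ U, ∀ A B C : G.datum.Idx,
        untwistedFlux G.datum tS f v E Om (Sum.elim s y) (Sum.inr A) (Sum.inr B) (Sum.inr C)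
          = torsion G.datum tS E Om y A B C) ∧
    (∀ (xi : (G.datum.Idx → ℝ) → G.datum.Idx → ℝ) (lam : (G.datum.Idx → ℝ) → Fin n → ℝ),
      (∀ I, ContDiffOn ℝ ∞ (fun y => xi y I) U) → (∀ α, ContDiffOn ℝ ∞ (fun y => lam y α) U) →
      SectionCondition G.datum U (components G.datum E Om xi lam) →
      ∀ y ∈ U, ∀ A B C : G.datum.Idx,
        HasDerivAt
          (fun ε : ℝ => torsion G.datum tS
            (fun z => E z + ε • deltaE G.datum tS E xi lam z)
            (fun z => Om z + ε • deltaOm G.datum tS f E Om xi lam z) y A B C)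
          (covariantVariation G.datum tS xi lam (torsion G.datum tS E Om) y A B C) 0) := by
  have hD : G.datum.IsCovariant := G.isCovariant
  have hu : ∀ y ∈ U, IsUnit (E y).det := fun y hy => hD.isUnit_det _ (hEG y hy)
  have hEs : ∀ y ∈ U, SmoothAt E y := fun y hy A I => (hE A I).contDiffAt (hU.mem_nhds hy)
  have hOs : ∀ y ∈ U, SmoothAt Om y := fun y hy A α => (hOm A α).contDiffAt (hU.mem_nhds hy)
  refine ⟨fun Gam => forall₂_congr fun y hy => vielbeinPostulate_iff Gam (hu y hy), ?_, ?_⟩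
  · intro S v hv s hs y hy A B C
    exact untwistedFlux_eq_torsion hD htS hv hs (hu y hy) (hEs y hy).diffAt A B C
  · intro xi lam hxi hlam hsec y hy A B C
    exact hasDerivAt_torsion_gauge hD htS hf hy hsec (hEs y hy) (hOs y hy) (hu y hy) (hEG y hy)
      (fun I => (hxi I).contDiffAt (hU.mem_nhds hy))
      (fun α => (hlam α).contDiffAt (hU.mem_nhds hy)) A B C
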